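/- **Setting.** A *lattice* in the plane is a discrete additive subgroup of $\mathbb R^2$ containing two linearly independent vectors. Let $P$ be a (nondegenerate) centrally symmetric convex polygon with $2n$ sides, $n\ge 2$, given by its vertices $v_0,\dots,v_{2n-1}$ in counterclockwise order (indices modulo $2n$). For $j=0,\dots,n-1$ let $e_j=v_{j+1}-v_j$, and let $\tau_j=v_{j+n+1}-v_j$ be the translation vector carrying the edge $[v_j,v_{j+1}]$ to the opposite edge. We say that $P$ *tiles multiply* with a lattice $L$ if for some integer $k\ge 1$ almost every point of the plane lies in exactly $k$ of the translates $P+\ell$, $\ell\in L$. Let (A1) be the condition $\tau_j\in L$. For $J\subseteq[n]=\{0,\dots,n-1\}$ put $T(J)=\operatorname{span}_{\mathbb Z}\{\tau_j: j\in J\}$ and $E(J)=\operatorname{span}_{\mathbb Z}\{e_j: j\in J\}$. A point $p$ is *commensurable* with a group $L$ if $mp\in L$ for some integer $m\ge1$. $P$ is in *Class A* if it tiles multiply with some lattice and, for every lattice with which it tiles multiply, (A1) holds for exactly one index $j$. $P$ is in *Class B* if it tiles multiply with some lattice for which (A1) holds for at least two indices. **Theorem.** (i) For every such $P$: $P$ tiles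 multiply with some lattice if and only if it is in Class A or in Class B, and it is never in both. * $P$ is in Class A if and only if for some $j$ the group $L=\operatorname{span}_{\mathbb Z}(\{\tau_j\}\cup\{e_i:i\ne j\})$ is a lattice and, for every $i\neq j$, the line $\tau_i+\mathbb R e_i$ contains a point commensurable with $L$ while $\tau_i$ is incommensurable with $L$. * $P$ is in Class B if and only if for some $J\subseteq [n]$ that is maximal with the property that $T(J)$ is discrete, the group $L=T(J)+E([n]\setminus J)$ is discrete and, for every $j\notin J$, the line $\tau_j+\mathbb R e_j$ contains a point commensurable with $L$. * Any two distinct indices lie in exactly one set $J$ that is maximal with the property that $T(J)$ is discrete, and there are at most $n^2$ such maximal sets. (ii) There is an algorithm, on a random access machine that stores real numbers and performs, each in one unit of time, the four arithmetic operations, zero tests and tests whether a number is rational (together with addition, subtraction and comparison of natural numbers held in index registers, through which number cells are addressed), which, given $n$ and the coordinates of the vertices of any such $P$, decides in time polynomial in $n$ whether $P$ tiles multiply with some lattice, and reports whether it is in Class A, in Class B, or in neither. (iii) Let $a$ be a fixed real algebraic number of degree $d$. There is an algorithm, on a random access machine that stores integers and is charged for the number of binary digits of the numbers and addresses it handles (quadratically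 for arithmetic operations), which solves the same problem for all such $P$ with vertex coordinates in $\mathbb Q(a)$, in time polynomial in the length of the input. Here each coordinate is given as $x_0+x_1a+\dots+x_{d-1}a^{d-1}$, each rational $x_k$ as a numerator and a nonzero denominator, and the length of the input is the total number of binary digits of these integers plus one for each integer. -/

import Mathlib

open MeasureTheory

/-! ## Lattices and multiple tilings of the plane -/

/-- The plane, with its usual topology and Lebesgue measure. -/
abbrev Plane : Type := ℝ × ℝ

/-- A lattice in the plane: a discrete additive subgroup containing two linearly
independent vectors. -/
def IsPlaneLattice (L : Submodule ℤ Plane) : Prop :=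
  DiscreteTopology L ∧ ∃ a ∈ L, ∃ b ∈ L, LinearIndependent ℝ ![a, b]

/-- `P + L` is a multiple tiling: for some level `k ≥ 1`, almost every point of the plane
lies in exactly `k` of the translates `P + ℓ`, `ℓ ∈ L`. -/
def IsMultipleTiling (P : Set Plane) (L : Submodule ℤ Plane) : Prop :=
  ∃ k : ℕ, 1 ≤ k ∧ ∀ᵐ x : Plane, {l : Plane | l ∈ L ∧ x - l ∈ P}.encard = (k : ℕ∞)

/-- The point `p` is commensurable with `L`: a positive integer multiple of `p` is in `L`. -/
def IsCommensurableWith (p : Plane) (L : Submodule ℤ Plane) : Prop :=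
  ∃ m : ℕ, 0 < m ∧ m • p ∈ L

/-! ## Symmetric convex polygons -/

/-- Twice the signed area of the triangle with sides `a`, `b` from a common vertex. -/
def cross (a b : Plane) : ℝ := a.1 * b.2 - a.2 * b.1

/-- `v 0, v 1, …, v (2n-1)` are the vertices of a (nondegenerate) centrally symmetric convex
polygon with `2n` sides, in counterclockwise order: every vertex lies strictly to the left of
every directed edge `v i → v (i+1)` that it is not an end of, and opposite vertices are
exchanged by the reflection in a centre `c`. -/
structure IsSymmConvexPolygon (n : ℕ) (v : ZMod (2 * n) → Plane) : Prop where
  two_le : 2 ≤ n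
  convex : ∀ i k : ZMod (2 * n), k ≠ i → k ≠ i + 1 → 0 < cross (v (i + 1) - v i) (v k - v i)
  symm : ∃ c : Plane, ∀ i : ZMod (2 * n), v i + v (i + (n : ZMod (2 * n))) = c + c

/-- The polygon (with its interior) whose vertices are the `v i`. -/
def polygon {n : ℕ} (v : ZMod (2 * n) → Plane) : Set Plane :=
  convexHull ℝ (Set.range v)

/-- The edge vector `e_j`, `j = 0, …, n-1`; the edge `e_j` is the segment `[v j, v (j+1)]`. -/
def edgeVec {n : ℕ} (v : ZMod (2 * n) → Plane) (j : Fin n) : Plane :=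
  v (((j : ℕ) + 1 : ℕ) : ZMod (2 * n)) - v ((j : ℕ) : ZMod (2 * n))

/-- The vector `τ_j` of the translation that carries the edge `[v j, v (j+1)]` to the opposite
edge `[v (j+n), v (j+n+1)]`; it carries `v j` to `v (j+n+1)` and `v (j+1)` to `v (j+n)`. -/
def transVec {n : ℕ} (v : ZMod (2 * n) → Plane) (j : Fin n) : Plane :=
  v (((j : ℕ) + n + 1 : ℕ) : ZMod (2 * n)) - v ((j : ℕ) : ZMod (2 * n))

/-- `P + L` is a multiple tiling for some lattice `L`. -/
def TilesMultiply {n : ℕ} (v : ZMod (2 * n) → Plane) : Prop :=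
  ∃ L : Submodule ℤ Plane, IsPlaneLattice L ∧ IsMultipleTiling (polygon v) L

/-- Class A: `P` tiles multiply with some lattice, and for all lattices with which it does,
condition (A1), `τ_j ∈ L`, holds for exactly one index `j`. -/
def InClassA {n : ℕ} (v : ZMod (2 * n) → Plane) : Prop :=
  TilesMultiply v ∧
    ∀ L : Submodule ℤ Plane, IsPlaneLattice L → IsMultipleTiling (polygon v) L →
      ∃! j : Fin n, transVec v j ∈ L

/-- Class B: for some lattice with which `P` tiles multiply, condition (A1), `τ_j ∈ L`, holds
for at least two indices `j`. -/
def InClassB {n : ℕ} (v : ZMod (2 * n) → Plane) : Prop :=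
  ∃ L : Submodule ℤ Plane, IsPlaneLattice L ∧ IsMultipleTiling (polygon v) L ∧
    ∃ i j : Fin n, i ≠ j ∧ transVec v i ∈ L ∧ transVec v j ∈ L

/-! ## The groups `E(J)`, `T(J)` and the tests for the two classes -/

/-- `E(J)`, the additive group generated by the `e_j`, `j ∈ J`. -/
def edgeGroup {n : ℕ} (v : ZMod (2 * n) → Plane) (J : Finset (Fin n)) : Submodule ℤ Plane :=
  Submodule.span ℤ (edgeVec v '' (J : Set (Fin n)))

/-- `T(J)`, the additive group generated by the `τ_j`, `j ∈ J`. -/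
def transGroup {n : ℕ} (v : ZMod (2 * n) → Plane) (J : Finset (Fin n)) : Submodule ℤ Plane :=
  Submodule.span ℤ (transVec v '' (J : Set (Fin n)))

/-- The group `T(J) + E([n] \ J)`. -/
def mixedGroup {n : ℕ} (v : ZMod (2 * n) → Plane) (J : Finset (Fin n)) : Submodule ℤ Plane :=
  transGroup v J ⊔ edgeGroup v Jᶜ

/-- The straight line `τ_j + ℝ e_j` contains a point commensurable with `L`. -/
def LineCommensurable {n : ℕ} (v : ZMod (2 * n) → Plane) (L : Submodule ℤ Plane)
    (j : Fin n) : Prop :=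
  ∃ r : ℝ, IsCommensurableWith (transVec v j + r • edgeVec v j) L

/-- `J` is maximal with the property that `T(J)` is discrete. -/
def IsMaxDiscrete {n : ℕ} (v : ZMod (2 * n) → Plane) (J : Finset (Fin n)) : Prop :=
  Maximal (fun J' : Finset (Fin n) => DiscreteTopology (transGroup v J')) J

/-- The test for Class A: for some `j`, the group `L` generated by `τ_j` and the `e_i`, `i ≠ j`,
is a lattice, and for all `i ≠ j` the line `τ_i + ℝ e_i` contains a point commensurable with `L`
while `τ_i` is itself incommensurable with `L`. -/
def PassesTestA {n : ℕ} (v : ZMod (2 * n) → Plane) : Prop :=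
  ∃ j : Fin n, IsPlaneLattice (mixedGroup v {j}) ∧
    ∀ i : Fin n, i ≠ j → LineCommensurable v (mixedGroup v {j}) i ∧
      ¬ IsCommensurableWith (transVec v i) (mixedGroup v {j})

/-- The test for Class B: for some `J` maximal with the property that `T(J)` is discrete, the
group `L = T(J) + E([n] \ J)` is discrete, and for all `j ∉ J` the line `τ_j + ℝ e_j` contains a
point commensurable with `L`. -/
def PassesTestB {n : ℕ} (v : ZMod (2 * n) → Plane) : Prop :=
  ∃ J : Finset (Fin n), IsMaxDiscrete v J ∧ DiscreteTopology (mixedGroup v J) ∧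
    ∀ j : Fin n, j ∉ J → LineCommensurable v (mixedGroup v J) j

/-! ## Random access machines with numbers in a ring, and their running time -/

/-- The four arithmetic operations. -/
inductive ArithOp : Type
  | add | sub | mul | div

/-- The value of an arithmetic operation. (Division is that of `R`: exact division for `ℝ`,
division with remainder for `ℤ`; division by zero gives zero.) -/
def ArithOp.apply {R : Type} [CommRing R] [Div R] : ArithOp → R → R → R
  | .add, x, y => x + y
  | .sub, x, y => x - y
  | .mul, x, y => x * y
  | .div, x, y => x / y

/-- The memory: index registers `idx 0, idx 1, …` holding natural numbers, and number cells
`num 0, num 1, …` holding elements of `R`, which are addressed through index registers. -/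
structure Memory (R : Type) where
  idx : ℕ → ℕ
  num : ℕ → R

/-- What a machine may branch on. -/
inductive Cond : Type
  /-- `idx a < idx b` -/
  | lt (a b : ℕ)
  /-- `num (idx a) = 0` -/
  | zero (a : ℕ)
  /-- `num (idx a)` satisfies the special predicate of the number model -/
  | special (a : ℕ)

/-- Programs. They do not contain elements of `R` other than integer constants. -/
inductive Program : Type
  /-- `idx a := c` -/
  | idxConst (a c : ℕ)
  /-- `idx a := idx b + idx c` -/
  | idxAdd (a b c : ℕ)
  /-- `idx a := idx b - idx c` (zero if this is negative) -/
  | idxSub (a b c : ℕ)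
  /-- `num (idx a) := z` -/
  | numConst (a : ℕ) (z : ℤ)
  /-- `num (idx a) := op (num (idx b)) (num (idx c))` -/
  | numOp (op : ArithOp) (a b c : ℕ)
  /-- first `p`, then `q` -/
  | seq (p q : Program)
  /-- if `c` then `p` else `q` -/
  | branch (c : Cond) (p q : Program)
  /-- while `c` do `p` -/
  | loop (c : Cond) (p : Program)

/-- A number model: the sizes of indices and numbers that determine the cost of the
instructions, and the special predicate of numbers on which programs may branch. -/
structure NumberModel (R : Type) where
  idxSize : ℕ → ℕ
  numSize : R → ℕ
  special : R → Prop

/-- Arbitrary real numbers; every instruction costs one unit of time, and rationality of a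
number can be tested at this cost. -/
def realModel : NumberModel ℝ where
  idxSize _ := 0
  numSize _ := 0
  special x := ∃ q : ℚ, (q : ℝ) = x

/-- Integers of finite size, where sizes are numbers of binary digits; positivity can be
tested. -/
def integerModel : NumberModel ℤ where
  idxSize a := Nat.size a
  numSize z := Nat.size z.natAbs
  special z := 0 < z

section Machine

variable {R : Type} [CommRing R] [Div R] (M : NumberModel R)

/-- Whether a condition holds in a given memory. -/
def Cond.Holds : Cond → Memory R → Prop
  | .lt a b, s => s.idx a < s.idx b
  | .zero a, s => s.num (s.idx a) = 0
  | .special a, s => M.special (s.num (s.idx a))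

/-- The time needed to evaluate a condition. -/
def Cond.cost : Cond → Memory R → ℕ
  | .lt a b, s => 1 + M.idxSize (s.idx a) + M.idxSize (s.idx b)
  | .zero a, s => 1 + M.idxSize (s.idx a) + M.numSize (s.num (s.idx a))
  | .special a, s => 1 + M.idxSize (s.idx a) + M.numSize (s.num (s.idx a))

/-- `Runs M p s s' t`: started with memory `s`, the program `p` halts with memory `s'` after
time `t`. An arithmetic operation takes time quadratic in the size of its operands; the sizes
of the addresses are charged, too. -/
inductive Runs : Program → Memory R → Memory R → ℕ → Prop
  | idxConst (a c : ℕ) (s : Memory R) :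
      Runs (.idxConst a c) s ⟨Function.update s.idx a c, s.num⟩ (1 + M.idxSize c)
  | idxAdd (a b c : ℕ) (s : Memory R) :
      Runs (.idxAdd a b c) s ⟨Function.update s.idx a (s.idx b + s.idx c), s.num⟩
        (1 + M.idxSize (s.idx b) + M.idxSize (s.idx c))
  | idxSub (a b c : ℕ) (s : Memory R) :
      Runs (.idxSub a b c) s ⟨Function.update s.idx a (s.idx b - s.idx c), s.num⟩
        (1 + M.idxSize (s.idx b) + M.idxSize (s.idx c))
  | numConst (a : ℕ) (z : ℤ) (s : Memory R) :
      Runs (.numConst a z) s ⟨s.idx, Function.update s.num (s.idx a) (z : R)⟩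
        (1 + M.idxSize (s.idx a) + M.numSize (z : R))
  | numOp (op : ArithOp) (a b c : ℕ) (s : Memory R) :
      Runs (.numOp op a b c) s
        ⟨s.idx, Function.update s.num (s.idx a)
          (op.apply (s.num (s.idx b)) (s.num (s.idx c)))⟩
        (1 + M.idxSize (s.idx a) + M.idxSize (s.idx b) + M.idxSize (s.idx c)
          + (M.numSize (s.num (s.idx b)) + M.numSize (s.num (s.idx c))) ^ 2)
  | seq {p q : Program} {s s' s'' : Memory R} {t t' : ℕ} :
      Runs p s s' t → Runs q s' s'' t' → Runs (.seq p q) s s'' (t + t')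
  | branchTrue {c : Cond} {p q : Program} {s s' : Memory R} {t : ℕ} :
      c.Holds M s → Runs p s s' t → Runs (.branch c p q) s s' (c.cost M s + t)
  | branchFalse {c : Cond} {p q : Program} {s s' : Memory R} {t : ℕ} :
      ¬ c.Holds M s → Runs q s s' t → Runs (.branch c p q) s s' (c.cost M s + t)
  | loopTrue {c : Cond} {p : Program} {s s' s'' : Memory R} {t t' : ℕ} :
      c.Holds M s → Runs p s s' t → Runs (.loop c p) s' s'' t' →
        Runs (.loop c p) s s'' (c.cost M s + t + t')
  | loopFalse {c : Cond} {p : Program} {s : Memory R} :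
      ¬ c.Holds M s → Runs (.loop c p) s s (c.cost M s)

/-- Programs are deterministic: there is at most one result and one running time. -/
theorem Runs.unique {p : Program} {s s₁ s₂ : Memory R} {t₁ t₂ : ℕ}
    (h₁ : Runs M p s s₁ t₁) (h₂ : Runs M p s s₂ t₂) : s₁ = s₂ ∧ t₁ = t₂ := by
  induction h₁ generalizing s₂ t₂ with
  | idxConst | idxAdd | idxSub | numConst | numOp => cases h₂; exact ⟨rfl, rfl⟩
  | seq _ _ ih ih' =>
    cases h₂ with
    | seq k k' =>
      obtain ⟨rfl, rfl⟩ := ih k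
      obtain ⟨rfl, rfl⟩ := ih' k'
      exact ⟨rfl, rfl⟩
  | branchTrue hc _ ih =>
    cases h₂ with
    | branchTrue _ k => obtain ⟨rfl, rfl⟩ := ih k; exact ⟨rfl, rfl⟩
    | branchFalse hn _ => exact absurd hc hn
  | branchFalse hn _ ih =>
    cases h₂ with
    | branchTrue hc _ => exact absurd hc hn
    | branchFalse _ k => obtain ⟨rfl, rfl⟩ := ih k; exact ⟨rfl, rfl⟩
  | loopTrue hc _ _ ih ih' =>
    cases h₂ with
    | loopTrue _ k k' =>
      obtain ⟨rfl, rfl⟩ := ih k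
      obtain ⟨rfl, rfl⟩ := ih' k'
      exact ⟨rfl, rfl⟩
    | loopFalse hn => exact absurd hc hn
  | loopFalse hn =>
    cases h₂ with
    | loopTrue hc _ _ => exact absurd hc hn
    | loopFalse _ => exact ⟨rfl, rfl⟩

end Machine

/-- The initial memory: `n` is in index register `0`, the input `w 0, …, w (len - 1)` is in the
first `len` number cells, and everything else is zero. -/
def inputMemory {R : Type} [Zero R] (n len : ℕ) (w : ℕ → R) : Memory R where
  idx a := if a = 0 then n else 0
  num a := if a < len then w a else 0

/-- The final memory `s` holds, in index register `0`, the answer for the polygon with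
vertices `v`: `1` if it is in Class A, `2` if it is in Class B, and `0` if it does not tile
multiply with any lattice. -/
def HoldsAnswer {R : Type} {n : ℕ} (v : ZMod (2 * n) → Plane) (s : Memory R) : Prop :=
  (s.idx 0 = 1 ↔ InClassA v) ∧ (s.idx 0 = 2 ↔ InClassB v) ∧ (s.idx 0 = 0 ↔ ¬ TilesMultiply v)

/-- The sequence of the coordinates of the vertices, `x_0, y_0, x_1, y_1, …`. -/
def coordSeq {n : ℕ} (v : ZMod (2 * n) → Plane) (a : ℕ) : ℝ :=
  if a % 2 = 0 then (v ((a / 2 : ℕ) : ZMod (2 * n))).1 else (v ((a / 2 : ℕ) : ZMod (2 * n))).2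

/-- The integers `w 0, …, w (8nd - 1)` represent the polygon with vertices `v` over `ℚ(α)`, where
`α` has degree `d`: each of the `4n` coordinates is given as `x_0 + x_1 α + ⋯ + x_{d-1} α^{d-1}`,
and each rational `x_k` as a numerator followed by a nonzero denominator. -/
def Represents (α : ℝ) (d : ℕ) {n : ℕ} (w : ℕ → ℤ) (v : ZMod (2 * n) → Plane) : Prop :=
  ∀ a < 4 * n,
    (∀ k < d, w (2 * (a * d + k) + 1) ≠ 0) ∧
    coordSeq v a =
      ∑ k ∈ Finset.range d,
        ((w (2 * (a * d + k)) : ℝ) / (w (2 * (a * d + k) + 1) : ℝ)) * α ^ k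

/-- The length of the input `w 0, …, w (len - 1)`: its total number of binary digits, plus one
for each integer. -/
def bitLength (len : ℕ) (w : ℕ → ℤ) : ℕ :=
  ∑ a ∈ Finset.range len, (1 + Nat.size (w a).natAbs)

/-! The heart of the proof is a criterion for a discrete group `L` (`isMultipleTiling_iff`): `P`
tiles multiply with `L` if and only if, for every `j`, either `τ_j ∈ L`, or `e_j ∈ L` and the line
`τ_j + ℝ e_j` meets `L`. When a point crosses the boundaries of the translates transversally, away
from their vertices, the number of translates containing it changes by a signed count of the
translated edges at the crossing, and opposite edges have opposite signs (`count_jump`). So the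
number is almost everywhere constant if every point that is no vertex of a translate is on as many
translates of an edge as of the opposite edge; conversely, constancy forces this equality at points
that are on no edge of another direction. Comparing the two counts along the line of an edge yields
the criterion.

Any two of the `τ_i` are linearly independent. If a discrete group contains `τ_i` and `τ_j`, all of
it lies in their rational span `W`; conversely, finitely many vectors of `W` generate a discrete
group. Hence Class B means that, for some `i ≠ j`, the criterion holds with `W` in place of `L`
(`inClassB_iff`). The maximal `J` with discrete `T(J)` are the sets of all `k` with `τ_k ∈ W`, and
the test for Class B says the same as this condition (`passesTestB_iff`).

Class A is in fact empty, and the test for it always fails. Let `n ≥ 3` and let at most one `τ_j` be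
in `L`. Then all other edges are in `L`. As `τ_m` is a combination of the edges other than `e_m`
with coefficients `±1`, the line conditions put `e_j + r_m e_m` into the rational span of two of
these edges, for every `m ≠ j`. Two such conditions force `e_j` into this plane, too
(`mem_ratSpan_of_forall_ne`). So all `τ_m` together generate a discrete group, which puts `P` in
Class B. For `n = 2` every `P` is in Class B.

The algorithm therefore only decides whether there are `i ≠ j` such that all `k` satisfy the
condition relative to `W`. By Cramer's rule this is a fixed formula about rationality of ratios of
cross products. A compiler turns such formulas into programs: expressions have fixed size, so
numbers grow by a constant factor only, and each quantifier is a loop over `n` vertices. Over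
`ℚ(α)`, numbers become integer coefficient vectors with a denominator, and a ratio is rational if
and only if the two vectors are proportional. -/

/-! ## A small compiler for arithmetic tests with bounded quantifiers -/

set_option linter.unusedSectionVars false

section Compiler

variable {R : Type} [CommRing R] [Div R]

/-- Number models in which results of arithmetic operations are not much larger than the
operands. -/
structure NumberModel.Modest (M : NumberModel R) : Prop where
  idxSize_le : ∀ a, M.idxSize a ≤ a
  numSize_apply_le : ∀ (o : ArithOp) (x y : R),
    M.numSize (o.apply x y) ≤ M.numSize x + M.numSize y + 1

/-- Arithmetic expressions; `load r c` is the number whose address is `c` plus the content of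
index register `r`. -/
inductive Expr : Type
  | const (z : ℤ)
  | load (r c : ℕ)
  | app (o : ArithOp) (a b : Expr)

namespace Expr

/-- The value of an expression. -/
def eval (env : ℕ → ℕ) (data : ℕ → R) : Expr → R
  | const z => z
  | load r c => data (env r + c)
  | app o a b => o.apply (a.eval env data) (b.eval env data)

/-- All addresses in an expression are within the input: registers `7` and `8` hold the
addresses of the first vertex and of the vertex opposite to it, and registers `9, …, L - 1`
those of vertices in between. -/
def Static (str L : ℕ) : Expr → Prop
  | const _ => True
  | load r c => 7 ≤ r ∧ r < L ∧ c < 2 * str ∧ (r = 8 → c < str)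
  | app _ a b => a.Static str L ∧ b.Static str L

/-- Evaluates an expression and pushes the result on a stack, with stack pointer in index
register `3`. Index register `2` holds the constant `1`. -/
def compile : Expr → Program
  | const z => .seq (.numConst 3 z) (.idxAdd 3 3 2)
  | load r c => .seq (.idxConst 4 c) (.seq (.idxAdd 4 4 r) (.seq (.numConst 3 0)
      (.seq (.numOp .add 3 3 4) (.idxAdd 3 3 2))))
  | app o a b => .seq a.compile (.seq b.compile (.seq (.idxSub 3 3 2) (.seq (.idxSub 4 3 2)
      (.numOp o 4 4 3))))

end Expr

/-- The input data of the compiled programs: addresses of vertices, and bounds on all numbers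
involved. There are `2 * N` vertices, represented by `str` numbers each. -/
structure Layout (M : NumberModel R) (B L N str : ℕ) (env : ℕ → ℕ) (data : ℕ → R) : Prop where
  one_le_str : 1 ≤ str
  str_le : str ≤ B
  len_le : 2 * (N * str) ≤ B
  nine_le : 9 ≤ L
  env_seven : env 7 = 0
  env_eight : env 8 = N * str
  env_of_le : ∀ r, 9 ≤ r → r < L → ∃ q < N, env r = q * str
  numSize_le : ∀ a < 2 * (N * str), M.numSize (data a) ≤ B

/-- The state `s` is as expected while a compiled program is running. -/
structure Frame (L N str sp : ℕ) (env : ℕ → ℕ) (data : ℕ → R) (s : Memory R) : Prop where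
  idx_one : s.idx 1 = str
  idx_two : s.idx 2 = 1
  idx_three : s.idx 3 = sp
  idx_env : ∀ r, 7 ≤ r → r < L → s.idx r = env r
  num_data : ∀ a < 2 * (N * str), s.num a = data a

variable {M : NumberModel R} {B L N str sp : ℕ} {env : ℕ → ℕ} {data : ℕ → R}

theorem Layout.mono (h : Layout M B L N str env data) {B' : ℕ} (hB : B ≤ B') :
    Layout M B' L N str env data :=
  ⟨h.one_le_str, h.str_le.trans hB, h.len_le.trans hB, h.nine_le, h.env_seven, h.env_eight,
    h.env_of_le, fun a ha => (h.numSize_le a ha).trans hB⟩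

theorem Layout.one_le (h : Layout M B L N str env data) : 1 ≤ B :=
  h.one_le_str.trans h.str_le

theorem Layout.env_le (h : Layout M B L N str env data) {r : ℕ} (h7 : 7 ≤ r) (hr : r < L) :
    env r ≤ N * str := by
  rcases (by omega : r = 7 ∨ r = 8 ∨ 9 ≤ r) with rfl | rfl | h9
  · simp [h.env_seven]
  · exact h.env_eight.le
  · obtain ⟨q, hq, e⟩ := h.env_of_le r h9 hr
    rw [e]; exact Nat.mul_le_mul_right _ hq.le

theorem Layout.load_lt (h : Layout M B L N str env data) (hN : 1 ≤ N) {r c : ℕ}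
    (hs : (Expr.load r c).Static str L) : env r + c < 2 * (N * str) := by
  obtain ⟨h7, hL, hc, h8⟩ := hs
  have h1 : str ≤ N * str := Nat.le_mul_of_pos_left _ hN
  rcases (by omega : r = 7 ∨ r = 8 ∨ 9 ≤ r) with rfl | rfl | h9
  · rw [h.env_seven]; omega
  · rw [h.env_eight]; have := h8 rfl; omega
  · obtain ⟨q, hq, e⟩ := h.env_of_le r h9 hL
    have : (q + 1) * str ≤ N * str := Nat.mul_le_mul_right _ hq
    rw [add_mul] at this
    omega

/-- `C` depends on the expression alone: constants have a fixed size, loaded numbers have size at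
most `B`, and an operation adds at most one to the sum of the sizes of its operands. -/
theorem Expr.exists_numSize_le (hM : M.Modest) (e : Expr) : ∃ C, ∀ {B L N str : ℕ}
    {env : ℕ → ℕ} {data : ℕ → R}, Layout M B L N str env data → 1 ≤ N → e.Static str L →
    M.numSize (e.eval env data) ≤ C * B := by
  induction e with
  | const z =>
    refine ⟨M.numSize (z : R), fun h _ _ => ?_⟩
    exact Nat.le_mul_of_pos_right _ h.one_le
  | load r c =>
    refine ⟨1, fun h hN hs => ?_⟩
    rw [one_mul]
    exact h.numSize_le _ (h.load_lt hN hs)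
  | app o a b iha ihb =>
    obtain ⟨C₁, h₁⟩ := iha
    obtain ⟨C₂, h₂⟩ := ihb
    refine ⟨C₁ + C₂ + 1, fun h hN hs => ?_⟩
    refine (hM.numSize_apply_le o _ _).trans ?_
    have := h₁ h hN hs.1
    have := h₂ h hN hs.2
    have := h.one_le
    rw [add_mul, add_mul, one_mul]
    omega

/-- The cells from `sp` upwards are the stack. Those below `sp` are unchanged, so that the first
operand survives the evaluation of the second. -/
theorem Expr.exists_runs (hM : M.Modest) (e : Expr) : ∃ C, ∀ {B L N str sp : ℕ}
    {env : ℕ → ℕ} {data : ℕ → R} {s : Memory R}, Layout M B L N str env data → 1 ≤ N →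
    e.Static str L → 2 * (N * str) ≤ sp → sp ≤ B → Frame L N str sp env data s →
    ∃ s' t, Runs M e.compile s s' t ∧ t ≤ C * B ^ 2 ∧ Frame L N str (sp + 1) env data s' ∧
      (∀ a < sp, s'.num a = s.num a) ∧ s'.num sp = e.eval env data := by
  induction e with
  | const z =>
    refine ⟨M.numSize (z : R) + 5, fun {B L N str sp env data s} h hN hs hsp hB hf => ?_⟩
    refine ⟨_, _, .seq (.numConst _ _ _) (.idxAdd _ _ _ _), ?_, ⟨?_, ?_, ?_, ?_, ?_⟩, ?_, ?_⟩
    · have h1 := hM.idxSize_le (s.idx 3)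
      have h2 := hM.idxSize_le (s.idx 2)
      rw [hf.idx_three] at h1
      rw [hf.idx_two] at h2
      simp only [hf.idx_three, hf.idx_two]
      have := h.one_le
      have : M.numSize (z : R) ≤ M.numSize (z : R) * B ^ 2 :=
        Nat.le_mul_of_pos_right _ (by positivity)
      nlinarith
    · simpa using hf.idx_one
    · simpa using hf.idx_two
    · simp [hf.idx_three, hf.idx_two]
    · intro r h7 hr
      have : r ≠ 3 := by omega
      simpa [this] using hf.idx_env r h7 hr
    · intro a ha
      have : a ≠ sp := by omega
      simpa [this, hf.idx_three] using hf.num_data a ha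
    · intro a ha
      simp [hf.idx_three, ha.ne]
    · simp [hf.idx_three, Expr.eval]
  | load r c =>
    refine ⟨c + (2 * M.numSize (0 : R) + 2) ^ 2 + M.numSize (0 : R) + 20,
      fun {B L N str sp env data s} h hN hs hsp hB hf => ?_⟩
    have hlt := h.load_lt hN hs
    have h7 := hs.1
    have hrL := hs.2.1
    have hr4 : r ≠ 4 := by omega
    have hr3 : r ≠ 3 := by omega
    have her := hf.idx_env r h7 hrL
    -- There is no copy instruction: a zero is pushed, and the loaded number is added to it. The
    -- loaded cell is in the input, below the stack, so the zero does not overwrite it.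
    have hne : env r + c ≠ sp := by omega
    have hd := hf.num_data _ hlt
    refine ⟨_, _, .seq (.idxConst _ _ _) (.seq (.idxAdd _ _ _ _) (.seq (.numConst _ _ _)
      (.seq (.numOp _ _ _ _ _) (.idxAdd _ _ _ _)))), ?_, ⟨?_, ?_, ?_, ?_, ?_⟩, ?_, ?_⟩
    · have e1 := hM.idxSize_le c
      have e2 := hM.idxSize_le (env r)
      have e3 := hM.idxSize_le sp
      have e4 := hM.idxSize_le (c + env r)
      have e5 := hM.idxSize_le 1
      have e6 := h.env_le h7 hrL
      have e7 := h.numSize_le _ hlt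
      have hB1 := h.one_le
      simp [hf.idx_three, hf.idx_two, hr4, her]
      rw [add_comm c, Function.update_of_ne hne, hd]
      rw [add_comm c] at e4
      generalize M.numSize (0 : R) = z at *
      generalize M.numSize (data (env r + c)) = y at *
      have e8 : (z + y) ^ 2 ≤ ((z + 1) * B) ^ 2 := Nat.pow_le_pow_left (by nlinarith) 2
      have e9 : ((z + 1) * B) ^ 2 ≤ (2 * z + 2) ^ 2 * B ^ 2 := by
        rw [mul_pow]; gcongr <;> omega
      have e10 : c ≤ c * B ^ 2 := Nat.le_mul_of_pos_right _ (by positivity)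
      have e11 : z ≤ z * B ^ 2 := Nat.le_mul_of_pos_right _ (by positivity)
      have e12 : B ≤ B ^ 2 := by nlinarith
      simp only [add_mul]
      omega
    · simpa using hf.idx_one
    · simpa using hf.idx_two
    · simp [hf.idx_three, hf.idx_two]
    · intro r' h7 hr
      have h3 : r' ≠ 3 := by omega
      have h4 : r' ≠ 4 := by omega
      simpa [h3, h4] using hf.idx_env r' h7 hr
    · intro a ha
      have : a ≠ sp := by omega
      simpa [this, hf.idx_three] using hf.num_data a ha
    · intro a ha
      simp [hf.idx_three, ha.ne]
    · simp [hf.idx_three, Expr.eval, ArithOp.apply, hr4, her]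
      rw [add_comm c, Function.update_of_ne hne, hd]
  | app o a b iha ihb =>
    obtain ⟨C₁, h₁⟩ := iha
    obtain ⟨C₂, h₂⟩ := ihb
    obtain ⟨D₁, k₁⟩ := a.exists_numSize_le hM
    obtain ⟨D₂, k₂⟩ := b.exists_numSize_le hM
    refine ⟨C₁ + 4 * C₂ + (D₁ + D₂) ^ 2 + 20,
      fun {B L N str sp env data s} h hN hs hsp hB hf => ?_⟩
    obtain ⟨s₁, t₁, r₁, ht₁, f₁, n₁, v₁⟩ := h₁ h hN hs.1 hsp hB hf
    have hB1 := h.one_le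
    -- The stack pointer is now `sp + 1`, which may exceed `B`. The bound is therefore doubled,
    -- whence the factor `4` before `C₂`.
    obtain ⟨s₂, t₂, r₂, ht₂, f₂, n₂, v₂⟩ := h₂ (h.mono (show B ≤ 2 * B by omega)) hN hs.2
      (show 2 * (N * str) ≤ sp + 1 by omega) (by omega) f₁
    have hsp2 := f₂.idx_three
    have hone := f₂.idx_two
    have v₁' : s₂.num sp = a.eval env data := (n₂ sp (by omega)).trans v₁
    refine ⟨_, _, .seq r₁ (.seq r₂ (.seq (.idxSub _ _ _ _) (.seq (.idxSub _ _ _ _)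
      (.numOp _ _ _ _ _)))), ?_, ⟨?_, ?_, ?_, ?_, ?_⟩, ?_, ?_⟩
    · have e1 := hM.idxSize_le (sp + 1 + 1)
      have e2 := hM.idxSize_le (sp + 1)
      have e3 := hM.idxSize_le sp
      have e5 := hM.idxSize_le 1
      have e6 := k₁ h hN hs.1
      have e7 := k₂ h hN hs.2
      simp [hsp2, hone, v₁', v₂]
      have e8 : (M.numSize (a.eval env data) + M.numSize (b.eval env data)) ^ 2
          ≤ ((D₁ + D₂) * B) ^ 2 := by rw [add_mul]; gcongr
      rw [mul_pow] at e8
      have e12 : B ≤ B ^ 2 := by nlinarith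
      rw [mul_pow] at ht₂
      simp only [add_mul]
      have : C₂ * (2 ^ 2 * B ^ 2) = 4 * C₂ * B ^ 2 := by ring
      omega
    · simpa using f₂.idx_one
    · simpa using f₂.idx_two
    · simp [hsp2, hone]
    · intro r' h7 hr
      have h3 : r' ≠ 3 := by omega
      have h4 : r' ≠ 4 := by omega
      simpa [h3, h4] using f₂.idx_env r' h7 hr
    · intro x hx
      have : x ≠ sp := by omega
      simpa [this, hsp2, hone] using f₂.num_data x hx
    · intro x hx
      have : x ≠ sp := by omega
      simp [hsp2, hone, this]
      rw [n₂ x (by omega), n₁ x hx]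
    · simp [hsp2, hone, Expr.eval, v₁', v₂]

/-! ### Tests with quantifiers over vertices -/

/-- Tests: boolean combinations of tests of numbers, with a quantifier over the first half of
the vertices. -/
inductive Test : Type
  | isZero (e : Expr)
  | special (e : Expr)
  | not (φ : Test)
  | and (φ ψ : Test)
  | ex (φ : Test)

namespace Test

/-- The meaning of a test; at level `L`, a quantifier binds register `L`. -/
def Holds (M : NumberModel R) (N str : ℕ) : Test → ℕ → (ℕ → ℕ) → (ℕ → R) → Prop
  | isZero e, _, env, data => e.eval env data = 0
  | special e, _, env, data => M.special (e.eval env data)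
  | not φ, L, env, data => ¬ φ.Holds M N str L env data
  | and φ ψ, L, env, data => φ.Holds M N str L env data ∧ ψ.Holds M N str L env data
  | ex φ, L, env, data =>
    ∃ q < N, φ.Holds M N str (L + 1) (Function.update env L (q * str)) data

/-- All addresses in a test are within the input. -/
def Static (str : ℕ) : Test → ℕ → Prop
  | isZero e, L => e.Static str L
  | special e, L => e.Static str L
  | not φ, L => φ.Static str L
  | and φ ψ, L => φ.Static str L ∧ ψ.Static str L
  | ex φ, L => φ.Static str (L + 1)

/-- Evaluates a test and stores the truth value in index register `5`. Index register `7` holds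
the constant `0`. -/
def compile : Test → ℕ → Program
  | isZero e, _ => .seq e.compile (.seq (.idxSub 3 3 2)
      (.branch (.zero 3) (.idxConst 5 1) (.idxConst 5 0)))
  | special e, _ => .seq e.compile (.seq (.idxSub 3 3 2)
      (.branch (.special 3) (.idxConst 5 1) (.idxConst 5 0)))
  | not φ, L => .seq (φ.compile L) (.idxSub 5 2 5)
  | and φ ψ, L => .seq (φ.compile L) (.branch (.lt 7 5) (ψ.compile L) (.idxConst 4 0))
  | ex φ, L => .seq (.idxConst L 0) (.seq (.idxConst 5 0) (.loop (.lt L 8)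
      (.seq (φ.compile (L + 1)) (.branch (.lt 7 5) (.idxAdd L 8 7) (.idxAdd L L 1)))))

end Test

/-- Index register `5` of `s` holds the truth value of `P`. -/
def TruthFlag (s : Memory R) (P : Prop) : Prop :=
  (s.idx 5 = 1 ∧ P) ∨ (s.idx 5 = 0 ∧ ¬ P)

theorem Frame.of_idx {s s' : Memory R} (h : Frame L N str sp env data s)
    (hnum : s'.num = s.num)
    (hidx : ∀ r, r ≠ 4 → r ≠ 5 → r < L → s'.idx r = s.idx r) (hL : 9 ≤ L) :
    Frame L N str sp env data s' where
  idx_one := (hidx 1 (by omega) (by omega) (by omega)).trans h.idx_one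
  idx_two := (hidx 2 (by omega) (by omega) (by omega)).trans h.idx_two
  idx_three := (hidx 3 (by omega) (by omega) (by omega)).trans h.idx_three
  idx_env r h7 hr := (hidx r (by omega) (by omega) hr).trans (h.idx_env r h7 hr)
  num_data a ha := by rw [hnum]; exact h.num_data a ha

/-- The specification of a compiled test, with explicit bound for the running time. -/
def Test.RunsWithin (M : NumberModel R) (φ : Test) (T : ℕ → ℕ) : Prop :=
  ∀ ⦃B L N str sp : ℕ⦄ ⦃env : ℕ → ℕ⦄ ⦃data : ℕ → R⦄ ⦃s : Memory R⦄,
    Layout M B L N str env data → 1 ≤ N → φ.Static str L → 2 * (N * str) ≤ sp → sp ≤ B →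
    Frame L N str sp env data s →
    ∃ s' t, Runs M (φ.compile L) s s' t ∧ t ≤ T B ∧ Frame L N str sp env data s' ∧
      TruthFlag s' (φ.Holds M N str L env data)

/-- This serves both kinds of atomic tests. Popping only lowers the stack pointer; the number stays
in its cell, where the branch reads it. -/
theorem runs_pop_branch (hM : M.Modest) (e : Expr) (c : Cond) (P : R → Prop)
    (hc : ∀ s : Memory R, c.Holds M s ↔ P (s.num (s.idx 3)))
    (hcost : ∀ s : Memory R, c.cost M s = 1 + M.idxSize (s.idx 3) + M.numSize (s.num (s.idx 3))) :
    ∃ C, ∀ {B L N str sp : ℕ}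
    {env : ℕ → ℕ} {data : ℕ → R} {s : Memory R}, Layout M B L N str env data → 1 ≤ N →
    e.Static str L → 2 * (N * str) ≤ sp → sp ≤ B → Frame L N str sp env data s →
    ∃ s' t, Runs M (.seq e.compile (.seq (.idxSub 3 3 2)
      (.branch c (.idxConst 5 1) (.idxConst 5 0)))) s s' t ∧ t ≤ C * B ^ 2 ∧
      Frame L N str sp env data s' ∧ TruthFlag s' (P (e.eval env data)) := by
  obtain ⟨C, hC⟩ := e.exists_runs hM
  obtain ⟨D, hD⟩ := e.exists_numSize_le hM
  refine ⟨C + D + 20, fun {B L N str sp env data s} h hN hs hsp hB hf => ?_⟩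
  obtain ⟨s₁, t₁, r₁, ht₁, f₁, n₁, v₁⟩ := hC h hN hs hsp hB hf
  have hsp1 := f₁.idx_three
  have hone := f₁.idx_two
  let s₂ : Memory R := ⟨Function.update s₁.idx 3 (s₁.idx 3 - s₁.idx 2), s₁.num⟩
  have h3 : s₂.idx 3 = sp := by simp [s₂, hsp1, hone]
  have hv : s₂.num (s₂.idx 3) = e.eval env data := by rw [h3]; exact v₁
  have hcs : c.Holds M s₂ ↔ P (e.eval env data) := by rw [hc, hv]
  have h9 := h.nine_le
  have f₂ : Frame L N str sp env data s₂ := by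
    refine ⟨by simpa [s₂] using f₁.idx_one, by simpa [s₂] using f₁.idx_two, h3, ?_, f₁.num_data⟩
    intro r h7 hr
    have : r ≠ 3 := by omega
    simpa [s₂, this] using f₁.idx_env r h7 hr
  have cost : ∀ b, b ≤ 1 → t₁ + (1 + M.idxSize (s₁.idx 3) + M.idxSize (s₁.idx 2)
      + (c.cost M s₂ + (1 + M.idxSize b))) ≤ (C + D + 20) * B ^ 2 := by
    intro b hb
    rw [hcost, hv, h3, hsp1, hone]
    have e1 := hM.idxSize_le (sp + 1)
    have e2 := hM.idxSize_le sp
    have e3 := hM.idxSize_le 1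
    have e4 := hM.idxSize_le b
    have e5 := hD h hN hs
    have hB1 := h.one_le
    have e12 : B ≤ B ^ 2 := by nlinarith
    have e13 : D * B ≤ D * B ^ 2 := by gcongr
    simp only [add_mul]
    omega
  by_cases hP : P (e.eval env data)
  · refine ⟨_, _, .seq r₁ (.seq (.idxSub _ _ _ _) (.branchTrue (hcs.2 hP) (.idxConst _ _ _))),
      cost 1 le_rfl, f₂.of_idx rfl (fun r _ h5 _ => by simp [h5]; rfl) h9, Or.inl ⟨?_, hP⟩⟩
    simp
  · refine ⟨_, _, .seq r₁ (.seq (.idxSub _ _ _ _) (.branchFalse (mt hcs.1 hP)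
      (.idxConst _ _ _))),
      cost 0 zero_le_one, f₂.of_idx rfl (fun r _ h5 _ => by simp [h5]; rfl) h9, Or.inr ⟨?_, hP⟩⟩
    simp

theorem Test.RunsWithin.not (hM : M.Modest) {φ : Test} {T : ℕ → ℕ} (hφ : φ.RunsWithin M T) :
    φ.not.RunsWithin M fun B => T B + 3 := by
  intro B L N str sp env data s h hN hs hsp hB hf
  obtain ⟨s₁, t₁, r₁, ht₁, f₁, fl⟩ := hφ h hN hs hsp hB hf
  refine ⟨_, _, .seq r₁ (.idxSub _ _ _ _), ?_,
    f₁.of_idx rfl (fun r _ h5 _ => by simp [h5]) h.nine_le, ?_⟩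
  · have e1 := hM.idxSize_le 1
    have e2 := hM.idxSize_le (s₁.idx 5)
    rw [f₁.idx_two]
    have : s₁.idx 5 ≤ 1 := by rcases fl with fl | fl <;> omega
    show _ ≤ T B + 3
    omega
  · rcases fl with ⟨h5, hP⟩ | ⟨h5, hP⟩
    · exact Or.inr ⟨by simp [h5, f₁.idx_two], not_not.2 hP⟩
    · exact Or.inl ⟨by simp [h5, f₁.idx_two], hP⟩

theorem Test.RunsWithin.and (hM : M.Modest) {φ ψ : Test} {T U : ℕ → ℕ}
    (hφ : φ.RunsWithin M T) (hψ : ψ.RunsWithin M U) :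
    (φ.and ψ).RunsWithin M fun B => T B + U B + 4 := by
  intro B L N str sp env data s h hN hs hsp hB hf
  obtain ⟨s₁, t₁, r₁, ht₁, f₁, fl⟩ := hφ h hN hs.1 hsp hB hf
  have h9 := h.nine_le
  have h7 : s₁.idx 7 = 0 := (f₁.idx_env 7 le_rfl (by omega)).trans h.env_seven
  have e1 := hM.idxSize_le 0
  have e2 := hM.idxSize_le (s₁.idx 5)
  have : s₁.idx 5 ≤ 1 := by rcases fl with fl | fl <;> omega
  have hcost : (Cond.lt 7 5).cost M s₁ ≤ 2 := by
    simp only [Cond.cost, h7]; omega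
  rcases fl with ⟨h5, hP⟩ | ⟨h5, hP⟩
  · obtain ⟨s₂, t₂, r₂, ht₂, f₂, fl₂⟩ := hψ h hN hs.2 hsp hB f₁
    refine ⟨_, _, .seq r₁ (.branchTrue ?_ r₂), ?_, f₂, ?_⟩
    · simp [Cond.Holds, h7, h5]
    · show _ ≤ T B + U B + 4
      omega
    · exact fl₂.imp (fun h => ⟨h.1, hP, h.2⟩) (fun h => ⟨h.1, fun k => h.2 k.2⟩)
  · refine ⟨_, _, .seq r₁ (.branchFalse ?_ (.idxConst _ _ _)), ?_,
      f₁.of_idx rfl (fun r h4 _ _ => by simp [h4]) h.nine_le, ?_⟩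
    · simp [Cond.Holds, h7, h5]
    · show _ ≤ T B + U B + 4
      omega
    · exact Or.inr ⟨by simp [h5], fun k => hP k.1⟩

theorem Frame.update_env {s : Memory R} {x : ℕ} (h : Frame L N str sp env data s)
    (hx : s.idx L = x) : Frame (L + 1) N str sp (Function.update env L x) data s where
  idx_one := h.idx_one
  idx_two := h.idx_two
  idx_three := h.idx_three
  idx_env r h7 hr := by
    by_cases hrL : r = L
    · subst hrL; simp [hx]
    · simp only [Function.update_of_ne hrL]
      exact h.idx_env r h7 (by omega)
  num_data := h.num_data

theorem Frame.of_update_env {s : Memory R} {x : ℕ}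
    (h : Frame (L + 1) N str sp (Function.update env L x) data s) :
    Frame L N str sp env data s where
  idx_one := h.idx_one
  idx_two := h.idx_two
  idx_three := h.idx_three
  idx_env r h7 hr := by
    have := h.idx_env r h7 (by omega)
    rwa [Function.update_of_ne (by omega)] at this
  num_data := h.num_data

theorem Layout.update_env (h : Layout M B L N str env data) {q : ℕ} (hq : q < N) :
    Layout M B (L + 1) N str (Function.update env L (q * str)) data where
  one_le_str := h.one_le_str
  str_le := h.str_le
  len_le := h.len_le
  nine_le := by have := h.nine_le; omega
  env_seven := by
    have := h.nine_le
    rw [Function.update_of_ne (by omega), h.env_seven]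
  env_eight := by
    have := h.nine_le
    rw [Function.update_of_ne (by omega), h.env_eight]
  env_of_le r h9 hr := by
    by_cases hrL : r = L
    · subst hrL; exact ⟨q, hq, by simp⟩
    · rw [Function.update_of_ne hrL]
      exact h.env_of_le r h9 (by omega)
  numSize_le := h.numSize_le

/-- Register `L` runs through the multiples of `str` below `N * str`. As soon as the body holds, it
is set to `N * str`, which ends the loop with the flag still `1`. As `N ≤ B`, the body runs at most
`B` times. -/
theorem Test.RunsWithin.ex (hM : M.Modest) {φ : Test} {T : ℕ → ℕ} (hφ : φ.RunsWithin M T) :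
    φ.ex.RunsWithin M fun B => (B + 1) * (T B + 4 * B + 10) + 10 := by
  intro B L N str sp env data s h hN hs hsp hB hf
  have h9 := h.nine_le
  have hlen := h.len_le
  have hstr := h.one_le_str
  have hstrB := h.str_le
  -- Induction on the number `j` of values still to be tried, the first `q` values having been
  -- refuted.
  have iter : ∀ (j : ℕ) (q : ℕ) (s : Memory R), q + j = N → Frame L N str sp env data s →
      s.idx L = q * str → s.idx 5 = 0 →
      (∀ q' < q, ¬ φ.Holds M N str (L + 1) (Function.update env L (q' * str)) data) →
      ∃ s' t, Runs M (.loop (.lt L 8) (.seq (φ.compile (L + 1))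
          (.branch (.lt 7 5) (.idxAdd L 8 7) (.idxAdd L L 1)))) s s' t ∧
        t ≤ (j + 1) * (T B + 4 * B + 10) ∧ Frame L N str sp env data s' ∧
        TruthFlag s' (φ.ex.Holds M N str L env data) := by
    intro j
    induction j with
    | zero =>
      intro q s hq hf hL h5 hno
      have e8 : s.idx 8 = N * str := (hf.idx_env 8 (by omega) (by omega)).trans h.env_eight
      have e1 := hM.idxSize_le (q * str)
      have e2 := hM.idxSize_le (N * str)
      obtain rfl : q = N := by omega
      refine ⟨s, _, .loopFalse ?_, ?_, hf, Or.inr ⟨h5, ?_⟩⟩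
      · simp [Cond.Holds, hL, e8]
      · simp only [Cond.cost, hL, e8]; omega
      · rintro ⟨q', hq', k⟩; exact hno q' hq' k
    | succ j ih =>
      intro q s hq hf hL h5 hno
      have e8 : s.idx 8 = N * str := (hf.idx_env 8 (by omega) (by omega)).trans h.env_eight
      have hqN : q * str < N * str := Nat.mul_lt_mul_of_pos_right (by omega) hstr
      have e1 := hM.idxSize_le (q * str)
      have e2 := hM.idxSize_le (N * str)
      have e3 := hM.idxSize_le 0
      have e4 := hM.idxSize_le str
      obtain ⟨s₁, t₁, r₁, ht₁, f₁, fl⟩ := hφ (h.update_env (show q < N by omega)) hN hs hsp hB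
        (hf.update_env hL)
      have g₁ := f₁.of_update_env
      have g7 : s₁.idx 7 = 0 := (g₁.idx_env 7 (by omega) (by omega)).trans h.env_seven
      have g8 : s₁.idx 8 = N * str := (g₁.idx_env 8 (by omega) (by omega)).trans h.env_eight
      have gL : s₁.idx L = q * str := by
        have := f₁.idx_env L (by omega) (by omega)
        simpa using this
      have e5 := hM.idxSize_le (s₁.idx 5)
      have : s₁.idx 5 ≤ 1 := by rcases fl with fl | fl <;> omega
      have hc : (Cond.lt L 8).Holds M s := by simp only [Cond.Holds, hL, e8]; exact hqN
      have hcost : (Cond.lt 7 5).cost M s₁ ≤ 2 := by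
        simp only [Cond.cost, g7]; omega
      have hcost' : (Cond.lt L 8).cost M s ≤ 1 + B := by
        simp only [Cond.cost, hL, e8]; omega
      rcases fl with ⟨g5, hP⟩ | ⟨g5, hP⟩
      · refine ⟨_, _, .loopTrue hc (.seq r₁ (.branchTrue (by simp [Cond.Holds, g7, g5])
          (.idxAdd _ _ _ _))) (.loopFalse ?_), ?_,
          g₁.of_idx rfl (fun r _ _ hr => by simp [hr.ne]) h9, Or.inl ⟨?_, q, by omega, hP⟩⟩
        · have : (8 : ℕ) ≠ L := by omega
          simp [Cond.Holds, g8, g7, this]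
        · have : (8 : ℕ) ≠ L := by omega
          have hcost'' : ∀ s : Memory R, s.idx L = N * str → s.idx 8 = N * str →
              (Cond.lt L 8).cost M s ≤ 1 + B := by
            intro s k1 k2
            simp only [Cond.cost, k1, k2]; omega
          have := hcost'' ⟨Function.update s₁.idx L (s₁.idx 8 + s₁.idx 7), s₁.num⟩
            (by simp [g8, g7]) (by simp [this, g8])
          rw [g8, g7] at *
          have : 1 * (T B + 4 * B + 10) ≤ (j + 1) * (T B + 4 * B + 10) := by gcongr; omega
          rw [add_mul (j + 1)]
          omega
        · have : (5 : ℕ) ≠ L := by omega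
          simp [this, g5]
      · obtain ⟨s₂, t₂, r₂, ht₂, f₂, fl₂⟩ := ih (q + 1)
          ⟨Function.update s₁.idx L (s₁.idx L + s₁.idx 1), s₁.num⟩ (by omega)
          (g₁.of_idx rfl (fun r _ _ hr => by simp [hr.ne]) h9)
          (by simp [gL, g₁.idx_one, add_mul])
          (by have : (5 : ℕ) ≠ L := by omega
              simp [this, g5])
          (fun q' hq' => by
            rcases Nat.lt_succ_iff_lt_or_eq.1 hq' with k | rfl
            · exact hno q' k
            · exact hP)
        refine ⟨_, _, .loopTrue hc (.seq r₁ (.branchFalse (by simp [Cond.Holds, g7, g5])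
          (.idxAdd _ _ _ _))) r₂, ?_, f₂, fl₂⟩
        rw [gL, g₁.idx_one]
        rw [add_mul (j + 1)]
        omega
  obtain ⟨s', t, r, ht, f, fl⟩ := iter N 0
    ⟨Function.update (Function.update s.idx L 0) 5 0, s.num⟩ (by omega)
    (hf.of_idx rfl (fun r _ h5 hr => by simp [h5, hr.ne]) h9)
    (by have : L ≠ 5 := by omega
        simp [this]) (by simp) (by simp)
  refine ⟨s', _, .seq (.idxConst _ _ _) (.seq (.idxConst _ _ _) r), ?_, f, fl⟩
  have e1 := hM.idxSize_le 0
  have hNB : N ≤ B := by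
    have : N * 1 ≤ N * str := by gcongr
    omega
  have : (N + 1) * (T B + 4 * B + 10) ≤ (B + 1) * (T B + 4 * B + 10) := by gcongr
  show _ ≤ (B + 1) * (T B + 4 * B + 10) + 10
  omega

theorem Test.RunsWithin.mono {φ : Test} {T U : ℕ → ℕ} (hφ : φ.RunsWithin M T)
    (h : ∀ B, 1 ≤ B → T B ≤ U B) : φ.RunsWithin M U := by
  intro B L N str sp env data s hl hN hs hsp hB hf
  obtain ⟨s₁, t₁, r₁, ht₁, f₁, fl⟩ := hφ hl hN hs hsp hB hf
  exact ⟨s₁, t₁, r₁, ht₁.trans (h B hl.one_le), f₁, fl⟩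

/-- Compiled tests run in polynomial time. -/
theorem Test.exists_runsWithin (hM : M.Modest) (φ : Test) :
    ∃ C k, φ.RunsWithin M fun B => C * B ^ k := by
  induction φ with
  | isZero e =>
    obtain ⟨C, hC⟩ := runs_pop_branch hM e (.zero 3) (fun x => x = 0) (fun _ => Iff.rfl)
      (fun _ => rfl)
    exact ⟨C, 2, fun _ _ _ _ _ _ _ _ => hC⟩
  | special e =>
    obtain ⟨C, hC⟩ := runs_pop_branch hM e (.special 3) M.special (fun _ => Iff.rfl)
      (fun _ => rfl)
    exact ⟨C, 2, fun _ _ _ _ _ _ _ _ => hC⟩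
  | not φ ih =>
    obtain ⟨C, k, h⟩ := ih
    refine ⟨C + 3, k, (h.not hM).mono fun B hB => ?_⟩
    have : 3 ≤ 3 * B ^ k := Nat.le_mul_of_pos_right _ (by positivity)
    rw [add_mul]
    exact Nat.add_le_add_left this _
  | and φ ψ ih₁ ih₂ =>
    obtain ⟨C, k, h⟩ := ih₁
    obtain ⟨D, l, h'⟩ := ih₂
    refine ⟨C + D + 4, k + l, (h.and hM h').mono fun B hB => ?_⟩
    have e1 : C * B ^ k ≤ C * B ^ (k + l) := by gcongr; omega
    have e2 : D * B ^ l ≤ D * B ^ (k + l) := by gcongr; omega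
    have e3 : 4 ≤ 4 * B ^ (k + l) := Nat.le_mul_of_pos_right _ (by positivity)
    simp only [add_mul]
    omega
  | ex φ ih =>
    obtain ⟨C, k, h⟩ := ih
    refine ⟨2 * (C + 14) + 10, k + 2, (h.ex hM).mono fun B hB => ?_⟩
    have e1 : C * B ^ k + 4 * B + 10 ≤ (C + 14) * B ^ (k + 1) := by
      have e1 : C * B ^ k ≤ C * B ^ (k + 1) := by gcongr; omega
      have e2 : B ≤ B ^ (k + 1) := by
        calc B = B ^ 1 := (pow_one B).symm
          _ ≤ _ := by gcongr; omega
      rw [add_mul]; omega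
    have e3 : 1 ≤ B ^ (k + 2) := Nat.one_le_pow _ _ hB
    calc (B + 1) * (C * B ^ k + 4 * B + 10) + 10
        ≤ (2 * B) * ((C + 14) * B ^ (k + 1)) + 10 := by gcongr; omega
      _ = 2 * (C + 14) * B ^ (k + 2) + 10 := by ring
      _ ≤ (2 * (C + 14) + 10) * B ^ (k + 2) := by rw [add_mul]; omega

/-! ### The decision program -/

/-- Adds index register `0` to index register `8`, `k` times. -/
def addMany : ℕ → Program
  | 0 => .idxConst 4 0
  | k + 1 => .seq (.idxAdd 8 8 0) (addMany k)

/-- Index registers can be added but not multiplied, so `N * str` is obtained by repeated addition.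
The number of additions is fixed with the program. -/
theorem exists_runs_addMany (hM : M.Modest) (k : ℕ) : ∀ s : Memory R, ∃ s' t,
    Runs M (addMany k) s s' t ∧ t ≤ (k + 1) * (s.idx 8 + (k + 1) * s.idx 0 + 1) ∧
    s'.num = s.num ∧ s'.idx 8 = s.idx 8 + k * s.idx 0 ∧
    ∀ r, r ≠ 8 → r ≠ 4 → s'.idx r = s.idx r := by
  induction k with
  | zero =>
    intro s
    refine ⟨_, _, .idxConst _ _ _, ?_, rfl, by simp, fun r _ h4 => by simp [h4]⟩
    have := hM.idxSize_le 0
    omega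
  | succ k ih =>
    intro s
    obtain ⟨s', t, r, ht, hn, h8, hr⟩ := ih
      ⟨Function.update s.idx 8 (s.idx 8 + s.idx 0), s.num⟩
    refine ⟨s', _, .seq (.idxAdd _ _ _ _) r, ?_, hn, ?_, ?_⟩
    · have e1 := hM.idxSize_le (s.idx 8)
      have e2 := hM.idxSize_le (s.idx 0)
      simp at ht
      have : (k + 1 + 1) * (s.idx 8 + (k + 1 + 1) * s.idx 0 + 1) =
        (k + 1) * (s.idx 8 + s.idx 0 + (k + 1) * s.idx 0 + 1)
          + (s.idx 8 + (k + 1 + 1) * s.idx 0 + 1) := by ring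
      rw [this, add_mul (k + 1)]
      omega
    · simp at h8
      rw [h8]; ring
    · intro r h8' h4
      simpa [h8'] using hr r h8' h4

/-- The program that answers `2` if the test holds and `0` otherwise. -/
def decisionProgram (str : ℕ) (φ : Test) : Program :=
  .seq (.idxConst 2 1) (.seq (.idxConst 1 str) (.seq (addMany str) (.seq (.idxAdd 3 8 8)
    (.seq (φ.compile 9) (.branch (.lt 7 5) (.idxConst 0 2) (.idxConst 0 0))))))

/-- The addresses of the first vertex and of the vertex opposite to it. -/
def initialEnv (N str : ℕ) : ℕ → ℕ :=
  fun r => if r = 8 then N * str else 0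

/-- The stack starts at `2 * (N * str)`, the first cell after the input. `C` and `k` depend on `str`
and `φ` only, not on the input. -/
theorem exists_runs_decisionProgram (hM : M.Modest) (str : ℕ) (hstr : 1 ≤ str) (φ : Test)
    (hs : φ.Static str 9) : ∃ C k, ∀ (N : ℕ), 1 ≤ N → ∀ (w : ℕ → R) (B : ℕ),
      2 * (N * str) ≤ B → (∀ a < 2 * (N * str), M.numSize (w a) ≤ B) →
      ∃ s t, Runs M (decisionProgram str φ) (inputMemory N (2 * (N * str)) w) s t ∧
        t ≤ C * B ^ k ∧
        (φ.Holds M N str 9 (initialEnv N str) w ∧ s.idx 0 = 2 ∨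
          ¬ φ.Holds M N str 9 (initialEnv N str) w ∧ s.idx 0 = 0) := by
  obtain ⟨C, k, hC⟩ := φ.exists_runsWithin hM
  refine ⟨C + (str + 1) * (str + 2) + str + 30, k + 1, fun N hN w B hB hw => ?_⟩
  have hNs : N * 1 ≤ N * str := by gcongr
  have hsN : 1 * str ≤ N * str := by gcongr
  have hlay : Layout M B 9 N str (initialEnv N str) w :=
    { one_le_str := hstr
      str_le := by omega
      len_le := hB
      nine_le := le_rfl
      env_seven := rfl
      env_eight := rfl
      env_of_le := fun r h9 hr => by omega
      numSize_le := hw }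
  let s₀ : Memory R := inputMemory N (2 * (N * str)) w
  let s₁ : Memory R := ⟨Function.update (Function.update s₀.idx 2 1) 1 str, s₀.num⟩
  obtain ⟨s₂, t₂, r₂, ht₂, n₂, h8, hr₂⟩ := exists_runs_addMany hM str s₁
  have z8 : s₁.idx 8 = 0 := by simp [s₁, s₀, inputMemory]
  have z0 : s₁.idx 0 = N := by simp [s₁, s₀, inputMemory]
  rw [z8, z0] at ht₂ h8
  rw [zero_add] at h8
  let s₃ : Memory R := ⟨Function.update s₂.idx 3 (s₂.idx 8 + s₂.idx 8), s₂.num⟩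
  have hf : Frame 9 N str (2 * (N * str)) (initialEnv N str) w s₃ := by
    refine ⟨?_, ?_, ?_, ?_, ?_⟩
    · simp [s₃, hr₂, s₁]
    · simp [s₃, hr₂, s₁]
    · simp [s₃, h8]; ring
    · intro r h7 h9
      obtain rfl | rfl : r = 7 ∨ r = 8 := by omega
      · simp [s₃, hr₂, s₁, s₀, inputMemory, initialEnv]
      · simp [s₃, h8, initialEnv]; ring
    · intro a ha
      simp [s₃, n₂, s₁, s₀, inputMemory, ha]
  obtain ⟨s₄, t₄, r₄, ht₄, f₄, fl⟩ := hC hlay hN hs le_rfl hB hf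
  have g7 : s₄.idx 7 = 0 := f₄.idx_env 7 (by omega) (by omega)
  have g5 : s₄.idx 5 ≤ 1 := by rcases fl with fl | fl <;> omega
  have hcost : (Cond.lt 7 5).cost M s₄ ≤ 2 := by
    have e1 := hM.idxSize_le 0
    have e2 := hM.idxSize_le (s₄.idx 5)
    simp only [Cond.cost, g7]; omega
  have hB1 : 1 ≤ B := by omega
  have cost : ∀ b, b ≤ 2 → 1 + M.idxSize 1 + (1 + M.idxSize str + (t₂ +
      (1 + M.idxSize (s₂.idx 8) + M.idxSize (s₂.idx 8) + (t₄ + ((Cond.lt 7 5).cost M s₄ +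
        (1 + M.idxSize b)))))) ≤ (C + (str + 1) * (str + 2) + str + 30) * B ^ (k + 1) := by
    intro b hb
    have e1 := hM.idxSize_le 1
    have e2 := hM.idxSize_le str
    have e3 := hM.idxSize_le (s₂.idx 8)
    have e4 := hM.idxSize_le b
    have e5 : B ≤ B ^ (k + 1) := by
      calc B = B ^ 1 := (pow_one B).symm
        _ ≤ _ := by gcongr; omega
    have e6 : C * B ^ k ≤ C * B ^ (k + 1) := by gcongr; omega
    have e7 : (str + 1) * (0 + (str + 1) * N + 1) ≤ (str + 1) * ((str + 2) * B) := by
      gcongr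
      nlinarith
    have e8 : (str + 1) * ((str + 2) * B) ≤ (str + 1) * (str + 2) * B ^ (k + 1) := by
      rw [← mul_assoc]; gcongr
    have e9 : str ≤ str * B ^ (k + 1) := Nat.le_mul_of_pos_right _ (by positivity)
    have e10 : str * N = N * str := mul_comm _ _
    simp only [add_mul] at *
    omega
  rcases fl with ⟨h5, hP⟩ | ⟨h5, hP⟩
  · refine ⟨_, _, .seq (.idxConst _ _ _) (.seq (.idxConst _ _ _) (.seq r₂ (.seq (.idxAdd _ _ _ _)
      (.seq r₄ (.branchTrue (by simp [Cond.Holds, g7, h5]) (.idxConst _ _ _)))))),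
      cost 2 le_rfl, Or.inl ⟨hP, by simp⟩⟩
  · refine ⟨_, _, .seq (.idxConst _ _ _) (.seq (.idxConst _ _ _) (.seq r₂ (.seq (.idxAdd _ _ _ _)
      (.seq r₄ (.branchFalse (by simp [Cond.Holds, g7, h5]) (.idxConst _ _ _)))))),
      cost 0 (by omega), Or.inr ⟨hP, by simp⟩⟩

end Compiler

/-! ## Cross products and convex polygons -/

theorem cross_add_left (a b c : Plane) : cross (a + b) c = cross a c + cross b c := by
  simp [cross]; ring

theorem cross_add_right (a b c : Plane) : cross a (b + c) = cross a b + cross a c := by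
  simp [cross]; ring

theorem cross_sub_left (a b c : Plane) : cross (a - b) c = cross a c - cross b c := by
  simp [cross]; ring

theorem cross_sub_right (a b c : Plane) : cross a (b - c) = cross a b - cross a c := by
  simp [cross]; ring

theorem cross_smul_left (r : ℝ) (a b : Plane) : cross (r • a) b = r * cross a b := by
  simp [cross]; ring

theorem cross_smul_right (r : ℝ) (a b : Plane) : cross a (r • b) = r * cross a b := by
  simp [cross]; ring

theorem cross_neg_left (a b : Plane) : cross (-a) b = - cross a b := by
  simp [cross]; ring

theorem cross_neg_right (a b : Plane) : cross a (-b) = - cross a b := by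
  simp [cross]; ring

theorem cross_same (a : Plane) : cross a a = 0 := by
  simp [cross]; ring

theorem cross_swap (a b : Plane) : cross a b = - cross b a := by
  simp [cross]; ring

theorem cross_zero_left (a : Plane) : cross 0 a = 0 := by simp [cross]

theorem cross_zero_right (a : Plane) : cross a 0 = 0 := by simp [cross]

theorem cross_sum_left {ι : Type*} (s : Finset ι) (f : ι → Plane) (b : Plane) :
    cross (∑ i ∈ s, f i) b = ∑ i ∈ s, cross (f i) b := by
  classical
  induction s using Finset.induction_on with
  | empty => simp [cross_zero_left]
  | insert a s ha ih => rw [Finset.sum_insert ha, Finset.sum_insert ha, cross_add_left, ih]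

theorem cross_sum_right {ι : Type*} (s : Finset ι) (f : ι → Plane) (b : Plane) :
    cross b (∑ i ∈ s, f i) = ∑ i ∈ s, cross b (f i) := by
  classical
  induction s using Finset.induction_on with
  | empty => simp [cross_zero_right]
  | insert a s ha ih => rw [Finset.sum_insert ha, Finset.sum_insert ha, cross_add_right, ih]

@[fun_prop]
theorem Continuous.cross {X : Type*} [TopologicalSpace X] {f g : X → Plane} (hf : Continuous f)
    (hg : Continuous g) : Continuous fun x => cross (f x) (g x) := by
  unfold _root_.cross; fun_prop

/-- Cramer's rule. -/
theorem cross_smul_eq (a b x : Plane) : cross a b • x = cross x b • a + cross a x • b := by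
  ext <;> simp [cross] <;> ring

theorem eq_smul_add_smul {a b : Plane} (h : cross a b ≠ 0) (x : Plane) :
    x = (cross x b / cross a b) • a + (cross a x / cross a b) • b := by
  rw [div_eq_inv_mul, div_eq_inv_mul, mul_smul, mul_smul, ← smul_add, ← cross_smul_eq,
    inv_smul_smul₀ h]

theorem exists_eq_smul_of_cross_eq_zero {a x : Plane} (ha : a ≠ 0) (h : cross a x = 0) :
    ∃ r : ℝ, x = r • a := by
  have : a.1 ≠ 0 ∨ a.2 ≠ 0 := by
    by_contra! hc; exact ha (Prod.ext hc.1 hc.2)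
  unfold cross at h
  rcases this with h1 | h1
  · refine ⟨x.1 / a.1, Prod.ext ?_ ?_⟩ <;> simp <;> field_simp; linarith
  · refine ⟨x.2 / a.2, Prod.ext ?_ ?_⟩ <;> simp <;> field_simp; linarith

/-! ### Geometry of symmetric convex polygons -/

namespace IsSymmConvexPolygon

variable {n : ℕ} {v : ZMod (2 * n) → Plane}

/-- The directed edge from `v i` to `v (i + 1)`. -/
def edge (v : ZMod (2 * n) → Plane) (i : ZMod (2 * n)) : Plane := v (i + 1) - v i

/-- The translation from the edge `i` to its opposite. -/
def trans (v : ZMod (2 * n) → Plane) (i : ZMod (2 * n)) : Plane := v (i + n + 1) - v i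

/-- The function that is nonnegative to the left of the directed edge from `v i` to `v (i + 1)`. -/
def side (v : ZMod (2 * n) → Plane) (i : ZMod (2 * n)) (x : Plane) : ℝ :=
  cross (edge v i) (x - v i)

theorem natCast_ne_zero {m : ℕ} (h : 0 < m) (hm : m < 2 * n) : (m : ZMod (2 * n)) ≠ 0 := by
  intro h0
  rw [ZMod.natCast_eq_zero_iff] at h0
  exact absurd (Nat.le_of_dvd h h0) (by omega)

theorem two_n_eq_zero : (n : ZMod (2 * n)) + n = 0 := by
  have := ZMod.natCast_self (2 * n)
  push_cast at this
  rw [← two_mul]; exact this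

theorem add_n_add_n (i : ZMod (2 * n)) : i + n + n = i := by
  rw [add_assoc, two_n_eq_zero, add_zero]

theorem side_self (i : ZMod (2 * n)) : side v i (v i) = 0 := by
  simp [side, cross_zero_right]

theorem side_succ (i : ZMod (2 * n)) : side v i (v (i + 1)) = 0 := by
  simp [side, edge, cross_same]

theorem side_eq_add (i : ZMod (2 * n)) (x y : Plane) :
    side v i (x + y) = side v i x + cross (edge v i) y := by
  rw [side, side, add_sub_right_comm, cross_add_right]

theorem side_lineMap (i : ZMod (2 * n)) (a b : ℝ) (x y : Plane) (h : a + b = 1) :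
    side v i (a • x + b • y) = a * side v i x + b * side v i y := by
  have : a • x + b • y - v i = a • (x - v i) + b • (y - v i) := by
    have : v i = (a + b) • v i := by rw [h, one_smul]
    nth_rw 1 [this]; module
  rw [side, this, cross_add_right, cross_smul_right, cross_smul_right]; rfl

theorem edge_sum (i : ZMod (2 * n)) (m : ℕ) :
    v (i + m) - v i = ∑ t ∈ Finset.range m, edge v (i + t) := by
  induction m with
  | zero => simp
  | succ m ih =>
    rw [Finset.sum_range_succ, ← ih, edge]
    push_cast
    rw [← add_assoc]; abel

variable (h : IsSymmConvexPolygon n v)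
include h

theorem neZero : NeZero (2 * n) := ⟨by have := h.two_le; omega⟩

theorem one_ne_zero : (1 : ZMod (2 * n)) ≠ 0 := by
  have := natCast_ne_zero (n := n) (m := 1) one_pos (by have := h.two_le; omega)
  simpa using this

theorem two_ne_zero : (2 : ZMod (2 * n)) ≠ 0 := by
  have := natCast_ne_zero (n := n) (m := 2) two_pos (by have := h.two_le; omega)
  simpa using this

theorem side_pos {i k : ZMod (2 * n)} (h1 : k ≠ i) (h2 : k ≠ i + 1) : 0 < side v i (v k) :=
  h.convex i k h1 h2

theorem side_nonneg (i k : ZMod (2 * n)) : 0 ≤ side v i (v k) := by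
  by_cases h1 : k = i
  · rw [h1, side_self]
  by_cases h2 : k = i + 1
  · rw [h2, side_succ]
  exact (h.side_pos h1 h2).le

theorem cross_edge_succ (i : ZMod (2 * n)) : 0 < cross (edge v i) (edge v (i + 1)) := by
  have := h.side_pos (i := i) (k := i + 1 + 1) (by
    intro e
    apply h.two_ne_zero
    have : i + 1 + 1 = i + 2 := by ring
    rw [this] at e; simpa using e) (by simpa using h.one_ne_zero)
  rw [side] at this
  have e : v (i + 1 + 1) - v i = edge v (i + 1) + edge v i := by simp [edge]
  rwa [e, cross_add_right, cross_same, add_zero] at this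

theorem edge_ne_zero (i : ZMod (2 * n)) : edge v i ≠ 0 := by
  intro e
  have := h.cross_edge_succ i
  rw [e, cross_zero_left] at this
  exact lt_irrefl _ this

theorem vertex_opposite (i j : ZMod (2 * n)) : v i + v (i + n) = v j + v (j + n) := by
  obtain ⟨c, hc⟩ := h.symm
  rw [hc, hc]

theorem edge_opposite (i : ZMod (2 * n)) : edge v (i + n) = - edge v i := by
  have := h.vertex_opposite i (i + 1)
  rw [edge, edge, add_right_comm]
  linear_combination -this

theorem trans_eq (i : ZMod (2 * n)) (j : ZMod (2 * n)) :
    trans v i = v j + v (j + n) - v (i + 1) - v i := by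
  have := h.vertex_opposite (i + 1) j
  rw [trans, add_right_comm]
  linear_combination this

theorem trans_opposite (i : ZMod (2 * n)) : trans v (i + n) = - trans v i := by
  rw [h.trans_eq i i, trans, add_n_add_n]
  abel

theorem vertex_add_n (i : ZMod (2 * n)) : v (i + n) = v (i + 1) + trans v i := by
  rw [h.trans_eq i i]; abel

/-- A vertex between an edge on which a linear function increases and an edge on which it does
not is a global maximum. -/
theorem side_le_of_local_max {a k : ZMod (2 * n)} (h1 : 0 ≤ cross (edge v a) (edge v k))
    (h2 : cross (edge v a) (edge v (k + 1)) ≤ 0) (q : ZMod (2 * n)) :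
    side v a (v q) ≤ side v a (v (k + 1)) := by
  have hp := h.cross_edge_succ k
  -- By convexity `v q - v (k + 1)` lies to the left of both edges at `v (k + 1)`; Cramer's rule
  -- expands it in these two edges with known signs.
  have e := cross_smul_eq (edge v k) (edge v (k + 1)) (v q - v (k + 1))
  have e' := congrArg (cross (edge v a)) e
  rw [cross_add_right, cross_smul_right, cross_smul_right, cross_smul_right] at e'
  have n1 : 0 ≤ cross (edge v k) (v q - v (k + 1)) := by
    have := h.side_nonneg k q
    rw [side] at this
    have e : v q - v k = (v q - v (k + 1)) + edge v k := by simp [edge]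
    rwa [e, cross_add_right, cross_same, add_zero] at this
  have n2 : cross (v q - v (k + 1)) (edge v (k + 1)) ≤ 0 := by
    have := h.side_nonneg (k + 1) q
    rw [cross_swap]; rw [side] at this; linarith
  have e3 : v q = v (k + 1) + (v q - v (k + 1)) := by abel
  rw [e3, side_eq_add]
  have : cross (edge v k) (edge v (k + 1)) * cross (edge v a) (v q - v (k + 1)) ≤ 0 := by
    rw [e']; nlinarith [mul_nonneg n1 (neg_nonneg.2 h2), mul_nonneg (neg_nonneg.2 n2) h1]
  have : cross (edge v a) (v q - v (k + 1)) ≤ 0 := by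
    by_contra! hc; nlinarith
  linarith

/-- The opposite edge is antiparallel to the edge `a`, so being strictly to the left of it means
having a smaller value of `side v a`. -/
theorem side_lt_opposite {a k : ZMod (2 * n)} (h1 : k ≠ a + n) (h2 : k ≠ a + n + 1) :
    side v a (v k) < side v a (v (a + n)) := by
  have := h.side_pos (i := a + n) h1 h2
  rw [side, h.edge_opposite, cross_neg_left] at this
  have e : v k = v (a + n) + (v k - v (a + n)) := by abel
  rw [e, side_eq_add]; linarith

/-- If the sign changed before the opposite edge, the vertex where this happens would be a local,
hence a global maximum of `side v a`; but the maximum is attained on the opposite edge only. -/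
theorem cross_edge_pos (a : ZMod (2 * n)) (m : ℕ) (hm : m + 1 < n) :
    0 < cross (edge v a) (edge v (a + (m + 1 : ℕ))) := by
  induction m with
  | zero => simpa using h.cross_edge_succ a
  | succ m ih =>
    by_contra! hc
    have h1 := (ih (by omega)).le
    have e : a + ((m + 1 + 1 : ℕ) : ZMod (2 * n)) = a + (m + 1 : ℕ) + 1 := by
      push_cast; ring
    rw [e] at hc
    have h3 := h.side_le_of_local_max h1 hc (a + n)
    have key : ∀ k l : ℕ, k < l → l < k + 2 * n → (a + (k : ZMod (2 * n))) ≠ a + l := by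
      intro k l hkl hl e
      obtain ⟨d, rfl⟩ := Nat.exists_eq_add_of_lt hkl
      rw [add_assoc k, Nat.cast_add, ← add_assoc, left_eq_add] at e
      exact natCast_ne_zero (n := n) (m := d + 1) (by omega) (by omega) e
    have h4 := h.side_lt_opposite (a := a) (k := a + (m + 1 : ℕ) + 1)
      (by have := key (m + 1 + 1) n (by omega) (by omega); rwa [← e])
      (by have := key (m + 1 + 1) (n + 1) (by omega) (by omega)
          rw [← e]; rwa [Nat.cast_add n, ← add_assoc, Nat.cast_one] at this)
    linarith

theorem cross_edge_ne_zero {j k : ZMod (2 * n)} (h1 : k ≠ j) (h2 : k ≠ j + n) :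
    cross (edge v j) (edge v k) ≠ 0 := by
  have := h.neZero
  have hk : k = j + ((k - j).val : ZMod (2 * n)) := by simp
  have hlt := ZMod.val_lt (k - j)
  generalize (k - j).val = t at hk hlt
  have t0 : t ≠ 0 := by rintro rfl; simp at hk; exact h1 hk
  have tn : t ≠ n := by rintro rfl; exact h2 hk
  rcases lt_or_gt_of_ne tn with hl | hl
  · have := h.cross_edge_pos j (t - 1) (by omega)
    rw [Nat.sub_add_cancel (by omega), ← hk] at this
    exact this.ne'
  · have := h.cross_edge_pos j (t - n - 1) (by omega)
    rw [Nat.sub_add_cancel (by omega)] at this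
    have e : k = j + ((t - n : ℕ) : ZMod (2 * n)) + n := by
      rw [hk, add_assoc, ← Nat.cast_add, Nat.sub_add_cancel hl.le]
    rw [e, h.edge_opposite, cross_neg_right]
    exact neg_ne_zero.2 this.ne'

/-- Both diagonals are sums of edges, and every edge of the first sum makes a positive cross product
with every edge of the second, since all of them are among `n` consecutive edges. -/
theorem cross_diagonal_pos (i : ZMod (2 * n)) {m : ℕ} (h0 : 0 < m) (hm : m < n) :
    0 < cross (v (i + m) - v i) (v (i + n) - v (i + m)) := by
  have e1 := edge_sum (v := v) i m
  have e2 := edge_sum (v := v) (i + m) (n - m)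
  rw [add_assoc i, ← Nat.cast_add, Nat.add_sub_cancel' hm.le] at e2
  rw [e1, e2, cross_sum_left]
  simp_rw [cross_sum_right]
  refine Finset.sum_pos (fun t ht => Finset.sum_pos (fun s hs => ?_) ⟨0, by simp; omega⟩)
    ⟨0, by simp; omega⟩
  rw [Finset.mem_range] at ht hs
  have := h.cross_edge_pos (i + t) (m + s - t - 1) (by omega)
  rw [Nat.sub_add_cancel (by omega), add_assoc, ← Nat.cast_add, Nat.add_sub_cancel' (by omega),
    Nat.cast_add, ← add_assoc] at this
  exact this

/-- With `x = v (i + m) - v i` and `y = v (i + n) - v (i + m)`, central symmetry turns the two long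
diagonals into `-(x + y)` and `x - y`, whose cross product is twice that of `x` and `y`. -/
theorem cross_diameter_nonneg (i : ZMod (2 * n)) {m : ℕ} (hm : m ≤ n) :
    0 ≤ cross (v i - v (i + n)) (v (i + m) - v (i + m + n)) ∧
    (0 < m → m < n → 0 < cross (v i - v (i + n)) (v (i + m) - v (i + m + n))) := by
  have e : cross (v i - v (i + n)) (v (i + m) - v (i + m + n)) =
      2 * cross (v (i + m) - v i) (v (i + n) - v (i + m)) := by
    have e1 : v (i + m) - v (i + m + n) = (v (i + m) - v i) - (v (i + n) - v (i + m)) := by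
      have := h.vertex_opposite i (i + m)
      linear_combination this
    have e2 : v i - v (i + n) = - ((v (i + m) - v i) + (v (i + n) - v (i + m))) := by abel
    rw [e1, e2]
    simp only [cross, Prod.fst_sub, Prod.snd_sub, Prod.fst_add, Prod.snd_add, Prod.fst_neg,
      Prod.snd_neg]
    ring
  rw [e]
  have pos : 0 < m → m < n → 0 < 2 * cross (v (i + m) - v i) (v (i + n) - v (i + m)) :=
    fun h0 hm => mul_pos two_pos (h.cross_diagonal_pos i h0 hm)
  refine ⟨?_, pos⟩
  rcases Nat.eq_zero_or_pos m with rfl | h0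
  · simp [cross_zero_left]
  rcases hm.eq_or_lt with rfl | hm
  · simp [cross_zero_right]
  exact (pos h0 hm).le

/-- Twice `τ_i` is minus the sum of the long diagonals through `v i` and `v (i + 1)`. The product
thus expands into four cross products of long diagonals, all nonnegative and the one of `i` and `i +
m` positive. -/
theorem cross_trans_pos (i : ZMod (2 * n)) {m : ℕ} (h0 : 0 < m) (hm : m < n) :
    0 < cross (trans v i) (trans v (i + m)) := by
  have key : ∀ i, (2 : ℝ) • trans v i = -((v i - v (i + n)) + (v (i + 1) - v (i + 1 + n))) := by
    intro i
    have e1 := h.trans_eq i i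
    have e2 := h.vertex_opposite i (i + 1)
    rw [two_smul]; nth_rw 1 [e1]
    rw [h.trans_eq i (i + 1)]; abel
  have e : 4 * cross (trans v i) (trans v (i + m)) =
      cross ((2 : ℝ) • trans v i) ((2 : ℝ) • trans v (i + m)) := by
    rw [cross_smul_left, cross_smul_right]; ring
  rw [key, key, cross_neg_left, cross_neg_right, cross_add_left, cross_add_right,
    cross_add_right] at e
  have p1 := (h.cross_diameter_nonneg i hm.le).2 h0 hm
  have p2 := (h.cross_diameter_nonneg i (m := m + 1) hm).1
  have p3 := (h.cross_diameter_nonneg (i + 1) (m := m - 1) (by omega)).1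
  have p4 := (h.cross_diameter_nonneg (i + 1) hm.le).1
  rw [Nat.cast_add, Nat.cast_one, ← add_assoc] at p2
  have e3 : i + 1 + ((m - 1 : ℕ) : ZMod (2 * n)) = i + m := by
    rw [add_assoc, add_comm 1, ← Nat.cast_add_one, Nat.sub_add_cancel h0]
  rw [e3] at p3
  rw [add_right_comm i 1 (m : ZMod (2 * n))] at p4
  linarith

/-- For the inclusion of the intersection of half-planes in the hull, the diagonals from `v 0` cut
the polygon into triangles. The least `m` for which `x` is not to the left of the diagonal to `v (m
+ 2)` singles out a triangle, and the half-plane of the edge `m + 1` gives the last barycentric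
inequality. -/
theorem polygon_eq : polygon v = {x | ∀ i, 0 ≤ side v i x} := by
  have := h.neZero
  apply Set.Subset.antisymm
  · refine convexHull_min ?_ ?_
    · rintro _ ⟨k, rfl⟩ i
      exact h.side_nonneg i k
    · intro x hx y hy a b ha hb hab i
      rw [side_lineMap i a b x y hab]
      have := hx i
      have := hy i
      positivity
  · intro x hx
    have h2 := h.two_le
    let w : ℕ → ℝ := fun m => cross (v m - v 0) (x - v 0)
    have hw1 : 0 ≤ w 1 := by
      have := hx 0
      simpa [side, edge, w] using this
    have hw2 : w (2 * n - 1) ≤ 0 := by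
      have := hx ((2 * n - 1 : ℕ) : ZMod (2 * n))
      have e : ((2 * n - 1 : ℕ) : ZMod (2 * n)) + 1 = 0 := by
        rw [← Nat.cast_add_one, Nat.sub_add_cancel (by omega), ZMod.natCast_self]
      simp only [side, edge, e] at this
      have e2 : cross (v 0 - v ((2 * n - 1 : ℕ) : ZMod (2 * n)))
          (x - v ((2 * n - 1 : ℕ) : ZMod (2 * n))) = - w (2 * n - 1) := by
        simp only [w, cross, Prod.fst_sub, Prod.snd_sub]; ring
      linarith
    have hex : ∃ m, w (m + 2) ≤ 0 := ⟨2 * n - 3, by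
      rwa [show 2 * n - 3 + 2 = 2 * n - 1 by omega]⟩
    classical
    obtain ⟨m, hm, hmin⟩ : ∃ m, w (m + 2) ≤ 0 ∧ ∀ m' < m, ¬ w (m' + 2) ≤ 0 :=
      ⟨Nat.find hex, Nat.find_spec hex, fun m' => Nat.find_min hex⟩
    have hmle : m ≤ 2 * n - 3 := by
      by_contra! hc
      exact hmin _ hc (by rwa [show 2 * n - 3 + 2 = 2 * n - 1 by omega])
    have hm1 : 0 ≤ w (m + 1) := by
      rcases Nat.eq_zero_or_pos m with rfl | h0
      · exact hw1
      · have := hmin (m - 1) (by omega)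
        rw [show m - 1 + 2 = m + 1 by omega] at this
        exact (not_le.1 this).le
    have hA := h.side_pos (i := ((m + 1 : ℕ) : ZMod (2 * n))) (k := 0)
      (natCast_ne_zero (by omega) (by omega)).symm
      (by rw [← Nat.cast_add_one]; exact (natCast_ne_zero (by omega) (by omega)).symm)
    have hx1 := hx ((m + 1 : ℕ) : ZMod (2 * n))
    have c0 : v 0 ∈ polygon v := subset_convexHull ℝ _ ⟨0, rfl⟩
    have c1 : v ((m + 1 : ℕ) : ZMod (2 * n)) ∈ polygon v := subset_convexHull ℝ _ ⟨_, rfl⟩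
    have c2 : v ((m + 2 : ℕ) : ZMod (2 * n)) ∈ polygon v := subset_convexHull ℝ _ ⟨_, rfl⟩
    simp only [side, edge, ← Nat.cast_add_one] at hA hx1
    have e2 : m + 1 + 1 = m + 2 := rfl
    rw [e2] at hA hx1
    simp only [w] at hm hm1
    generalize v ((m + 1 : ℕ) : ZMod (2 * n)) = p at *
    generalize v ((m + 2 : ℕ) : ZMod (2 * n)) = q at *
    generalize v 0 = o at *
    have eA : cross (q - p) (o - p) = cross (p - o) (q - o) := by
      simp only [cross, Prod.fst_sub, Prod.snd_sub]; ring
    have e3 : cross (q - p) (x - p) =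
        cross (p - o) (q - o) - cross (x - o) (q - o) - cross (p - o) (x - o) := by
      simp only [cross, Prod.fst_sub, Prod.snd_sub]; ring
    rw [eA] at hA
    rw [e3] at hx1
    rw [cross_swap] at hm
    have ex := eq_smul_add_smul hA.ne' (x - o)
    set α := cross (x - o) (q - o) / cross (p - o) (q - o) with hα
    set β := cross (p - o) (x - o) / cross (p - o) (q - o) with hβ
    have hα0 : 0 ≤ α := div_nonneg (by linarith) hA.le
    have hβ0 : 0 ≤ β := div_nonneg (by linarith) hA.le
    have hαβ : α + β ≤ 1 := by
      rw [hα, hβ, ← add_div, div_le_one hA]; linarith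
    have := (convex_convexHull ℝ (Set.range v)).sum_mem (t := Finset.univ)
      (w := ![1 - α - β, α, β]) (z := ![o, p, q])
      (by intro i _; fin_cases i <;> simp <;> linarith)
      (by simp [Fin.sum_univ_three]; ring)
      (by intro i _; fin_cases i <;> assumption)
    have e4 : x = o + (x - o) := by abel
    rw [e4, ex]
    have e5 : o + (α • (p - o) + β • (q - o)) =
        ∑ i : Fin 3, ![1 - α - β, α, β] i • ![o, p, q] i := by
      simp [Fin.sum_univ_three]; module
    rw [e5]
    exact this

/-- On the line of the edge `i`, the half-plane of the previous edge bounds the parameter from below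
and that of the next edge bounds it from above. -/
theorem mem_segment_of_side_eq_zero {x : Plane} (hx : x ∈ polygon v) {i : ZMod (2 * n)}
    (hi : side v i x = 0) : x ∈ segment ℝ (v i) (v (i + 1)) := by
  rw [h.polygon_eq] at hx
  obtain ⟨s, hs⟩ := exists_eq_smul_of_cross_eq_zero (h.edge_ne_zero i) hi
  have e : x = v i + s • edge v i := by rw [← hs]; abel
  have h1 := hx (i + 1)
  have h2 := hx (i - 1)
  have p1 := h.cross_edge_succ i
  have p2 := h.cross_edge_succ (i - 1)
  rw [sub_add_cancel] at p2
  have s0 : 0 ≤ s := by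
    have e3 : side v (i - 1) (v i) = 0 := by
      have := side_succ (v := v) (i - 1); rwa [sub_add_cancel] at this
    rw [e, side_eq_add, e3, zero_add, cross_smul_right] at h2
    exact nonneg_of_mul_nonneg_left h2 p2
  have s1 : s ≤ 1 := by
    have e3 : x = v (i + 1) + (s - 1) • edge v i := by rw [e, edge]; module
    rw [e3, side_eq_add, side_self, zero_add, cross_smul_right,
      cross_swap (edge v (i + 1))] at h1
    nlinarith
  exact ⟨1 - s, s, by linarith, s0, by ring, by rw [e, edge]; module⟩

omit h in
theorem segment_subset (i : ZMod (2 * n)) : segment ℝ (v i) (v (i + 1)) ⊆ polygon v :=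
  (convex_convexHull ℝ _).segment_subset (subset_convexHull ℝ _ ⟨i, rfl⟩)
    (subset_convexHull ℝ _ ⟨i + 1, rfl⟩)

omit h in
theorem side_eq_zero_of_mem_segment {i : ZMod (2 * n)} {x : Plane}
    (hx : x ∈ segment ℝ (v i) (v (i + 1))) : side v i x = 0 := by
  obtain ⟨a, b, ha, hb, hab, rfl⟩ := hx
  rw [side_lineMap i a b _ _ hab, side_self, side_succ]; simp

theorem side_pos_of_mem_segment {i k : ZMod (2 * n)} {x : Plane}
    (hx : x ∈ segment ℝ (v i) (v (i + 1))) (hv : ∀ j, x ≠ v j) (hk : k ≠ i) :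
    0 < side v k x := by
  obtain ⟨a, b, ha, hb, hab, rfl⟩ := hx
  have ha : 0 < a := by
    refine ha.lt_of_ne ?_
    rintro rfl
    apply hv (i + 1)
    rw [zero_add] at hab; simp [hab]
  have hb : 0 < b := by
    refine hb.lt_of_ne ?_
    rintro rfl
    apply hv i
    rw [add_zero] at hab; simp [hab]
  rw [side_lineMap k a b _ _ hab]
  have n1 := h.side_nonneg k i
  have n2 := h.side_nonneg k (i + 1)
  by_cases h1 : i = k + 1
  · have : 0 < side v k (v (i + 1)) := by
      apply h.side_pos
      · rw [h1]; intro e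
        apply h.two_ne_zero
        rw [add_assoc] at e; simpa [one_add_one_eq_two] using e
      · rw [h1]; simpa using h.one_ne_zero
    positivity
  · have : 0 < side v k (v i) := h.side_pos (Ne.symm hk) h1
    positivity

end IsSymmConvexPolygon

open Filter Topology

/-! ## Counting translates by a discrete group -/

section Count

variable (L : Submodule ℤ Plane)

/-- The number of translates of `A` by elements of `L` that contain `x`. -/
noncomputable def latticeCount (A : Set Plane) (x : Plane) : ℕ :=
  {l : Plane | l ∈ L ∧ x - l ∈ A}.ncard

variable [DiscreteTopology L]

theorem isClosed_of_discreteTopology : IsClosed (L : Set Plane) := by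
  have : DiscreteTopology L.toAddSubgroup := ‹_›
  exact AddSubgroup.isClosed_of_discrete (H := L.toAddSubgroup)

theorem countable_of_discreteTopology : (L : Set Plane).Countable := by
  have : Countable L := countable_of_Lindelof_of_discrete
  exact Set.to_countable _

theorem finite_inter_of_isBounded {K : Set Plane} (hK : Bornology.IsBounded K) :
    {l | l ∈ L ∧ l ∈ K}.Finite := by
  have h : IsDiscrete (L : Set Plane) := ⟨‹_›⟩
  refine (Metric.finite_isBounded_inter_isClosed h hK (isClosed_of_discreteTopology L)).subset ?_
  exact fun l hl => ⟨hl.2, hl.1⟩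

theorem finite_translates {A : Set Plane} (hA : Bornology.IsBounded A) {K : Set Plane}
    (hK : Bornology.IsBounded K) : {l | l ∈ L ∧ ∃ x ∈ K, x - l ∈ A}.Finite := by
  refine (finite_inter_of_isBounded L (hK.sub hA)).subset ?_
  rintro l ⟨hl, x, hx, hxl⟩
  exact ⟨hl, x, hx, x - l, hxl, by simp⟩

theorem finite_count {A : Set Plane} (hA : Bornology.IsBounded A) (x : Plane) :
    {l | l ∈ L ∧ x - l ∈ A}.Finite := by
  refine (finite_translates L hA (Bornology.isBounded_singleton (x := x))).subset ?_
  exact fun l hl => ⟨hl.1, x, rfl, hl.2⟩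

/-- Near a point, only finitely many translates matter. -/
theorem exists_finset_count {A : Set Plane} (hA : Bornology.IsBounded A) (p : Plane) :
    ∃ T : Finset Plane, (∀ l ∈ T, l ∈ L) ∧ ∀ B ⊆ A, ∀ x ∈ Metric.ball p 1,
      (latticeCount L B x : ℤ) = ∑ l ∈ T, B.indicator (1 : Plane → ℤ) (x - l) := by
  classical
  have hf := finite_translates L hA (Metric.isBounded_ball (x := p) (r := 1))
  refine ⟨hf.toFinset, fun l hl => ((Set.Finite.mem_toFinset _).1 hl).1, fun B hB x hx => ?_⟩
  have : {l | l ∈ L ∧ x - l ∈ B} = ((hf.toFinset.filter fun l => x - l ∈ B : Finset Plane) :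
      Set Plane) := by
    ext l
    simp only [Set.mem_ofPred_eq, Finset.coe_filter, Set.Finite.mem_toFinset]
    exact ⟨fun h => ⟨⟨h.1, x, hx, hB h.2⟩, h.2⟩, fun h => ⟨h.1.1, h.2⟩⟩
  rw [latticeCount, this, Set.ncard_coe_finset, Finset.card_filter, Nat.cast_sum]
  refine Finset.sum_congr rfl fun l _ => ?_
  by_cases h : x - l ∈ B <;> simp [h]

end Count

theorem volume_line_eq_zero {a : Plane} (ha : a ≠ 0) (c : Plane) :
    volume {x : Plane | cross a (x - c) = 0} = 0 := by
  let f : Plane →ₗ[ℝ] ℝ :=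
    { toFun := fun x => cross a x
      map_add' := cross_add_right a
      map_smul' := fun r x => cross_smul_right r a x }
  have h0 : volume (LinearMap.ker f : Set Plane) = 0 := by
    apply Measure.addHaar_submodule
    intro htop
    have h1 : f (-a.2, a.1) = 0 := by
      rw [← LinearMap.mem_ker, htop]; trivial
    have h2 : a.1 * a.1 + a.2 * a.2 = 0 := by simpa [f, cross] using h1
    apply ha
    have := mul_self_add_mul_self_eq_zero.1 h2
    exact Prod.ext this.1 this.2
  have := measure_preimage_add_right volume (-c) (LinearMap.ker f : Set Plane)
  rw [h0] at this
  convert this using 2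
  ext x
  simp [f, sub_eq_add_neg]

/-- A function of a real variable whose one-sided limits agree everywhere is constant outside of
isolated points. -/
theorem exists_eventually_eq_of_punctured {G : ℝ → ℤ}
    (hG : ∀ t, ∃ a, ∀ᶠ s in 𝓝[≠] t, G s = a) : ∃ a, ∀ t, ∀ᶠ s in 𝓝[≠] t, G s = a := by
  choose g hg using hG
  -- Off `t` and near it, `G` equals `g t`, so the punctured limits at nearby points are `g t` as
  -- well. Connectedness of the line does the rest.
  have hloc : IsLocallyConstant g := by
    rw [IsLocallyConstant.iff_eventually_eq]
    intro t
    have h1 := eventually_eventually_nhdsWithin.2 (hg t)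
    rw [eventually_nhdsWithin_iff] at h1
    filter_upwards [h1] with s hs
    by_cases hst : s = t
    · rw [hst]
    · have h2 := hs hst
      have h3 : ∀ᶠ u in 𝓝[≠] s, G u = g t := by
        rw [IsOpen.nhdsWithin_eq isOpen_compl_singleton hst] at h2
        exact h2.filter_mono nhdsWithin_le_nhds
      obtain ⟨u, hu1, hu2⟩ := (h3.and (hg s)).exists
      rw [← hu2, hu1]
  refine ⟨g 0, fun t => ?_⟩
  rw [hloc.apply_eq_of_preconnectedSpace 0 t]
  exact hg t

/-! ### The jump of the covering number at the boundary -/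

namespace IsSymmConvexPolygon

variable {n : ℕ} {v : ZMod (2 * n) → Plane} (h : IsSymmConvexPolygon n v)
include h

theorem isBounded_polygon : Bornology.IsBounded (polygon v) := by
  have := h.neZero
  exact (isBounded_convexHull).2 (Set.finite_range v).isBounded

theorem isClosed_polygon : IsClosed (polygon v) := by
  rw [h.polygon_eq, Set.ofPred_forall]
  refine isClosed_iInter fun i => isClosed_le continuous_const ?_
  unfold side; fun_prop

/-- The change of the indicator function of the polygon along a line that meets the boundary in a
point that is not a vertex. -/
theorem indicator_jump [Fintype (ZMod (2 * n))] {p : Plane} (hp : ∀ j, p ≠ v j) {w : Plane}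
    (hw : ∀ k, cross (edge v k) w ≠ 0) : ∃ a b : ℤ,
    (∀ᶠ ε in 𝓝[>] (0 : ℝ), (polygon v).indicator (1 : Plane → ℤ) (p + ε • w) = a) ∧
    (∀ᶠ ε in 𝓝[>] (0 : ℝ), (polygon v).indicator (1 : Plane → ℤ) (p - ε • w) = b) ∧
    a - b = ∑ k, (SignType.sign (cross (edge v k) w) : ℤ) *
      (segment ℝ (v k) (v (k + 1))).indicator (1 : Plane → ℤ) p := by
  have c1 : Tendsto (fun ε : ℝ => p + ε • w) (𝓝[>] 0) (𝓝 p) := by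
    have : Continuous fun ε : ℝ => p + ε • w := by fun_prop
    simpa using (this.tendsto 0).mono_left nhdsWithin_le_nhds
  have c2 : Tendsto (fun ε : ℝ => p - ε • w) (𝓝[>] 0) (𝓝 p) := by
    have : Continuous fun ε : ℝ => p - ε • w := by fun_prop
    simpa using (this.tendsto 0).mono_left nhdsWithin_le_nhds
  have cside : ∀ k, Continuous (side v k) := fun k => by unfold side; fun_prop
  -- Nothing changes near interior and exterior points. At a boundary point that is not a vertex,
  -- exactly one `side v i` vanishes, and its sign alone decides membership nearby.
  by_cases hpP : p ∈ polygon v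
  · by_cases hall : ∀ k, 0 < side v k p
    · have ev : ∀ᶠ x in 𝓝 p, x ∈ polygon v := by
        have : ∀ᶠ x in 𝓝 p, ∀ k, 0 < side v k x :=
          eventually_all.2 fun k => continuousAt_const.eventually_lt (cside k).continuousAt (hall k)
        filter_upwards [this] with x hx
        rw [h.polygon_eq]; exact fun k => (hx k).le
      refine ⟨1, 1, ?_, ?_, ?_⟩
      · filter_upwards [c1.eventually ev] with ε hε; simp [hε]
      · filter_upwards [c2.eventually ev] with ε hε; simp [hε]
      · symm
        rw [sub_self]
        refine Finset.sum_eq_zero fun k _ => ?_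
        rw [Set.indicator_of_notMem, mul_zero]
        intro hk
        exact (hall k).ne' (side_eq_zero_of_mem_segment hk)
    · push Not at hall
      obtain ⟨i, hi⟩ := hall
      have hpP' := hpP
      rw [h.polygon_eq] at hpP'
      have hi0 : side v i p = 0 := le_antisymm hi (hpP' i)
      have hseg := h.mem_segment_of_side_eq_zero hpP hi0
      have hpos : ∀ k, k ≠ i → 0 < side v k p := fun k hk =>
        h.side_pos_of_mem_segment hseg hp hk
      have ev : ∀ᶠ x in 𝓝 p, ∀ k, k ≠ i → 0 < side v k x :=
        eventually_all.2 fun k => by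
          by_cases hk : k = i
          · simp [hk]
          · filter_upwards [continuousAt_const.eventually_lt (cside k).continuousAt (hpos k hk)] with x hx _
            exact hx
      have mem : ∀ x, (∀ k, k ≠ i → 0 < side v k x) → (x ∈ polygon v ↔ 0 ≤ side v i x) := by
        intro x hx
        rw [h.polygon_eq]
        refine ⟨fun h => h i, fun hxi k => ?_⟩
        by_cases hk : k = i
        · rwa [hk]
        · exact (hx k hk).le
      have s1 : ∀ ε : ℝ, side v i (p + ε • w) = ε * cross (edge v i) w := fun ε => by
        rw [side_eq_add, hi0, cross_smul_right, zero_add]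
      have s2 : ∀ ε : ℝ, side v i (p - ε • w) = -(ε * cross (edge v i) w) := fun ε => by
        rw [sub_eq_add_neg, side_eq_add, hi0, cross_neg_right, cross_smul_right, zero_add]
      have hsum : ∑ k, (SignType.sign (cross (edge v k) w) : ℤ) *
          (segment ℝ (v k) (v (k + 1))).indicator (1 : Plane → ℤ) p =
          (SignType.sign (cross (edge v i) w) : ℤ) := by
        rw [Finset.sum_eq_single i]
        · simp [hseg]
        · intro k _ hk
          rw [Set.indicator_of_notMem, mul_zero]
          intro hk'
          exact (hpos k hk).ne' (side_eq_zero_of_mem_segment hk')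
        · simp
      rw [hsum]
      rcases lt_or_gt_of_ne (hw i) with hneg | hpos'
      · refine ⟨0, 1, ?_, ?_, ?_⟩
        · filter_upwards [c1.eventually ev, self_mem_nhdsWithin] with ε hε h0
          have h0 : 0 < ε := h0
          rw [Set.indicator_of_notMem]
          rw [mem _ hε, s1, not_le]
          exact mul_neg_of_pos_of_neg h0 hneg
        · filter_upwards [c2.eventually ev, self_mem_nhdsWithin] with ε hε h0
          have h0 : 0 < ε := h0
          rw [Set.indicator_of_mem, Pi.one_apply]
          rw [mem _ hε, s2]
          nlinarith
        · simp [sign_neg hneg]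
      · refine ⟨1, 0, ?_, ?_, ?_⟩
        · filter_upwards [c1.eventually ev, self_mem_nhdsWithin] with ε hε h0
          have h0 : 0 < ε := h0
          rw [Set.indicator_of_mem, Pi.one_apply]
          rw [mem _ hε, s1]
          positivity
        · filter_upwards [c2.eventually ev, self_mem_nhdsWithin] with ε hε h0
          have h0 : 0 < ε := h0
          rw [Set.indicator_of_notMem]
          rw [mem _ hε, s2, not_le]
          have := mul_pos h0 hpos'
          linarith
        · simp [sign_pos hpos']
  · have ev : ∀ᶠ x in 𝓝 p, x ∉ polygon v := h.isClosed_polygon.isOpen_compl.mem_nhds hpP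
    refine ⟨0, 0, ?_, ?_, ?_⟩
    · filter_upwards [c1.eventually ev] with ε hε; simp [hε]
    · filter_upwards [c2.eventually ev] with ε hε; simp [hε]
    · symm
      rw [sub_self]
      refine Finset.sum_eq_zero fun k _ => ?_
      rw [Set.indicator_of_notMem, mul_zero]
      exact fun hk => hpP (segment_subset k hk)

variable (L : Submodule ℤ Plane) [DiscreteTopology L]

/-- The change of the number of translates of the polygon along a line. -/
theorem count_jump [Fintype (ZMod (2 * n))] {p : Plane} (hp : ∀ l ∈ L, ∀ j, p - l ≠ v j)
    {w : Plane} (hw : ∀ k, cross (edge v k) w ≠ 0) : ∃ a b : ℤ,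
    (∀ᶠ ε in 𝓝[>] (0 : ℝ), (latticeCount L (polygon v) (p + ε • w) : ℤ) = a) ∧
    (∀ᶠ ε in 𝓝[>] (0 : ℝ), (latticeCount L (polygon v) (p - ε • w) : ℤ) = b) ∧
    a - b = ∑ k, (SignType.sign (cross (edge v k) w) : ℤ) *
      (latticeCount L (segment ℝ (v k) (v (k + 1))) p : ℤ) := by
  obtain ⟨T, hT, hc⟩ := exists_finset_count L h.isBounded_polygon p
  have hj : ∀ l : T, _ := fun l => h.indicator_jump (hp l (hT l l.2)) hw
  choose a b h1 h2 h3 using hj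
  have c1 : Tendsto (fun ε : ℝ => p + ε • w) (𝓝[>] 0) (𝓝 p) := by
    have : Continuous fun ε : ℝ => p + ε • w := by fun_prop
    simpa using (this.tendsto 0).mono_left nhdsWithin_le_nhds
  have c2 : Tendsto (fun ε : ℝ => p - ε • w) (𝓝[>] 0) (𝓝 p) := by
    have : Continuous fun ε : ℝ => p - ε • w := by fun_prop
    simpa using (this.tendsto 0).mono_left nhdsWithin_le_nhds
  have ball := Metric.ball_mem_nhds p one_pos
  refine ⟨∑ l : T, a l, ∑ l : T, b l, ?_, ?_, ?_⟩
  · filter_upwards [c1.eventually ball, eventually_all.2 h1] with ε hε hl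
    rw [hc _ subset_rfl _ hε, ← Finset.sum_coe_sort T]
    refine Finset.sum_congr rfl fun l _ => ?_
    rw [← hl l, add_sub_right_comm]
  · filter_upwards [c2.eventually ball, eventually_all.2 h2] with ε hε hl
    rw [hc _ subset_rfl _ hε, ← Finset.sum_coe_sort T]
    refine Finset.sum_congr rfl fun l _ => ?_
    rw [← hl l, sub_right_comm]
  · rw [← Finset.sum_sub_distrib]
    simp_rw [h3]
    rw [Finset.sum_comm]
    refine Finset.sum_congr rfl fun k _ => ?_
    rw [hc _ (segment_subset k) p (Metric.mem_ball_self one_pos), Finset.mul_sum,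
      ← Finset.sum_coe_sort T]

end IsSymmConvexPolygon

/-! ### Multiple tilings and balanced edges -/

namespace IsSymmConvexPolygon

variable {n : ℕ} {v : ZMod (2 * n) → Plane}

/-- The point `x` is not on an edge of a translate of the polygon. -/
def OffEdges (v : ZMod (2 * n) → Plane) (L : Submodule ℤ Plane) (x : Plane) : Prop :=
  ∀ l ∈ L, ∀ k, x - l ∉ segment ℝ (v k) (v (k + 1))

/-- The point `x` is not a vertex of a translate of the polygon. -/
def OffVertices (v : ZMod (2 * n) → Plane) (L : Submodule ℤ Plane) (x : Plane) : Prop :=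
  ∀ l ∈ L, ∀ j, x - l ≠ v j

variable (L : Submodule ℤ Plane)

theorem OffEdges.offVertices {x : Plane} (hx : OffEdges v L x) : OffVertices v L x :=
  fun l hl j e => hx l hl j (e ▸ left_mem_segment ℝ _ _)

theorem countable_setOf_add_smul_eq {w : Plane} (hw : w ≠ 0) (p : Plane) {S : Set Plane}
    (hS : S.Countable) : {t : ℝ | p + t • w ∈ S}.Countable := by
  refine hS.preimage_of_injOn (f := fun t : ℝ => p + t • w) ?_
  intro a _ b _ hab
  exact smul_left_injective ℝ hw (add_left_cancel hab)

variable (h : IsSymmConvexPolygon n v) [DiscreteTopology L]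
include h

theorem ae_offEdges : ∀ᵐ x : Plane, OffEdges v L x := by
  have := h.neZero
  change ∀ᵐ x : Plane, ∀ l ∈ (L : Set Plane), ∀ k, x - l ∉ segment ℝ (v k) (v (k + 1))
  rw [ae_ball_iff (countable_of_discreteTopology L)]
  intro l _
  rw [ae_all_iff]
  intro k
  have := volume_line_eq_zero (h.edge_ne_zero k) (l + v k)
  rw [ae_iff]
  refine measure_mono_null ?_ this
  intro x hx
  have hx : x - l ∈ segment ℝ (v k) (v (k + 1)) := not_not.1 hx
  have := side_eq_zero_of_mem_segment hx
  rwa [side, sub_sub] at this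

/-- Only finitely many translates matter near `p`, and each of them has `p` either in its interior
or in its open complement. -/
theorem eventually_latticeCount_eq {p : Plane} (hp : OffEdges v L p) :
    ∀ᶠ x in 𝓝 p, latticeCount L (polygon v) x = latticeCount L (polygon v) p := by
  have := h.neZero
  obtain ⟨T, hT, hc⟩ := exists_finset_count L h.isBounded_polygon p
  have key : ∀ l : T, ∀ᶠ x in 𝓝 p, (x - (l : Plane) ∈ polygon v ↔ p - (l : Plane) ∈ polygon v) := by
    intro l
    have hcont : Tendsto (fun x : Plane => x - (l : Plane)) (𝓝 p) (𝓝 (p - l)) := by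
      have : Continuous fun x : Plane => x - (l : Plane) := by fun_prop
      exact this.tendsto p
    by_cases hl : p - (l : Plane) ∈ polygon v
    · have hl' := hl
      rw [h.polygon_eq] at hl'
      have : ∀ᶠ x in 𝓝 (p - (l : Plane)), ∀ k, 0 < side v k x := by
        refine eventually_all.2 fun k => continuousAt_const.eventually_lt
          (Continuous.continuousAt (by unfold side; fun_prop)) ?_
        exact (hl' k).lt_of_ne fun e =>
          hp l (hT l l.2) k (h.mem_segment_of_side_eq_zero hl e.symm)
      filter_upwards [hcont.eventually this] with x hx
      refine iff_of_true ?_ hl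
      rw [h.polygon_eq]; exact fun k => (hx k).le
    · filter_upwards [hcont.eventually (h.isClosed_polygon.isOpen_compl.mem_nhds hl)] with x hx
      exact iff_of_false hx hl
  filter_upwards [eventually_all.2 key, Metric.ball_mem_nhds p one_pos] with x hx hball
  have e1 := hc _ subset_rfl x hball
  have e2 := hc _ subset_rfl p (Metric.mem_ball_self one_pos)
  have : ∀ l ∈ T, (polygon v).indicator (1 : Plane → ℤ) (x - l) =
      (polygon v).indicator (1 : Plane → ℤ) (p - l) := by
    intro l hl
    have := hx ⟨l, hl⟩
    by_cases hm : p - l ∈ polygon v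
    · rw [Set.indicator_of_mem hm, Set.indicator_of_mem (this.2 hm)]; rfl
    · rw [Set.indicator_of_notMem hm, Set.indicator_of_notMem (mt this.1 hm)]
  rw [Finset.sum_congr rfl this, ← e2] at e1
  exact_mod_cast e1

/-- A line transversal to all edge directions meets each of the countably many translated edges in
at most one point. -/
theorem countable_not_offEdges (p : Plane) {w : Plane} (hw : ∀ k, cross (edge v k) w ≠ 0) :
    {t : ℝ | ¬ OffEdges v L (p + t • w)}.Countable := by
  have := h.neZero
  have hsub : {t : ℝ | ¬ OffEdges v L (p + t • w)} ⊆
      ⋃ l ∈ (L : Set Plane), ⋃ k, {(- side v k (p - l)) / cross (edge v k) w} := by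
    intro t ht
    have ht : ¬ OffEdges v L (p + t • w) := ht
    unfold OffEdges at ht
    push Not at ht
    obtain ⟨l, hl, k, hk⟩ := ht
    simp only [Set.mem_iUnion, Set.mem_singleton_iff]
    refine ⟨l, hl, k, ?_⟩
    have := side_eq_zero_of_mem_segment hk
    rw [add_sub_right_comm, side_eq_add, cross_smul_right] at this
    rw [eq_div_iff (hw k)]; linarith
  refine Set.Countable.mono hsub ?_
  exact (countable_of_discreteTopology L).biUnion fun l _ =>
    Set.countable_iUnion fun k => Set.countable_singleton _

omit [DiscreteTopology L] in
theorem exists_transversal : ∃ w : Plane, ∀ k, cross (edge v k) w ≠ 0 := by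
  have := h.neZero
  have : ∀ᵐ w : Plane, ∀ k, cross (edge v k) w ≠ 0 := by
    rw [ae_all_iff]
    intro k
    have := volume_line_eq_zero (h.edge_ne_zero k) 0
    rw [ae_iff]
    simpa using this
  exact this.exists

/-- If every point is on as many translates of an edge as of the opposite edge, then the
translates of the polygon form a multiple tiling. -/
theorem isMultipleTiling_of_balanced
    (hbal : ∀ p, OffVertices v L p → ∀ k, latticeCount L (segment ℝ (v k) (v (k + 1))) p =
      latticeCount L (segment ℝ (v (k + n)) (v (k + n + 1))) p) :
    IsMultipleTiling (polygon v) L := by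
  have := h.neZero
  let F := latticeCount L (polygon v)
  have jump : ∀ p, OffVertices v L p → ∀ w, (∀ k, cross (edge v k) w ≠ 0) → ∃ a : ℤ,
      (∀ᶠ ε in 𝓝[>] (0 : ℝ), (F (p + ε • w) : ℤ) = a) ∧
      (∀ᶠ ε in 𝓝[>] (0 : ℝ), (F (p - ε • w) : ℤ) = a) := by
    intro p hp w hw
    obtain ⟨a, b, h1, h2, h3⟩ := h.count_jump L hp hw
    -- Passing to opposite edges permutes the summands up to sign: the counts agree by hypothesis
    -- and the signs are reversed. So the sum equals its own negative.
    have e : ∑ k, (SignType.sign (cross (edge v k) w) : ℤ) *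
        (latticeCount L (segment ℝ (v k) (v (k + 1))) p : ℤ) = 0 := by
      have e1 := Equiv.sum_comp (Equiv.addRight (n : ZMod (2 * n))) fun k =>
        (SignType.sign (cross (edge v k) w) : ℤ) *
          (latticeCount L (segment ℝ (v k) (v (k + 1))) p : ℤ)
      simp only [Equiv.coe_addRight, h.edge_opposite, cross_neg_left, Left.sign_neg,
        ← hbal p hp] at e1
      have e2 : ∀ k, ((-SignType.sign (cross (edge v k) w) : SignType) : ℤ) =
          -(SignType.sign (cross (edge v k) w) : ℤ) := fun k => by
        rcases SignType.sign (cross (edge v k) w) <;> rfl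
      simp only [e2, neg_mul, Finset.sum_neg_distrib] at e1
      linarith
    rw [e] at h3
    exact ⟨a, h1, by rwa [show a = b by linarith]⟩
  -- Along a transversal line that avoids all vertices of translates, the one-sided limits of the
  -- count agree everywhere, so the count is the same at all points off the edges.
  have line : ∀ x w, (∀ t : ℝ, OffVertices v L (x + t • w)) → (∀ k, cross (edge v k) w ≠ 0) →
      OffEdges v L x → OffEdges v L (x + w) → F (x + w) = F x := by
    intro x w hx hw h0 h1
    obtain ⟨a, ha⟩ := exists_eventually_eq_of_punctured (G := fun t => (F (x + t • w) : ℤ))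
      (fun t => by
        obtain ⟨a, h1, h2⟩ := jump _ (hx t) w hw
        refine ⟨a, ?_⟩
        rw [← nhdsLT_sup_nhdsGT, eventually_sup]
        constructor
        · have c : Tendsto (fun s => t - s) (𝓝[<] t) (𝓝[>] 0) := by
            refine tendsto_nhdsWithin_of_tendsto_nhds_of_eventually_within _ ?_ ?_
            · have : Continuous fun s => t - s := by fun_prop
              simpa using (this.tendsto t).mono_left nhdsWithin_le_nhds
            · filter_upwards [self_mem_nhdsWithin] with s hs
              exact Set.mem_Ioi.2 (sub_pos.2 (Set.mem_Iio.1 hs))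
          filter_upwards [c.eventually h2] with s hs
          rw [← hs]; congr 2; module
        · have c : Tendsto (fun s => s - t) (𝓝[>] t) (𝓝[>] 0) := by
            refine tendsto_nhdsWithin_of_tendsto_nhds_of_eventually_within _ ?_ ?_
            · have : Continuous fun s => s - t := by fun_prop
              simpa using (this.tendsto t).mono_left nhdsWithin_le_nhds
            · filter_upwards [self_mem_nhdsWithin] with s hs
              exact Set.mem_Ioi.2 (sub_pos.2 (Set.mem_Ioi.1 hs))
          filter_upwards [c.eventually h1] with s hs
          rw [← hs]; congr 2; module)
    have val : ∀ t : ℝ, OffEdges v L (x + t • w) → (F (x + t • w) : ℤ) = a := by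
      intro t ht
      have c : Tendsto (fun s : ℝ => x + s • w) (𝓝[≠] t) (𝓝 (x + t • w)) := by
        have : Continuous fun s : ℝ => x + s • w := by fun_prop
        exact (this.tendsto t).mono_left nhdsWithin_le_nhds
      obtain ⟨s, hs1, hs2⟩ := ((c.eventually (h.eventually_latticeCount_eq L ht)).and
        (ha t)).exists
      rw [← hs2]; exact_mod_cast hs1.symm
    have v0 := val 0 (by simpa using h0)
    have v1 := val 1 (by simpa using h1)
    simp only [zero_smul, add_zero, one_smul] at v0 v1
    exact_mod_cast v1.trans v0.symm
  obtain ⟨p, hp⟩ := (h.ae_offEdges L).exists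
  -- Almost every `q` is joined to `p` by such a line: the exceptions are on countably many lines
  -- through `p`, parallel to an edge or passing through a vertex of a translate.
  have hae : ∀ᵐ q : Plane, F q = F p := by
    have a1 : ∀ᵐ q : Plane, ∀ k, cross (edge v k) (q - p) ≠ 0 := by
      rw [ae_all_iff]
      intro k
      have := volume_line_eq_zero (h.edge_ne_zero k) p
      rw [ae_iff]
      simpa using this
    have a2 : ∀ᵐ q : Plane, ∀ l ∈ (L : Set Plane), ∀ j, cross (v j + l - p) (q - p) ≠ 0 := by
      rw [ae_ball_iff (countable_of_discreteTopology L)]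
      intro l hl
      rw [ae_all_iff]
      intro j
      have := volume_line_eq_zero (a := v j + l - p) (by
        intro e
        exact hp.offVertices L l hl j (by rw [sub_eq_zero] at e; rw [← e]; simp)) p
      rw [ae_iff]
      simpa using this
    filter_upwards [a1, a2, h.ae_offEdges L] with q h1 h2 h3
    have := line p (q - p) (fun t l hl j e => h2 l hl j (by
      have e1 : v j + l - p = t • (q - p) := by rw [← e]; abel
      rw [e1, cross_smul_left, cross_same, mul_zero])) h1 hp (by simpa using h3)
    simpa using this
  refine ⟨F p, ?_, ?_⟩
  -- The level is positive: the interior of the polygon is open and contains its centre, hence also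
  -- a point with the generic count, and the translate by `0` covers that point.
  · have hopen : IsOpen {x : Plane | ∀ k, 0 < side v k x} := by
      rw [Set.ofPred_forall]
      refine isOpen_iInter_of_finite fun k => isOpen_lt continuous_const ?_
      unfold side; fun_prop
    have hne : {x : Plane | ∀ k, 0 < side v k x}.Nonempty := by
      refine ⟨(1 / 2 : ℝ) • v 0 + (1 / 2 : ℝ) • v (0 + n), fun k => ?_⟩
      have h0 := h.side_nonneg k 0
      have h1 := h.side_nonneg k (0 + n)
      have : 0 < side v k (v 0) + side v k (v (0 + n)) := by
        have e1 : side v k (v 0) + side v k (v (0 + n)) = side v k (v (k + n)) := by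
          have := h.vertex_opposite 0 k
          have e2 : v 0 = v k + v (k + n) - v (0 + n) := by rw [← this]; abel
          rw [e2]; simp only [side, cross_sub_right, cross_add_right]; ring
        rw [e1]
        have e2 := natCast_ne_zero (n := n) (m := n) (by have := h.two_le; omega)
          (by have := h.two_le; omega)
        refine h.side_pos (by simpa using e2) ?_
        intro e
        have e := add_left_cancel e
        have e3 := natCast_ne_zero (n := n) (m := n - 1) (by have := h.two_le; omega)
          (by have := h.two_le; omega)
        rw [Nat.cast_sub (by have := h.two_le; omega)] at e3
        apply e3; rw [e]; simp
      rw [side_lineMap k _ _ _ _ (by norm_num)]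
      linarith
    obtain ⟨q, hq1, hq2⟩ := (Measure.dense_of_ae hae).inter_open_nonempty _ hopen hne
    have hq2 : F q = F p := hq2
    rw [← hq2, Nat.one_le_iff_ne_zero]
    have : (0 : Plane) ∈ {l : Plane | l ∈ L ∧ q - l ∈ polygon v} := by
      refine ⟨L.zero_mem, ?_⟩
      rw [sub_zero, h.polygon_eq]; exact fun k => (hq1 k).le
    exact Set.ncard_ne_zero_of_mem this (finite_count L h.isBounded_polygon q)
  · filter_upwards [hae] with q hq
    rw [← Set.Finite.cast_ncard_eq (finite_count L h.isBounded_polygon q), ← hq]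
    rfl

/-- In a multiple tiling, every point is on as many translates of an edge as of the opposite
edge, unless it is on an edge of another direction. -/
theorem balanced_of_isMultipleTiling (ht : IsMultipleTiling (polygon v) L) {j : ZMod (2 * n)}
    {p : Plane} (hp : OffVertices v L p)
    (hoff : ∀ k, k ≠ j → k ≠ j + n → ∀ l ∈ L, p - l ∉ segment ℝ (v k) (v (k + 1))) :
    latticeCount L (segment ℝ (v j) (v (j + 1))) p =
      latticeCount L (segment ℝ (v (j + n)) (v (j + n + 1))) p := by
  have := h.neZero
  obtain ⟨K, -, hK⟩ := ht
  let F := latticeCount L (polygon v)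
  -- The level is attained on a dense set, and the count is locally constant off the edges.
  have hF : ∀ q, OffEdges v L q → F q = K := by
    intro q hq
    have ev := h.eventually_latticeCount_eq L hq
    obtain ⟨x, hx1, hx2⟩ :=
      ((mem_closure_iff_frequently.1 (Measure.dense_of_ae hK q)).and_eventually ev).exists
    have hx1 : {l : Plane | l ∈ L ∧ x - l ∈ polygon v}.encard = (K : ℕ∞) := hx1
    rw [← Set.Finite.cast_ncard_eq (finite_count L h.isBounded_polygon x)] at hx1
    have hx1 : latticeCount L (polygon v) x = K := by exact_mod_cast hx1
    exact hx2.symm.trans hx1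
  obtain ⟨w, hw⟩ := h.exists_transversal
  -- The one-sided limits at `p` equal the level, because all but countably many points of a
  -- transversal line are off the edges.
  have near : ∀ w, (∀ k, cross (edge v k) w ≠ 0) → ∀ a : ℤ,
      (∀ᶠ ε in 𝓝[>] (0 : ℝ), (F (p + ε • w) : ℤ) = a) → a = K := by
    intro w hw a ha
    have hd := (h.countable_not_offEdges L p hw).dense_compl ℝ
    rw [eventually_nhdsWithin_iff, Metric.eventually_nhds_iff] at ha
    obtain ⟨δ, hδ, hδ'⟩ := ha
    obtain ⟨ε, hε1, hε2⟩ := hd.inter_open_nonempty (Set.Ioo 0 δ) isOpen_Ioo ⟨δ / 2, by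
      constructor <;> linarith⟩
    have hε2 : ¬ ¬ OffEdges v L (p + ε • w) := hε2
    rw [← hδ' (by rw [Real.dist_eq, sub_zero, abs_of_pos hε1.1]; exact hε1.2) hε1.1,
      hF _ (not_not.1 hε2)]
  obtain ⟨a, b, h1, h2, h3⟩ := h.count_jump L hp hw
  have ea := near w hw a h1
  have eb := near (-w) (fun k => by rw [cross_neg_right]; exact neg_ne_zero.2 (hw k)) b (by
    simpa [← sub_eq_add_neg] using h2)
  rw [ea, eb, sub_self] at h3
  have hne : j ≠ j + n := by
    have := natCast_ne_zero (n := n) (m := n) (by have := h.two_le; omega)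
      (by have := h.two_le; omega)
    simpa using this
  -- Only the edges `j` and `j + n` can pass through `p`. Their signs are opposite, so a zero jump
  -- means equal counts.
  rw [Finset.sum_eq_add j (j + n) hne (fun k _ hk => by
      have : latticeCount L (segment ℝ (v k) (v (k + 1))) p = 0 := by
        rw [latticeCount, Set.ncard_eq_zero (finite_count L (h.isBounded_polygon.subset
          (segment_subset k)) p)]
        exact Set.eq_empty_of_forall_notMem fun l hl => hoff k hk.1 hk.2 l hl.1 hl.2
      rw [this]; simp) (by simp) (by simp), h.edge_opposite, cross_neg_left, Left.sign_neg] at h3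
  have hs := hw j
  rcases lt_or_gt_of_ne hs with hs | hs
  · rw [sign_neg hs] at h3; simp at h3; omega
  · rw [sign_pos hs] at h3; simp at h3; omega

end IsSymmConvexPolygon

/-! ### The criterion for multiple tilings with a given lattice -/

namespace IsSymmConvexPolygon

variable {n : ℕ} {v : ZMod (2 * n) → Plane}

theorem mem_segment_iff {j : ZMod (2 * n)} {x : Plane} :
    x ∈ segment ℝ (v j) (v (j + 1)) ↔ ∃ s : ℝ, 0 ≤ s ∧ s ≤ 1 ∧ x = v j + s • edge v j := by
  rw [segment_eq_image']
  simp only [Set.mem_image, Set.mem_Icc, edge]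
  exact ⟨fun ⟨s, ⟨h0, h1⟩, e⟩ => ⟨s, h0, h1, e.symm⟩, fun ⟨s, h0, h1, e⟩ => ⟨s, ⟨h0, h1⟩, e.symm⟩⟩

variable (L : Submodule ℤ Plane)

/-- The condition on an edge for a multiple tiling. -/
def EdgeCondition (v : ZMod (2 * n) → Plane) (L : Submodule ℤ Plane) (j : ZMod (2 * n)) : Prop :=
  trans v j ∈ L ∨ edge v j ∈ L ∧ ∃ r : ℝ, trans v j + r • edge v j ∈ L

variable (h : IsSymmConvexPolygon n v) [DiscreteTopology L]
include h

theorem mem_segment_opposite_iff {j : ZMod (2 * n)} {x : Plane} :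
    x ∈ segment ℝ (v (j + n)) (v (j + n + 1)) ↔
      x - trans v j ∈ segment ℝ (v j) (v (j + 1)) := by
  have e1 := h.vertex_add_n j
  have e2 : v (j + n + 1) = v j + trans v j := by rw [trans]; abel
  have e3 : x = trans v j + (x - trans v j) := by abel
  rw [e1, e2, segment_symm, add_comm (v j), add_comm (v (j + 1))]
  nth_rw 1 [e3]
  rw [mem_segment_translate]

/-- On a line in the direction of an edge, the numbers of translates of the edge through two
points are equal if the edge is a vector of the lattice. -/
theorem count_edge_le {j : ZMod (2 * n)} (hj : edge v j ∈ L) (r : ℝ) {y : Plane}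
    (hy : ∀ l ∈ L, y - l ≠ v (j + 1)) :
    latticeCount L (segment ℝ (v j) (v (j + 1))) y ≤
      latticeCount L (segment ℝ (v j) (v (j + 1))) (y + r • edge v j) := by
  have hN := h.neZero
  have he := h.edge_ne_zero j
  obtain ⟨φ, hφ⟩ : ∃ φ : Plane → ℝ, ∀ s : ℝ, φ (v j + s • edge v j) = s := by
    have hinj : Function.Injective fun s : ℝ => v j + s • edge v j := fun a b hab =>
      smul_left_injective ℝ he (add_left_cancel hab)
    exact ⟨Function.invFun fun s : ℝ => v j + s • edge v j,
      Function.leftInverse_invFun hinj⟩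
  have coord : ∀ {l : Plane}, l ∈ L → y - l ∈ segment ℝ (v j) (v (j + 1)) →
      ∃ s : ℝ, 0 ≤ s ∧ s < 1 ∧ y - l = v j + s • edge v j := by
    intro l hl hm
    obtain ⟨s, h0, h1, e⟩ := mem_segment_iff.1 hm
    refine ⟨s, h0, h1.lt_of_ne ?_, e⟩
    rintro rfl
    exact hy l hl (by rw [e, edge]; module)
  -- A half-open edge is a fundamental domain for the multiples of `e_j` on its line: after the
  -- shift by `r`, a multiple of `e_j` brings the parameter back to its fractional part. The
  -- hypothesis `hy` excludes the end with parameter `1`, so that no two translates are identified.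
  refine Set.ncard_le_ncard_of_injOn
    (fun l => l + ⌊φ (y - l) + r⌋ • edge v j) ?_ ?_
    (finite_count L (h.isBounded_polygon.subset (segment_subset j)) _)
  · rintro l ⟨hl, hm⟩
    obtain ⟨s, h0, h1, e⟩ := coord hl hm
    refine ⟨L.add_mem hl (L.smul_mem _ hj), mem_segment_iff.2 ⟨Int.fract (s + r),
      Int.fract_nonneg _, (Int.fract_lt_one _).le, ?_⟩⟩
    have e2 : y + r • edge v j - (l + ⌊φ (y - l) + r⌋ • edge v j) =
        (y - l) + r • edge v j - ⌊φ (y - l) + r⌋ • edge v j := by abel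
    rw [e2, e, hφ, Int.fract, ← Int.cast_smul_eq_zsmul ℝ]
    module
  · rintro l ⟨hl, hm⟩ l' ⟨hl', hm'⟩ hll
    obtain ⟨s, h0, h1, e⟩ := coord hl hm
    obtain ⟨s', h0', h1', e'⟩ := coord hl' hm'
    simp only [e, e', hφ, ← Int.cast_smul_eq_zsmul ℝ] at hll
    have e3 : l = y - (v j + s • edge v j) := by rw [← e]; abel
    have e4 : l' = y - (v j + s' • edge v j) := by rw [← e']; abel
    rw [e3, e4] at hll
    have e5 : ((⌊s + r⌋ : ℝ) - s) • edge v j = ((⌊s' + r⌋ : ℝ) - s') • edge v j := by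
      have := congrArg (fun z => z - y + v j) hll
      convert this using 1 <;> module
    have e6 : (⌊s + r⌋ : ℝ) - s = (⌊s' + r⌋ : ℝ) - s' := smul_left_injective ℝ he e5
    have e7 : s - s' = ((⌊s + r⌋ - ⌊s' + r⌋ : ℤ) : ℝ) := by push_cast; linarith
    have e8 : ⌊s + r⌋ - ⌊s' + r⌋ = 0 := by
      have l1 : ((⌊s + r⌋ - ⌊s' + r⌋ : ℤ) : ℝ) < 1 := by rw [← e7]; linarith
      have l2 : (-1 : ℝ) < ((⌊s + r⌋ - ⌊s' + r⌋ : ℤ) : ℝ) := by rw [← e7]; linarith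
      have l1 : ⌊s + r⌋ - ⌊s' + r⌋ < 1 := by exact_mod_cast l1
      have l2 : -1 < ⌊s + r⌋ - ⌊s' + r⌋ := by exact_mod_cast l2
      omega
    rw [e8, Int.cast_zero, sub_eq_zero] at e7
    rw [e3, e4, e7]

/-- Translates of the opposite edge through `p` correspond to translates of the edge `k` through `p
- τ_k`. If `τ_k ∈ L`, this point is equivalent to `p`; otherwise it is equivalent to a point
displaced from `p` along the edge, which does not change the count because `e_k ∈ L`. -/
theorem isMultipleTiling_of_edgeCondition (hc : ∀ j, EdgeCondition v L j) :
    IsMultipleTiling (polygon v) L := by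
  have hN := h.neZero
  refine h.isMultipleTiling_of_balanced L fun p hp k => ?_
  have shift : ∀ u ∈ L, ∀ A : Set Plane, ∀ x, latticeCount L A (x + u) = latticeCount L A x := by
    intro u hu A x
    refine Set.ncard_congr (fun l _ => l - u) ?_ ?_ ?_
    · rintro l ⟨hl, hm⟩
      exact ⟨L.sub_mem hl hu, by convert hm using 1; abel⟩
    · intro a b _ _ hab; exact sub_left_injective hab
    · rintro l ⟨hl, hm⟩
      exact ⟨l + u, ⟨L.add_mem hl hu, by convert hm using 1; abel⟩, by abel⟩
  have opp : latticeCount L (segment ℝ (v (k + n)) (v (k + n + 1))) p =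
      latticeCount L (segment ℝ (v k) (v (k + 1))) (p - trans v k) := by
    unfold latticeCount
    congr 1; ext l
    change (_ ∧ _) ↔ (_ ∧ _)
    rw [h.mem_segment_opposite_iff, sub_right_comm]
  rw [opp]
  rcases hc k with h1 | ⟨h1, r, h2⟩
  · rw [sub_eq_add_neg, shift _ (L.neg_mem h1)]
  · have e : p - trans v k = p + r • edge v k + -(trans v k + r • edge v k) := by abel
    rw [e, shift _ (L.neg_mem h2)]
    refine le_antisymm (h.count_edge_le L h1 r fun l hl => hp l hl (k + 1)) ?_
    -- The reverse inequality moves back by `-r`. A vertex at the displaced point would be the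
    -- vertex `k + n` of a translate at `p`.
    have := h.count_edge_le L h1 (-r) (y := p + r • edge v k) fun l hl e' => by
      refine hp (l - (trans v k + r • edge v k)) (L.sub_mem hl h2) (k + n) ?_
      rw [h.vertex_add_n, ← e']; abel
    simpa using this

/-- Let a point move along the line of the edge and pass `v j`. There the edge itself, translated by
`0`, enters the count. If `e_j ∉ L`, no translate of the edge leaves it nearby, since that would
need a vector of `L` close to `-e_j`; if `τ_j ∉ L`, no translate of the opposite edge enters, since
that would need one close to `-τ_j`. Then the counts could not be equal both before and after. The
line `τ_j + ℝ e_j` meets `L` because some translate of the opposite edge must balance the edge. -/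
theorem edgeCondition_of_isMultipleTiling (ht : IsMultipleTiling (polygon v) L)
    (j : ZMod (2 * n)) : EdgeCondition v L j := by
  have hN := h.neZero
  have he := h.edge_ne_zero j
  let P : ℝ → Plane := fun s => v j + s • edge v j
  let A : ℝ → Set Plane := fun s => {l | l ∈ L ∧ P s - l ∈ segment ℝ (v j) (v (j + 1))}
  let A' : ℝ → Set Plane :=
    fun s => {l | l ∈ L ∧ P s - l ∈ segment ℝ (v (j + (n : ZMod (2 * n)))) (v (j + (n : ZMod (2 * n)) + 1))}
  have fin : ∀ s, (A s).Finite := fun s =>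
    finite_count L (h.isBounded_polygon.subset (segment_subset j)) _
  have fin' : ∀ s, (A' s).Finite := fun s =>
    finite_count L (h.isBounded_polygon.subset (segment_subset (j + (n : ZMod (2 * n))))) _
  have memA : ∀ s l, l ∈ A s ↔ ∃ t : ℝ, s - 1 ≤ t ∧ t ≤ s ∧ t • edge v j ∈ L ∧
      l = t • edge v j := by
    intro s l
    change (_ ∧ _) ↔ _
    rw [mem_segment_iff]
    constructor
    · rintro ⟨hl, t, h0, h1, e⟩
      have e2 : l = (s - t) • edge v j := by
        have e3 : l = P s - (v j + t • edge v j) := by rw [← e]; abel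
        rw [e3]; simp only [P]; module
      exact ⟨s - t, by linarith, by linarith, e2 ▸ hl, e2⟩
    · rintro ⟨t, h0, h1, hl, rfl⟩
      exact ⟨hl, s - t, by linarith, by linarith, by simp only [P]; module⟩
  have memA' : ∀ s l, l ∈ A' s ↔ ∃ t : ℝ, s - 1 ≤ t ∧ t ≤ s ∧ t • edge v j - trans v j ∈ L ∧
      l = t • edge v j - trans v j := by
    intro s l
    change (_ ∧ _) ↔ _
    rw [h.mem_segment_opposite_iff, mem_segment_iff]
    constructor
    · rintro ⟨hl, t, h0, h1, e⟩
      have e2 : l = (s - t) • edge v j - trans v j := by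
        have e3 : l = P s - trans v j - (v j + t • edge v j) := by rw [← e]; abel
        rw [e3]; simp only [P]; module
      exact ⟨s - t, by linarith, by linarith, e2 ▸ hl, e2⟩
    · rintro ⟨t, h0, h1, hl, rfl⟩
      exact ⟨hl, s - t, by linarith, by linarith, by simp only [P]; module⟩
  -- Excluded are the positions that are vertices of translates or on edges of other directions;
  -- countability of `L` makes these countably many.
  obtain ⟨Z, hZ, hbal⟩ : ∃ Z : Set ℝ, Z.Countable ∧ ∀ s ∉ Z, (A s).ncard = (A' s).ncard := by
    let U : Set Plane := ⋃ l ∈ (L : Set Plane), ⋃ i, {v i + l}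
    have hU : U.Countable := (countable_of_discreteTopology L).biUnion fun l _ =>
      Set.countable_iUnion fun k => Set.countable_singleton _
    let V : Set ℝ := ⋃ l ∈ (L : Set Plane), ⋃ k,
      {(- side v k (v j - l)) / cross (edge v k) (edge v j)}
    have hV : V.Countable := (countable_of_discreteTopology L).biUnion fun l _ =>
      Set.countable_iUnion fun k => Set.countable_singleton _
    refine ⟨{s | v j + s • edge v j ∈ U} ∪ V,
      (countable_setOf_add_smul_eq he _ hU).union hV, fun s hs => ?_⟩
    refine h.balanced_of_isMultipleTiling L ht (fun l hl i e => hs (Or.inl ?_))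
      (fun k hk hk' l hl hm => hs (Or.inr ?_))
    · change P s ∈ U
      simp only [U, Set.mem_iUnion, Set.mem_singleton_iff]
      exact ⟨l, hl, i, by rw [← e]; abel⟩
    · simp only [V, Set.mem_iUnion, Set.mem_singleton_iff]
      refine ⟨l, hl, k, ?_⟩
      have e := side_eq_zero_of_mem_segment hm
      have hne : cross (edge v k) (edge v j) ≠ 0 := by
        rw [cross_swap]; exact neg_ne_zero.2 (h.cross_edge_ne_zero hk hk')
      simp only [P] at e
      rw [add_sub_right_comm, side_eq_add, cross_smul_right] at e
      rw [eq_div_iff hne]; linarith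
  have hline : ∃ r : ℝ, trans v j + r • edge v j ∈ L := by
    obtain ⟨s, hs1, hs2⟩ := (hZ.dense_compl ℝ).inter_open_nonempty (Set.Ioo 0 1) isOpen_Ioo
      ⟨1 / 2, by norm_num⟩
    have h0 : (0 : Plane) ∈ A s := (memA s 0).2 ⟨0, by linarith [hs1.2], hs1.1.le, by simp, by simp⟩
    have h1 : (A' s).ncard ≠ 0 := by
      rw [← hbal s hs2]; exact Set.ncard_ne_zero_of_mem h0 (fin s)
    obtain ⟨l, hl⟩ := Set.nonempty_of_ncard_ne_zero h1
    obtain ⟨t, -, -, hm, -⟩ := (memA' s l).1 hl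
    refine ⟨-t, ?_⟩
    have := L.neg_mem hm
    convert this using 1; module
  by_contra hcon
  unfold EdgeCondition at hcon
  push Not at hcon
  obtain ⟨hτ, hcon⟩ := hcon
  have hej : edge v j ∉ L := fun he => by
    obtain ⟨r, hr⟩ := hline
    exact hcon he r hr
  have closed := isClosed_of_discreteTopology L
  -- A discrete group is closed, so neighbourhoods of `-e_j` and `-τ_j` avoid it.
  have ev1 : ∀ᶠ t in 𝓝 (-1 : ℝ), t • edge v j ∉ L := by
    have c : Continuous fun t : ℝ => t • edge v j := by fun_prop
    refine (c.tendsto (-1)).eventually (closed.isOpen_compl.mem_nhds ?_)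
    intro hm
    apply hej
    have := L.neg_mem hm
    simpa using this
  have ev2 : ∀ᶠ t in 𝓝 (0 : ℝ), t • edge v j - trans v j ∉ L := by
    have c : Continuous fun t : ℝ => t • edge v j - trans v j := by fun_prop
    refine (c.tendsto 0).eventually (closed.isOpen_compl.mem_nhds ?_)
    intro hm
    apply hτ
    have := L.neg_mem hm
    simpa using this
  rw [Metric.eventually_nhds_iff] at ev1 ev2
  obtain ⟨δ₁, hδ₁, ev1⟩ := ev1
  obtain ⟨δ₂, hδ₂, ev2⟩ := ev2
  have hZ' : (Z ∪ Neg.neg ⁻¹' Z).Countable :=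
    hZ.union (hZ.preimage neg_injective)
  obtain ⟨ε, hε, hεZ⟩ := (hZ'.dense_compl ℝ).inter_open_nonempty
    (Set.Ioo 0 (min (min δ₁ δ₂) (1 / 2))) isOpen_Ioo ⟨min (min δ₁ δ₂) (1 / 2) / 2, by
      have : 0 < min (min δ₁ δ₂) (1 / 2) := by positivity
      constructor <;> linarith⟩
  obtain ⟨ε0, ε1⟩ := hε
  rw [lt_min_iff, lt_min_iff] at ε1
  obtain ⟨⟨l1, l2⟩, l3⟩ := ε1
  have b1 := hbal ε fun hm => hεZ (Or.inl hm)
  have b2 := hbal (-ε) fun hm => hεZ (Or.inr hm)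
  have k1 : (A (-ε)).ncard < (A ε).ncard := by
    refine Set.ncard_lt_ncard ?_ (fin ε)
    rw [Set.ssubset_iff_of_subset]
    · refine ⟨0, (memA _ _).2 ⟨0, by linarith, ε0.le, by simp, by simp⟩, fun hm => ?_⟩
      obtain ⟨t, -, ht, -, e⟩ := (memA _ _).1 hm
      have : t = 0 := by
        by_contra h0
        exact smul_ne_zero h0 he e.symm
      linarith
    · intro l hl
      obtain ⟨t, ht1, ht2, ht3, e⟩ := (memA _ _).1 hl
      refine (memA _ _).2 ⟨t, ?_, by linarith, ht3, e⟩
      by_contra! hc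
      refine ev1 ?_ ht3
      rw [Real.dist_eq, abs_lt]; constructor <;> linarith
  have k2 : (A' ε).ncard ≤ (A' (-ε)).ncard := by
    refine Set.ncard_le_ncard ?_ (fin' _)
    intro l hl
    obtain ⟨t, ht1, ht2, ht3, e⟩ := (memA' _ _).1 hl
    refine (memA' _ _).2 ⟨t, by linarith, ?_, ht3, e⟩
    by_contra! hc
    refine ev2 ?_ ht3
    rw [Real.dist_eq, abs_lt]; constructor <;> linarith
  omega

end IsSymmConvexPolygon

/-! ## Rational spans and discrete groups -/

/-- The rational span of two vectors. -/
noncomputable def ratSpan (a b : Plane) : Submodule ℚ Plane := Submodule.span ℚ {a, b}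

theorem mem_ratSpan_iff {a b x : Plane} : x ∈ ratSpan a b ↔ ∃ p q : ℚ, p • a + q • b = x :=
  Submodule.mem_span_pair

theorem left_mem_ratSpan (a b : Plane) : a ∈ ratSpan a b := Submodule.subset_span (by simp)

theorem right_mem_ratSpan (a b : Plane) : b ∈ ratSpan a b := Submodule.subset_span (by simp)

theorem cross_ratCast_smul_left (p : ℚ) (a b : Plane) : cross (p • a) b = p * cross a b := by
  rw [← Rat.cast_smul_eq_qsmul ℝ, cross_smul_left]

theorem cross_ratCast_smul_right (p : ℚ) (a b : Plane) : cross a (p • b) = p * cross a b := by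
  rw [← Rat.cast_smul_eq_qsmul ℝ, cross_smul_right]

theorem mem_ratSpan_iff_cross {a b x : Plane} (hab : cross a b ≠ 0) :
    x ∈ ratSpan a b ↔ (∃ q : ℚ, (q : ℝ) = cross x b / cross a b) ∧
      ∃ q : ℚ, (q : ℝ) = cross a x / cross a b := by
  rw [mem_ratSpan_iff]
  constructor
  · rintro ⟨p, q, rfl⟩
    constructor
    · refine ⟨p, ?_⟩
      rw [cross_add_left, cross_ratCast_smul_left, cross_ratCast_smul_left, cross_same]
      field_simp; ring
    · refine ⟨q, ?_⟩
      rw [cross_add_right, cross_ratCast_smul_right, cross_ratCast_smul_right, cross_same]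
      field_simp; ring
  · rintro ⟨⟨p, hp⟩, q, hq⟩
    refine ⟨p, q, ?_⟩
    rw [← Rat.cast_smul_eq_qsmul ℝ, ← Rat.cast_smul_eq_qsmul ℝ, hp, hq]
    exact (eq_smul_add_smul hab x).symm

theorem isCommensurableWith_of_mem {L : Submodule ℤ Plane} {x : Plane} (h : x ∈ L) :
    IsCommensurableWith x L := ⟨1, one_pos, by simpa⟩

theorem IsCommensurableWith.mono {L L' : Submodule ℤ Plane} {x : Plane}
    (h : IsCommensurableWith x L) (hL : L ≤ L') : IsCommensurableWith x L' := by
  obtain ⟨m, hm, hx⟩ := h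
  exact ⟨m, hm, hL hx⟩

theorem isCommensurableWith_span_iff {a b x : Plane} :
    IsCommensurableWith x (Submodule.span ℤ {a, b}) ↔ x ∈ ratSpan a b := by
  constructor
  · rintro ⟨m, hm, hx⟩
    obtain ⟨s, t, hst⟩ := Submodule.mem_span_pair.1 hx
    refine mem_ratSpan_iff.2 ⟨s / m, t / m, ?_⟩
    have hm' : (m : ℚ) ≠ 0 := by exact_mod_cast hm.ne'
    have e : (m : ℚ) • ((s / m : ℚ) • a + (t / m : ℚ) • b) = (m : ℚ) • x := by
      rw [Nat.cast_smul_eq_nsmul ℚ m x, ← hst, smul_add, smul_smul, smul_smul,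
        mul_div_cancel₀ _ hm', mul_div_cancel₀ _ hm', Int.cast_smul_eq_zsmul,
        Int.cast_smul_eq_zsmul]
    exact smul_right_injective _ hm' e
  · intro hx
    obtain ⟨p, q, rfl⟩ := mem_ratSpan_iff.1 hx
    refine ⟨p.den * q.den, Nat.mul_pos p.den_pos q.den_pos, ?_⟩
    refine Submodule.mem_span_pair.2 ⟨p.num * q.den, q.num * p.den, ?_⟩
    rw [← Nat.cast_smul_eq_nsmul ℚ, ← Int.cast_smul_eq_zsmul ℚ, ← Int.cast_smul_eq_zsmul ℚ,
      smul_add, smul_smul, smul_smul]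
    have e1 : ((p.den * q.den : ℕ) : ℚ) * p = ((p.num * q.den : ℤ) : ℚ) := by
      push_cast
      rw [mul_right_comm, mul_comm (p.den : ℚ), Rat.mul_den_eq_num]
    have e2 : ((p.den * q.den : ℕ) : ℚ) * q = ((q.num * p.den : ℤ) : ℚ) := by
      push_cast
      rw [mul_assoc, mul_comm (q.den : ℚ), Rat.mul_den_eq_num, mul_comm]
    rw [e1, e2]

theorem isCommensurableWith_of_mem_ratSpan {L : Submodule ℤ Plane} {a b x : Plane} (ha : a ∈ L)
    (hb : b ∈ L) (hx : x ∈ ratSpan a b) : IsCommensurableWith x L := by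
  refine (isCommensurableWith_span_iff.2 hx).mono (Submodule.span_le.2 ?_)
  rintro y (rfl | rfl)
  exacts [ha, hb]

/-- Elements of a discrete group are rational combinations of two independent ones. -/
theorem mem_ratSpan_of_mem {L : Submodule ℤ Plane} [DiscreteTopology L] {a b x : Plane}
    (ha : a ∈ L) (hb : b ∈ L) (hab : cross a b ≠ 0) (hx : x ∈ L) : x ∈ ratSpan a b := by
  rw [← isCommensurableWith_span_iff]
  obtain ⟨s, t, e⟩ : ∃ s t : ℝ, x = s • a + t • b := ⟨_, _, eq_smul_add_smul hab x⟩
  -- Pigeonhole: reducing the multiples of `x` modulo `ℤ a + ℤ b` keeps them in a bounded part of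
  -- `L`, which is finite. Two of them coincide, so a positive multiple of `x` is in `ℤ a + ℤ b`.
  let f : ℕ → Plane := fun m => m • x - ⌊m * s⌋ • a - ⌊m * t⌋ • b
  have hf : ∀ m, f m ∈ {l | l ∈ L ∧ l ∈ Metric.closedBall (0 : Plane) (‖a‖ + ‖b‖)} := by
    intro m
    refine ⟨L.sub_mem (L.sub_mem (L.smul_of_tower_mem _ hx) (L.smul_mem _ ha))
      (L.smul_mem _ hb), ?_⟩
    have e2 : f m = Int.fract (m * s) • a + Int.fract (m * t) • b := by
      simp only [f, e, Int.fract, ← Int.cast_smul_eq_zsmul ℝ, ← Nat.cast_smul_eq_nsmul ℝ]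
      module
    rw [mem_closedBall_zero_iff, e2]
    refine (norm_add_le _ _).trans (add_le_add ?_ ?_)
    all_goals
      rw [norm_smul, Real.norm_of_nonneg (Int.fract_nonneg _)]
      exact mul_le_of_le_one_left (norm_nonneg _) (Int.fract_lt_one _).le
  obtain ⟨m, m', hlt, he⟩ := (finite_inter_of_isBounded L
    Metric.isBounded_closedBall).exists_lt_map_eq_of_forall_mem hf
  refine ⟨m' - m, by omega, Submodule.mem_span_pair.2
    ⟨⌊m' * s⌋ - ⌊m * s⌋, ⌊m' * t⌋ - ⌊m * t⌋, ?_⟩⟩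
  rw [← natCast_zsmul, Nat.cast_sub hlt.le]
  simp only [f] at he
  have e3 : (m' : ℤ) • x - (m : ℤ) • x = (m' • x - ⌊m' * s⌋ • a - ⌊m' * t⌋ • b) -
      (m • x - ⌊m * s⌋ • a - ⌊m * t⌋ • b) + ((⌊m' * s⌋ - ⌊m * s⌋) • a +
        (⌊m' * t⌋ - ⌊m * t⌋) • b) := by
    simp only [natCast_zsmul, sub_smul]; abel
  rw [sub_smul (m' : ℤ) (m : ℤ) x, e3, he, sub_self, zero_add]

theorem mem_ratSpan_of_isCommensurableWith {L : Submodule ℤ Plane} [DiscreteTopology L]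
    {a b x : Plane} (ha : a ∈ L) (hb : b ∈ L) (hab : cross a b ≠ 0)
    (hx : IsCommensurableWith x L) : x ∈ ratSpan a b := by
  obtain ⟨m, hm, hmx⟩ := hx
  have := mem_ratSpan_of_mem ha hb hab hmx
  have hm' : (m : ℚ) ≠ 0 := by exact_mod_cast hm.ne'
  rw [← Nat.cast_smul_eq_nsmul ℚ] at this
  exact (Submodule.smul_mem_iff _ hm').1 this

theorem linearIndependent_pair_iff_cross {a b : Plane} :
    LinearIndependent ℝ ![a, b] ↔ cross a b ≠ 0 := by
  rw [LinearIndependent.pair_iff]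
  constructor
  · intro h hc
    have h1 := h b.1 (-a.1) (by
      ext
      · simp; ring
      · simp only [cross] at hc
        simp; linarith)
    have h2 := h b.2 (-a.2) (by
      ext
      · simp only [cross] at hc
        simp; linarith
      · simp; ring)
    have h3 := h 1 0 (by
      ext <;> simp
      · linarith [h1.2]
      · linarith [h2.2])
    exact one_ne_zero h3.1
  · intro hc s t hst
    have h1 : cross (s • a + t • b) b = 0 := by rw [hst, cross_zero_left]
    have h2 : cross a (s • a + t • b) = 0 := by rw [hst, cross_zero_right]
    rw [cross_add_left, cross_smul_left, cross_smul_left, cross_same] at h1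
    rw [cross_add_right, cross_smul_right, cross_smul_right, cross_same] at h2
    simp only [mul_zero, add_zero, zero_add] at h1 h2
    exact ⟨(mul_eq_zero.1 h1).resolve_right hc, (mul_eq_zero.1 h2).resolve_right hc⟩

theorem discreteTopology_of_le {L L' : Submodule ℤ Plane} [DiscreteTopology L'] (h : L ≤ L') :
    DiscreteTopology L :=
  DiscreteTopology.of_subset ‹DiscreteTopology (L' : Set Plane)› h

theorem discreteTopology_span_pair {a b : Plane} (hab : cross a b ≠ 0) :
    DiscreteTopology (Submodule.span ℤ ({a, b} : Set Plane)) := by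
  let B := basisOfLinearIndependentOfCardEqFinrank (linearIndependent_pair_iff_cross.2 hab)
    (by simp)
  have : Set.range B = {a, b} := by
    rw [coe_basisOfLinearIndependentOfCardEqFinrank]; simp [Set.pair_comm]
  rw [← this]; infer_instance

/-- Finitely many vectors in a rational plane generate a discrete group. -/
theorem discreteTopology_span {a b : Plane} (hab : cross a b ≠ 0) {S : Set Plane}
    (hS : S.Finite) (h : S ⊆ ratSpan a b) : DiscreteTopology (Submodule.span ℤ S) := by
  -- A common multiple `M` of the denominators puts the group into the lattice generated by `a / M`
  -- and `b / M`.
  obtain ⟨M, hM, hMS⟩ : ∃ M : ℕ, 0 < M ∧ ∀ x ∈ S, M • x ∈ Submodule.span ℤ ({a, b} : Set Plane) := by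
    induction S, hS using Set.Finite.induction_on with
    | empty => exact ⟨1, one_pos, by simp⟩
    | @insert x S _ _ ih =>
      obtain ⟨M, hM, hMS⟩ := ih fun y hy => h (Set.mem_insert_of_mem _ hy)
      obtain ⟨m, hm, hmx⟩ := isCommensurableWith_span_iff.2 (h (Set.mem_insert x S))
      refine ⟨M * m, Nat.mul_pos hM hm, ?_⟩
      rintro y (rfl | hy)
      · rw [mul_smul]; exact Submodule.smul_of_tower_mem _ _ hmx
      · rw [mul_comm, mul_smul]; exact Submodule.smul_of_tower_mem _ _ (hMS y hy)
  have hM' : (M : ℝ) ≠ 0 := by exact_mod_cast hM.ne'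
  have := discreteTopology_span_pair (a := (M : ℝ)⁻¹ • a) (b := (M : ℝ)⁻¹ • b) (by
    rw [cross_smul_left, cross_smul_right]
    exact mul_ne_zero (inv_ne_zero hM') (mul_ne_zero (inv_ne_zero hM') hab))
  refine discreteTopology_of_le (L' := Submodule.span ℤ {(M : ℝ)⁻¹ • a, (M : ℝ)⁻¹ • b})
    (Submodule.span_le.2 fun x hx => ?_)
  obtain ⟨s, t, e⟩ := Submodule.mem_span_pair.1 (hMS x hx)
  refine Submodule.mem_span_pair.2 ⟨s, t, ?_⟩
  rw [smul_comm, smul_comm t, ← smul_add, e, ← Nat.cast_smul_eq_nsmul ℝ, inv_smul_smul₀ hM']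

namespace IsSymmConvexPolygon

variable {n : ℕ} {v : ZMod (2 * n) → Plane}

/-! ## The classification of multiply tiling polygons -/

theorem edgeVec_eq (j : Fin n) : edgeVec v j = edge v ((j : ℕ) : ZMod (2 * n)) := by
  rw [edgeVec, edge, Nat.cast_add, Nat.cast_one]

theorem transVec_eq (j : Fin n) : transVec v j = trans v ((j : ℕ) : ZMod (2 * n)) := by
  rw [transVec, trans, Nat.cast_add, Nat.cast_add, Nat.cast_one]

/-- The coefficient of the edge `i` in `τ_j`. -/
def transCoeff (j i : Fin n) : ℤ := if j < i then 1 else if i < j then -1 else 0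

theorem transCoeff_self (j : Fin n) : transCoeff j j = 0 := by simp [transCoeff]

theorem transCoeff_mul_self {i j : Fin n} (hij : i ≠ j) : transCoeff j i * transCoeff j i = 1 := by
  rcases lt_or_gt_of_ne hij with h | h
  · simp [transCoeff, h, h.not_gt]
  · simp [transCoeff, h]

/-- All `τ_k` satisfy the conditions for a multiple tiling with respect to the rational span of
`τ_i` and `τ_j`. -/
def PairCondition (v : ZMod (2 * n) → Plane) (i j : Fin n) : Prop :=
  ∀ k : Fin n, transVec v k ∈ ratSpan (transVec v i) (transVec v j) ∨
    edgeVec v k ∈ ratSpan (transVec v i) (transVec v j) ∧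
      ∃ r : ℝ, transVec v k + r • edgeVec v k ∈ ratSpan (transVec v i) (transVec v j)

variable (h : IsSymmConvexPolygon n v)
include h

/-- By symmetry `τ_j` is `v n - v 0` minus `v (j + 1) - v 0` minus `v j - v 0`. An edge before `e_j`
occurs in all three terms, `e_j` in the first two, and a later edge only in the first. -/
theorem transVec_eq_sum (j : Fin n) :
    transVec v j = ∑ i, transCoeff j i • edgeVec v i := by
  have e0 := edge_sum (v := v) 0 n
  have e1 := edge_sum (v := v) 0 (j : ℕ)
  have e2 := edge_sum (v := v) 0 ((j : ℕ) + 1)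
  simp only [zero_add] at e0 e1 e2
  have e3 : transVec v j = (v n - v 0) - (v ((j : ℕ) + 1 : ℕ) - v 0) - (v (j : ℕ) - v 0) := by
    rw [transVec_eq, h.trans_eq _ 0, zero_add, Nat.cast_add, Nat.cast_one]; abel
  have part : ∀ m ≤ n, ∑ t ∈ Finset.range m, edge v (t : ZMod (2 * n)) =
      ∑ i : Fin n, if (i : ℕ) < m then edgeVec v i else 0 := by
    intro m hm
    simp_rw [edgeVec_eq]
    rw [← Finset.sum_range fun t => if t < m then edge v (t : ZMod (2 * n)) else 0,
      ← Finset.sum_filter]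
    congr 1
    ext t; simp; omega
  rw [e3, e0, e1, e2, part n le_rfl, part _ j.2.le, part _ (show (j : ℕ) + 1 ≤ n from j.2),
    ← Finset.sum_sub_distrib, ← Finset.sum_sub_distrib]
  refine Finset.sum_congr rfl fun i _ => ?_
  have hi := i.2
  rcases lt_trichotomy i j with hij | rfl | hij
  · have : (i : ℕ) < j := hij
    have h2 : (i : ℕ) < (j : ℕ) + 1 := by omega
    simp [transCoeff, this, h2, hij, hij.not_gt]
  · simp [transCoeff]
  · have h1 : ¬ (i : ℕ) < j := by have : (j : ℕ) < i := hij; omega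
    have h2 : ¬ (i : ℕ) < (j : ℕ) + 1 := by have : (j : ℕ) < i := hij; omega
    simp [transCoeff, h1, h2, hij]

omit h in
theorem natCast_fin_ne {i j : Fin n} (hij : i ≠ j) :
    ((i : ℕ) : ZMod (2 * n)) ≠ ((j : ℕ) : ZMod (2 * n)) ∧
      ((i : ℕ) : ZMod (2 * n)) ≠ ((j : ℕ) : ZMod (2 * n)) + n := by
  have hi := i.2
  have hj := j.2
  have hne : (i : ℕ) ≠ j := fun e => hij (Fin.ext e)
  constructor
  · rw [Ne, ZMod.natCast_eq_natCast_iff', Nat.mod_eq_of_lt (by omega),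
      Nat.mod_eq_of_lt (by omega)]
    exact hne
  · rw [← Nat.cast_add, Ne, ZMod.natCast_eq_natCast_iff', Nat.mod_eq_of_lt (by omega),
      Nat.mod_eq_of_lt (by omega)]
    omega

theorem cross_edgeVec_ne_zero {i j : Fin n} (hij : i ≠ j) :
    cross (edgeVec v i) (edgeVec v j) ≠ 0 := by
  rw [edgeVec_eq, edgeVec_eq]
  have := natCast_fin_ne hij.symm
  exact h.cross_edge_ne_zero this.1 this.2

theorem cross_transVec_ne_zero {i j : Fin n} (hij : i ≠ j) :
    cross (transVec v i) (transVec v j) ≠ 0 := by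
  rw [transVec_eq, transVec_eq]
  have key : ∀ a b : ℕ, a < b → b < n →
      cross (trans v (a : ZMod (2 * n))) (trans v (b : ZMod (2 * n))) ≠ 0 := by
    intro a b hab hb
    have := h.cross_trans_pos (a : ZMod (2 * n)) (m := b - a) (by omega) (by omega)
    rw [← Nat.cast_add, Nat.add_sub_cancel' hab.le] at this
    exact this.ne'
  rcases lt_or_gt_of_ne hij with hlt | hlt
  · exact key i j hlt j.2
  · rw [cross_swap]; exact neg_ne_zero.2 (key j i hlt i.2)

/-- Opposite edges change `e_j` and `τ_j` only by a sign, so half of the edge conditions suffice. -/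
theorem isMultipleTiling_iff (L : Submodule ℤ Plane) [DiscreteTopology L] :
    IsMultipleTiling (polygon v) L ↔ ∀ j : Fin n, transVec v j ∈ L ∨
      edgeVec v j ∈ L ∧ ∃ r : ℝ, transVec v j + r • edgeVec v j ∈ L := by
  have hN := h.neZero
  constructor
  · intro ht j
    rw [transVec_eq, edgeVec_eq]
    exact h.edgeCondition_of_isMultipleTiling L ht _
  · intro hc
    have key : ∀ m : ℕ, m < n → EdgeCondition v L (m : ZMod (2 * n)) := by
      intro m hm
      have := hc ⟨m, hm⟩
      rwa [transVec_eq, edgeVec_eq] at this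
    refine h.isMultipleTiling_of_edgeCondition L fun k => ?_
    have hk : ((k.val : ℕ) : ZMod (2 * n)) = k := ZMod.natCast_zmod_val k
    have hlt := ZMod.val_lt k
    rcases lt_or_ge k.val n with hl | hl
    · rw [← hk]; exact key _ hl
    · have := key (k.val - n) (by omega)
      have e : k = ((k.val - n : ℕ) : ZMod (2 * n)) + n := by
        rw [← Nat.cast_add, Nat.sub_add_cancel hl, hk]
      rw [e]
      unfold EdgeCondition at this ⊢
      rw [h.trans_opposite, h.edge_opposite, L.neg_mem_iff, L.neg_mem_iff]
      refine this.imp_right (And.imp_right ?_)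
      rintro ⟨r, hr⟩
      refine ⟨r, ?_⟩
      rw [smul_neg, ← neg_add, L.neg_mem_iff]
      exact hr

/-- This eliminates the quantifier over lattices: a lattice containing `τ_i` and `τ_j` lies in their
rational span, and the finitely many vectors of that span that witness the condition generate a
suitable lattice. -/
theorem inClassB_iff : InClassB v ↔ ∃ i j : Fin n, i ≠ j ∧ PairCondition v i j := by
  constructor
  · rintro ⟨L, ⟨hd, -⟩, ht, i, j, hij, hi, hj⟩
    refine ⟨i, j, hij, fun k => ?_⟩
    have hW : ∀ x ∈ L, x ∈ ratSpan (transVec v i) (transVec v j) := fun x hx =>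
      mem_ratSpan_of_mem hi hj (h.cross_transVec_ne_zero hij) hx
    exact ((h.isMultipleTiling_iff L).1 ht k).imp (hW _)
      (And.imp (hW _) fun ⟨r, hr⟩ => ⟨r, hW _ hr⟩)
  · rintro ⟨i, j, hij, hc⟩
    have hcr := h.cross_transVec_ne_zero hij
    -- The value `0` is a default for those `k` whose line misses the rational plane.
    have : ∀ k : Fin n, ∃ r : ℝ, (∃ r : ℝ, transVec v k + r • edgeVec v k ∈
        ratSpan (transVec v i) (transVec v j)) → transVec v k + r • edgeVec v k ∈
        ratSpan (transVec v i) (transVec v j) := fun k => by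
      by_cases hk : ∃ r : ℝ, transVec v k + r • edgeVec v k ∈
        ratSpan (transVec v i) (transVec v j)
      · exact ⟨hk.choose, fun _ => hk.choose_spec⟩
      · exact ⟨0, fun h => absurd h hk⟩
    choose r hr using this
    let S : Set Plane := (Set.range (transVec v) ∪ Set.range (edgeVec v) ∪
      Set.range fun k => transVec v k + r k • edgeVec v k) ∩
        ratSpan (transVec v i) (transVec v j)
    have hS : S.Finite := (((Set.finite_range _).union (Set.finite_range _)).union
      (Set.finite_range _)).inter_of_left _
    have hd := discreteTopology_span hcr hS Set.inter_subset_right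
    have hi : transVec v i ∈ Submodule.span ℤ S :=
      Submodule.subset_span ⟨Or.inl (Or.inl ⟨i, rfl⟩), left_mem_ratSpan _ _⟩
    have hj : transVec v j ∈ Submodule.span ℤ S :=
      Submodule.subset_span ⟨Or.inl (Or.inl ⟨j, rfl⟩), right_mem_ratSpan _ _⟩
    refine ⟨Submodule.span ℤ S, ⟨hd, _, hi, _, hj, linearIndependent_pair_iff_cross.2 hcr⟩,
      (h.isMultipleTiling_iff _).2 fun k => ?_, i, j, hij, hi, hj⟩
    exact (hc k).imp (fun hk => Submodule.subset_span ⟨Or.inl (Or.inl ⟨k, rfl⟩), hk⟩)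
      (And.imp (fun hk => Submodule.subset_span ⟨Or.inl (Or.inr ⟨k, rfl⟩), hk⟩)
        fun hk => ⟨r k, Submodule.subset_span ⟨Or.inr ⟨k, rfl⟩, hr k hk⟩⟩)

/-- If all edges but one belong to a rational plane, and so do translates of the `τ_i` along
these edges, then the last edge belongs to the plane, too. -/
theorem mem_ratSpan_of_forall_ne {L : Submodule ℤ Plane} [DiscreteTopology L] {j i k : Fin n}
    (hij : i ≠ j) (hkj : k ≠ j) (hik : i ≠ k) (he : ∀ m, m ≠ j → edgeVec v m ∈ L)
    (hl : ∀ m, m ≠ j → LineCommensurable v L m) (m : Fin n) :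
    transVec v m ∈ ratSpan (edgeVec v i) (edgeVec v k) := by
  have hcr := h.cross_edgeVec_ne_zero hik
  set W := ratSpan (edgeVec v i) (edgeVec v k) with hW
  have hWm : ∀ m, m ≠ j → edgeVec v m ∈ W := fun m hm =>
    mem_ratSpan_of_mem (he i hij) (he k hkj) hcr (he m hm)
  have zsmul_mem : ∀ (z : ℤ) {x : Plane}, x ∈ W → z • x ∈ W := fun z x hx =>
    W.toAddSubgroup.zsmul_mem hx z
  -- All edges but `e_j` are in `W`, so `τ_m` is `± e_j` modulo `W`; multiplying by the same sign
  -- removes it.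
  have key : ∀ m, m ≠ j → ∃ r : ℝ, edgeVec v j + r • edgeVec v m ∈ W := by
    intro m hm
    obtain ⟨r, hr⟩ := hl m hm
    have h1 := mem_ratSpan_of_isCommensurableWith (he i hij) (he k hkj) hcr hr
    have h2 : transVec v m - transCoeff m j • edgeVec v j ∈ W := by
      rw [h.transVec_eq_sum, ← Finset.add_sum_erase _ _ (Finset.mem_univ j), add_sub_cancel_left]
      exact W.sum_mem fun x hx => zsmul_mem _ (hWm x (Finset.ne_of_mem_erase hx))
    have h3 := zsmul_mem (transCoeff m j) (W.sub_mem h1 h2)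
    refine ⟨transCoeff m j * r, ?_⟩
    convert h3 using 1
    have e := transCoeff_mul_self hm.symm
    have e' : (1 : ℝ) = (transCoeff m j : ℝ) * (transCoeff m j : ℝ) := by exact_mod_cast e.symm
    rw [← Int.cast_smul_eq_zsmul ℝ, ← Int.cast_smul_eq_zsmul ℝ]
    nth_rw 1 [← one_smul ℝ (edgeVec v j)]
    rw [e']; module
  -- The difference `r e_i - s e_k` of two such vectors is in `W`, so `r` is rational and `r e_i` is
  -- in `W` as well.
  have hj : edgeVec v j ∈ W := by
    obtain ⟨r, hr⟩ := key i hij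
    obtain ⟨s, hs⟩ := key k hkj
    obtain ⟨⟨p, hp⟩, -⟩ := (mem_ratSpan_iff_cross hcr).1 (W.sub_mem hr hs)
    have e : (p : ℝ) = r := by
      rw [hp, div_eq_iff hcr]
      rw [add_sub_add_left_eq_sub, cross_sub_left, cross_smul_left, cross_smul_left, cross_same]
      ring
    have h1 := W.sub_mem hr (W.smul_mem p (hWm i hij))
    rw [← Rat.cast_smul_eq_qsmul ℝ, e, add_sub_cancel_right] at h1
    exact h1
  rw [h.transVec_eq_sum]
  refine W.sum_mem fun x _ => zsmul_mem _ ?_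
  by_cases hx : x = j
  · rw [hx]; exact hj
  · exact hWm x hx

omit h in
theorem exists_ne_ne (hn : 3 ≤ n) (j : Fin n) : ∃ i k : Fin n, i ≠ j ∧ k ≠ j ∧ i ≠ k := by
  have : 2 ≤ (Finset.univ.erase j).card := by
    rw [Finset.card_erase_of_mem (Finset.mem_univ j), Finset.card_univ, Fintype.card_fin]; omega
  obtain ⟨i, hi, k, hk, hik⟩ := Finset.one_lt_card.1 this
  exact ⟨i, k, Finset.ne_of_mem_erase hi, Finset.ne_of_mem_erase hk, hik⟩

/-- For `n = 2` the plane spanned by both `τ_i` serves. For `n ≥ 3`, if no lattice witnesses Class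
B, all edges but one are in `L`, and then all `τ_m` are in one rational plane, which any two of them
span. -/
theorem exists_pairCondition_of_tiles (ht : TilesMultiply v) :
    ∃ i j : Fin n, i ≠ j ∧ PairCondition v i j := by
  have h2 := h.two_le
  have h01 : (⟨0, by omega⟩ : Fin n) ≠ ⟨1, by omega⟩ := by simp
  rcases h2.eq_or_lt with h2 | h3
  · refine ⟨_, _, h01, fun k => Or.inl ?_⟩
    have hk := k.2
    rcases (by omega : (k : ℕ) = 0 ∨ (k : ℕ) = 1) with e | e
    · have : k = ⟨0, by omega⟩ := Fin.ext e
      rw [this]; exact left_mem_ratSpan _ _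
    · have : k = ⟨1, by omega⟩ := Fin.ext e
      rw [this]; exact right_mem_ratSpan _ _
  by_cases hB : InClassB v
  · exact h.inClassB_iff.1 hB
  obtain ⟨L, hL, ht⟩ := ht
  have hd := hL.1
  have hc := (h.isMultipleTiling_iff L).1 ht
  -- At most one `τ_j` is in `L`; if there is none, any index may be singled out.
  obtain ⟨j, hj⟩ : ∃ j : Fin n, ∀ i, i ≠ j → transVec v i ∉ L := by
    by_cases hex : ∃ j : Fin n, transVec v j ∈ L
    · obtain ⟨j, hj⟩ := hex
      exact ⟨j, fun i hij hi => hB ⟨L, hL, ht, i, j, hij, hi, hj⟩⟩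
    · exact ⟨⟨0, by omega⟩, fun i _ hi => hex ⟨i, hi⟩⟩
  obtain ⟨i, k, hij, hkj, hik⟩ := exists_ne_ne h3 j
  have hmem := h.mem_ratSpan_of_forall_ne hij hkj hik
    (fun m hm => ((hc m).resolve_left (hj m hm)).1)
    (fun m hm => ((hc m).resolve_left (hj m hm)).2.imp fun r hr =>
      isCommensurableWith_of_mem hr)
  have hd' := discreteTopology_span (h.cross_edgeVec_ne_zero hik)
    (Set.finite_range (transVec v)) (by rintro _ ⟨m, rfl⟩; exact hmem m)
  have sub : ∀ m, transVec v m ∈ Submodule.span ℤ (Set.range (transVec v)) := fun m =>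
    Submodule.subset_span ⟨m, rfl⟩
  exact ⟨_, _, h01, fun m => Or.inl (mem_ratSpan_of_mem (sub _) (sub _)
    (h.cross_transVec_ne_zero h01) (sub m))⟩

theorem tilesMultiply_iff : TilesMultiply v ↔ InClassB v := by
  constructor
  · exact fun ht => h.inClassB_iff.2 (h.exists_pairCondition_of_tiles ht)
  · rintro ⟨L, hL, ht, -⟩
    exact ⟨L, hL, ht⟩

omit h in
theorem not_inClassA_and_inClassB : ¬ (InClassA v ∧ InClassB v) := by
  rintro ⟨⟨-, hA⟩, L, hL, ht, i, j, hij, hi, hj⟩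
  obtain ⟨m, -, hm⟩ := hA L hL ht
  exact hij ((hm i hi).trans (hm j hj).symm)

/-- No polygon is in Class A: one that tiles multiply also does so with a lattice that contains
two of the `τ_i`. -/
theorem not_inClassA : ¬ InClassA v := fun hA =>
  not_inClassA_and_inClassB ⟨hA, h.tilesMultiply_iff.1 hA.1⟩

omit h in
theorem transVec_mem_mixedGroup {J : Finset (Fin n)} {j : Fin n} (hj : j ∈ J) :
    transVec v j ∈ mixedGroup v J :=
  Submodule.mem_sup_left (Submodule.subset_span ⟨j, hj, rfl⟩)

omit h in
theorem edgeVec_mem_mixedGroup {J : Finset (Fin n)} {j : Fin n} (hj : j ∉ J) :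
    edgeVec v j ∈ mixedGroup v J :=
  Submodule.mem_sup_right (Submodule.subset_span ⟨j, by simpa using hj, rfl⟩)

/-- No polygon passes the test for Class A. -/
theorem not_passesTestA : ¬ PassesTestA v := by
  rintro ⟨j, hL, hall⟩
  have hd := hL.1
  have h2 := h.two_le
  rcases h2.eq_or_lt with h2 | h3
  -- For `n = 2`, `τ_j` is an integer multiple of the only other edge, so the group lies on a line.
  · obtain ⟨-, a, ha, b, hb, hab⟩ := hL
    rw [linearIndependent_pair_iff_cross] at hab
    apply hab
    obtain ⟨i, hij⟩ : ∃ i : Fin n, ∀ k, k ≠ j → k = i := by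
      have hj := j.2
      refine ⟨⟨1 - j, by omega⟩, fun k hk => Fin.ext ?_⟩
      have hk' := k.2
      have : (k : ℕ) ≠ j := fun e => hk (Fin.ext e)
      show (k : ℕ) = 1 - j
      omega
    have key : ∀ x ∈ mixedGroup v {j}, ∃ z : ℤ, x = z • edgeVec v i := by
      intro x hx
      rw [← Submodule.mem_span_singleton.trans (exists_congr fun _ => eq_comm)]
      refine (?_ : mixedGroup v {j} ≤ _) hx
      refine sup_le (Submodule.span_le.2 ?_) (Submodule.span_le.2 ?_)
      · rintro _ ⟨k, hk, rfl⟩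
        have hk : k = j := by simpa using hk
        rw [hk, h.transVec_eq_sum]
        refine Submodule.sum_mem _ fun m _ => ?_
        by_cases hm : m = j
        · rw [hm, transCoeff_self, zero_smul]; exact Submodule.zero_mem _
        · rw [hij m hm]
          exact Submodule.smul_mem _ _ (Submodule.mem_span_singleton_self _)
      · rintro _ ⟨k, hk, rfl⟩
        have hk : k ≠ j := by simpa using hk
        rw [hij k hk]
        exact Submodule.mem_span_singleton_self _
    obtain ⟨z, rfl⟩ := key a ha
    obtain ⟨z', rfl⟩ := key b hb
    rw [← Int.cast_smul_eq_zsmul ℝ, ← Int.cast_smul_eq_zsmul ℝ, cross_smul_left,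
      cross_smul_right, cross_same]
    ring
  -- For `n ≥ 3`, the line conditions make every `τ_i` commensurable with the group, which the test
  -- forbids for `i ≠ j`.
  · obtain ⟨i, k, hij, hkj, hik⟩ := exists_ne_ne h3 j
    have he : ∀ m, m ≠ j → edgeVec v m ∈ mixedGroup v {j} := fun m hm =>
      edgeVec_mem_mixedGroup (by simpa using hm)
    have hmem := h.mem_ratSpan_of_forall_ne hij hkj hik he (fun m hm => (hall m hm).1) i
    exact (hall i hij).2 (isCommensurableWith_of_mem_ratSpan (he i hij) (he k hkj) hmem)

/-! ### Maximal index sets with discrete `T(J)` -/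

open Classical in
/-- The indices of the `τ_k` in the rational span of `τ_i` and `τ_j`. -/
noncomputable def pairSet (v : ZMod (2 * n) → Plane) (i j : Fin n) : Finset (Fin n) :=
  Finset.univ.filter fun k => transVec v k ∈ ratSpan (transVec v i) (transVec v j)

omit h in
theorem mem_pairSet {i j k : Fin n} :
    k ∈ pairSet v i j ↔ transVec v k ∈ ratSpan (transVec v i) (transVec v j) := by
  simp [pairSet]

theorem discreteTopology_transGroup {i j : Fin n} (hij : i ≠ j) {J : Finset (Fin n)}
    (hJ : J ⊆ pairSet v i j) : DiscreteTopology (transGroup v J) := by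
  refine discreteTopology_span (h.cross_transVec_ne_zero hij) (J.finite_toSet.image _) ?_
  rintro _ ⟨k, hk, rfl⟩
  exact mem_pairSet.1 (hJ hk)

theorem subset_pairSet {i j : Fin n} (hij : i ≠ j) {J : Finset (Fin n)} (hi : i ∈ J) (hj : j ∈ J)
    (hd : DiscreteTopology (transGroup v J)) : J ⊆ pairSet v i j := by
  intro k hk
  have sub : ∀ m ∈ J, transVec v m ∈ transGroup v J := fun m hm =>
    Submodule.subset_span ⟨m, hm, rfl⟩
  exact mem_pairSet.2 (mem_ratSpan_of_mem (sub i hi) (sub j hj) (h.cross_transVec_ne_zero hij)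
    (sub k hk))

theorem isMaxDiscrete_pairSet {i j : Fin n} (hij : i ≠ j) : IsMaxDiscrete v (pairSet v i j) := by
  refine ⟨h.discreteTopology_transGroup hij subset_rfl, fun J hJ hle => ?_⟩
  exact h.subset_pairSet hij (hle (mem_pairSet.2 (left_mem_ratSpan _ _)))
    (hle (mem_pairSet.2 (right_mem_ratSpan _ _))) hJ

theorem eq_pairSet {i j : Fin n} (hij : i ≠ j) {J : Finset (Fin n)} (hJ : IsMaxDiscrete v J)
    (hi : i ∈ J) (hj : j ∈ J) : J = pairSet v i j :=
  hJ.eq_of_le (h.discreteTopology_transGroup hij subset_rfl) (h.subset_pairSet hij hi hj hJ.1)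

theorem exists_eq_pairSet {J : Finset (Fin n)} (hJ : IsMaxDiscrete v J) :
    ∃ i j : Fin n, i ≠ j ∧ J = pairSet v i j := by
  have h2 := h.two_le
  by_cases hc : 1 < J.card
  · obtain ⟨i, hi, j, hj, hij⟩ := Finset.one_lt_card.1 hc
    exact ⟨i, j, hij, h.eq_pairSet hij hJ hi hj⟩
  -- A set with at most one element is contained in a pair set, so by maximality it equals it.
  · obtain ⟨i, hi⟩ : ∃ i : Fin n, J ⊆ {i} := by
      have hne : Nonempty (Fin n) := ⟨⟨0, by omega⟩⟩
      exact Finset.card_le_one_iff_subset_singleton.1 (by omega)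
    obtain ⟨j, hj⟩ : ∃ j : Fin n, i ≠ j := by
      have : Nontrivial (Fin n) := Fin.nontrivial_iff_two_le.2 h2
      exact (exists_ne i).imp fun _ => Ne.symm
    refine ⟨i, j, hj, hJ.eq_of_le (h.discreteTopology_transGroup hj subset_rfl)
      (hi.trans ?_)⟩
    simpa using mem_pairSet.2 (left_mem_ratSpan _ _)

theorem existsUnique_isMaxDiscrete {i j : Fin n} (hij : i ≠ j) :
    ∃! J : Finset (Fin n), IsMaxDiscrete v J ∧ i ∈ J ∧ j ∈ J :=
  ⟨pairSet v i j, ⟨h.isMaxDiscrete_pairSet hij, mem_pairSet.2 (left_mem_ratSpan _ _),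
    mem_pairSet.2 (right_mem_ratSpan _ _)⟩, fun _ hJ => h.eq_pairSet hij hJ.1 hJ.2.1 hJ.2.2⟩

theorem ncard_isMaxDiscrete_le : {J : Finset (Fin n) | IsMaxDiscrete v J}.ncard ≤ n ^ 2 := by
  have hsub : {J : Finset (Fin n) | IsMaxDiscrete v J} ⊆
      (fun p : Fin n × Fin n => pairSet v p.1 p.2) '' Set.univ := by
    intro J hJ
    obtain ⟨i, j, -, e⟩ := h.exists_eq_pairSet hJ
    exact ⟨(i, j), trivial, e.symm⟩
  calc _ ≤ ((fun p : Fin n × Fin n => pairSet v p.1 p.2) '' Set.univ).ncard :=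
        Set.ncard_le_ncard hsub (Set.toFinite _)
    _ ≤ (Set.univ : Set (Fin n × Fin n)).ncard := Set.ncard_image_le (Set.toFinite _)
    _ = n ^ 2 := by rw [Set.ncard_univ]; simp [sq]

/-- The mixed group of `pairSet v i j` contains `τ_i` and `τ_j`. Once it is discrete, a point is
commensurable with it if and only if it is in their rational span. -/
theorem passesTestB_iff : PassesTestB v ↔ ∃ i j : Fin n, i ≠ j ∧ PairCondition v i j := by
  constructor
  · rintro ⟨J, hJ, hd, hl⟩
    obtain ⟨i, j, hij, rfl⟩ := h.exists_eq_pairSet hJ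
    have hi : i ∈ pairSet v i j := mem_pairSet.2 (left_mem_ratSpan _ _)
    have hj : j ∈ pairSet v i j := mem_pairSet.2 (right_mem_ratSpan _ _)
    have hcr := h.cross_transVec_ne_zero hij
    refine ⟨i, j, hij, fun k => ?_⟩
    by_cases hk : k ∈ pairSet v i j
    · exact Or.inl (mem_pairSet.1 hk)
    · exact Or.inr ⟨mem_ratSpan_of_mem (transVec_mem_mixedGroup hi) (transVec_mem_mixedGroup hj)
        hcr (edgeVec_mem_mixedGroup hk), (hl k hk).imp fun r hr =>
          mem_ratSpan_of_isCommensurableWith (transVec_mem_mixedGroup hi)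
            (transVec_mem_mixedGroup hj) hcr hr⟩
  · rintro ⟨i, j, hij, hc⟩
    have hcr := h.cross_transVec_ne_zero hij
    have hi : i ∈ pairSet v i j := mem_pairSet.2 (left_mem_ratSpan _ _)
    have hj : j ∈ pairSet v i j := mem_pairSet.2 (right_mem_ratSpan _ _)
    have hk : ∀ k, k ∉ pairSet v i j → _ := fun k hk => (hc k).resolve_left (mt mem_pairSet.2 hk)
    refine ⟨_, h.isMaxDiscrete_pairSet hij, ?_, fun k hk' => (hk k hk').2.imp fun r hr =>
      isCommensurableWith_of_mem_ratSpan (transVec_mem_mixedGroup hi)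
        (transVec_mem_mixedGroup hj) hr⟩
    rw [mixedGroup, transGroup, edgeGroup, ← Submodule.span_union]
    refine discreteTopology_span hcr
      (((Finset.finite_toSet _).image _).union ((Finset.finite_toSet _).image _)) ?_
    rintro _ (⟨k, hk', rfl⟩ | ⟨k, hk', rfl⟩)
    · exact mem_pairSet.1 hk'
    · exact (hk k (by simpa using hk')).1

theorem classification : (TilesMultiply v ↔ InClassA v ∨ InClassB v) ∧
    ¬ (InClassA v ∧ InClassB v) ∧ (InClassA v ↔ PassesTestA v) ∧
    (InClassB v ↔ PassesTestB v) ∧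
    (∀ i j : Fin n, i ≠ j → ∃! J : Finset (Fin n), IsMaxDiscrete v J ∧ i ∈ J ∧ j ∈ J) ∧
    {J : Finset (Fin n) | IsMaxDiscrete v J}.ncard ≤ n ^ 2 :=
  ⟨⟨fun ht => Or.inr (h.tilesMultiply_iff.1 ht), fun ht => ht.elim And.left
      h.tilesMultiply_iff.2⟩, not_inClassA_and_inClassB,
    iff_of_false h.not_inClassA h.not_passesTestA, h.inClassB_iff.trans h.passesTestB_iff.symm,
    fun _ _ hij => h.existsUnique_isMaxDiscrete hij, h.ncard_isMaxDiscrete_le⟩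

end IsSymmConvexPolygon

/-! ## The test for multiple tilings as a formula about coordinates -/

/-- Moving along `e` does not change the cross product with `e`, which is a rational multiple of
`cross a b` for any vector of the rational span. Conversely, if `e` has a nonzero coordinate `p` or
`q`, moving along `e` makes this coordinate of `x` vanish, and the given ratio makes the other one
rational. -/
theorem exists_add_smul_mem_ratSpan_iff {a b e x : Plane} (hab : cross a b ≠ 0) (he : e ≠ 0)
    (hmem : e ∈ ratSpan a b) : (∃ r : ℝ, x + r • e ∈ ratSpan a b) ↔
      ∃ q : ℚ, (q : ℝ) = cross x e / cross a b := by
  obtain ⟨p, q, hpq⟩ := mem_ratSpan_iff.1 hmem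
  constructor
  · rintro ⟨r, hr⟩
    obtain ⟨p', q', hpq'⟩ := mem_ratSpan_iff.1 hr
    refine ⟨p' * q - q' * p, ?_⟩
    have e1 : cross x e = cross (x + r • e) e := by
      rw [cross_add_left, cross_smul_left, cross_same]; ring
    rw [e1, ← hpq', ← hpq, eq_div_iff hab]
    simp only [cross_add_left, cross_add_right, cross_ratCast_smul_left, cross_ratCast_smul_right,
      cross_same]
    rw [cross_swap b a]; push_cast; ring
  · rintro ⟨ρ, hρ⟩
    obtain ⟨s, t, hx⟩ : ∃ s t : ℝ, x = s • a + t • b := ⟨_, _, eq_smul_add_smul hab x⟩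
    have h1 : (ρ : ℝ) = s * q - t * p := by
      rw [hρ, div_eq_iff hab, hx, ← hpq]
      simp only [cross_add_left, cross_add_right, cross_ratCast_smul_right,
        cross_smul_left, cross_same]
      rw [cross_swap b a]; ring
    rw [← Rat.cast_smul_eq_qsmul ℝ, ← Rat.cast_smul_eq_qsmul ℝ] at hpq
    by_cases hp : p = 0
    · have hq : q ≠ 0 := by
        rintro rfl; apply he; rw [← hpq, hp]; simp
      have hq' : (q : ℝ) ≠ 0 := by exact_mod_cast hq
      refine ⟨-(t / q), mem_ratSpan_iff.2 ⟨ρ / q, 0, ?_⟩⟩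
      rw [← Rat.cast_smul_eq_qsmul ℝ, hx, ← hpq, hp, zero_smul, add_zero]
      push_cast
      rw [h1, hp, Rat.cast_zero, mul_zero, sub_zero, mul_div_cancel_right₀ _ hq', zero_smul,
        zero_add, smul_smul, neg_mul, div_mul_cancel₀ _ hq']
      module
    · have hp' : (p : ℝ) ≠ 0 := by exact_mod_cast hp
      refine ⟨-(s / p), mem_ratSpan_iff.2 ⟨0, -(ρ / p), ?_⟩⟩
      rw [← Rat.cast_smul_eq_qsmul ℝ 0 a, ← Rat.cast_smul_eq_qsmul ℝ (-(ρ / p)) b, hx, ← hpq]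
      push_cast
      rw [h1, zero_smul, zero_add, smul_add, smul_smul, smul_smul, neg_mul, div_mul_cancel₀ _ hp']
      have : -((s * q - t * p) / p : ℝ) = t + -(s / p) * q := by field_simp; ring
      rw [this]; module

/-- A way of computing with real numbers on a machine. The numbers are represented by
expressions, and each vertex of the polygon is represented by `str` cells of the input. -/
structure Arithmetic {R : Type} [CommRing R] [Div R] (M : NumberModel R) (str : ℕ) where
  /-- Representations of real numbers. -/
  Number : Type
  /-- Sums. -/
  add : Number → Number → Number
  /-- Differences. -/
  sub : Number → Number → Number
  /-- Products. -/
  mul : Number → Number → Number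
  /-- The coordinates of the vertex whose address is in a register, and of the next vertex. -/
  coord : ℕ → ℕ → Number
  /-- The test whether a number is nonzero. -/
  nonzero : Number → Test
  /-- The test whether the ratio of two numbers is rational. -/
  isRatio : Number → Number → Test
  /-- The relation between representations and numbers. -/
  Rep : (ℕ → ℕ) → (ℕ → R) → Number → ℝ → Prop
  /-- The relation between polygons and inputs. -/
  Valid : {n : ℕ} → (ZMod (2 * n) → Plane) → (ℕ → R) → Prop
  rep_add : ∀ {env data x y a b}, Rep env data x a → Rep env data y b →
    Rep env data (add x y) (a + b)
  rep_sub : ∀ {env data x y a b}, Rep env data x a → Rep env data y b →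
    Rep env data (sub x y) (a - b)
  rep_mul : ∀ {env data x y a b}, Rep env data x a → Rep env data y b →
    Rep env data (mul x y) (a * b)
  rep_coord : ∀ {n : ℕ} {v : ZMod (2 * n) → Plane} {data}, Valid v data → ∀ {env r q c},
    env r = q * str → 7 ≤ r → r < 12 → c < 4 → (r = 8 → c < 2) → q * 2 + c < 4 * n →
    Rep env data (coord r c) (coordSeq v (q * 2 + c))
  static_nonzero : ∀ {env data x a}, Rep env data x a → (nonzero x).Static str 12
  nonzero_iff : ∀ {env data x a}, Rep env data x a → ∀ N,
    ((nonzero x).Holds M N str 12 env data ↔ a ≠ 0)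
  static_isRatio : ∀ {env data x y a b}, Rep env data x a → Rep env data y b →
    (isRatio x y).Static str 12
  isRatio_iff : ∀ {env data x y a b}, Rep env data x a → Rep env data y b → b ≠ 0 → ∀ N,
    ((isRatio x y).Holds M N str 12 env data ↔ ∃ q : ℚ, (q : ℝ) = a / b)

namespace Arithmetic

variable {R : Type} [CommRing R] [Div R] {M : NumberModel R} {str : ℕ} (A : Arithmetic M str)

/-- Representations of vectors. -/
abbrev Vec : Type := A.Number × A.Number

/-- The relation between representations and vectors. -/
def RepVec (env : ℕ → ℕ) (data : ℕ → R) (x : A.Vec) (p : Plane) : Prop :=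
  A.Rep env data x.1 p.1 ∧ A.Rep env data x.2 p.2

/-- The vertex whose address is in register `r`. -/
def vertex (r : ℕ) : A.Vec := (A.coord r 0, A.coord r 1)

/-- The vertex after the one whose address is in register `r`. -/
def next (r : ℕ) : A.Vec := (A.coord r 2, A.coord r 3)

/-- Sums of vectors. -/
def vadd (x y : A.Vec) : A.Vec := (A.add x.1 y.1, A.add x.2 y.2)

/-- Differences of vectors. -/
def vsub (x y : A.Vec) : A.Vec := (A.sub x.1 y.1, A.sub x.2 y.2)

/-- Cross products of vectors. -/
def vcross (x y : A.Vec) : A.Number := A.sub (A.mul x.1 y.2) (A.mul x.2 y.1)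

/-- The edge from the vertex whose address is in register `r`. -/
def edge (r : ℕ) : A.Vec := A.vsub (A.next r) (A.vertex r)

/-- The translation from this edge to the opposite one. -/
def trans (r : ℕ) : A.Vec :=
  A.vsub (A.vsub (A.vadd (A.vertex 7) (A.vertex 8)) (A.next r)) (A.vertex r)

/-- The test whether the ratios of the cross products `x × y` and `x' × y'` to `τ_i × τ_j` are
rational, where the addresses of the vertices `i` and `j` are in registers `9` and `10`. -/
def ratios (x y x' y' : A.Vec) : Test :=
  .and (A.isRatio (A.vcross x y) (A.vcross (A.trans 9) (A.trans 10)))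
    (A.isRatio (A.vcross x' y') (A.vcross (A.trans 9) (A.trans 10)))

/-- The condition on the edge `k`, whose address is in register `11`. -/
def matrix : Test :=
  .and (A.nonzero (A.vcross (A.trans 9) (A.trans 10)))
    (.not (.and
      (.not (A.ratios (A.trans 11) (A.trans 10) (A.trans 9) (A.trans 11)))
      (.not (.and (A.ratios (A.edge 11) (A.trans 10) (A.trans 9) (A.edge 11))
        (A.isRatio (A.vcross (A.trans 11) (A.edge 11))
          (A.vcross (A.trans 9) (A.trans 10)))))))

/-- The test for multiple tilings. -/
def formula : Test := .ex (.ex (.not (.ex (.not A.matrix))))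

variable {A} {n : ℕ} {v : ZMod (2 * n) → Plane} {env : ℕ → ℕ} {data : ℕ → R}

theorem RepVec.vadd {x y : A.Vec} {p q : Plane} (hx : A.RepVec env data x p)
    (hy : A.RepVec env data y q) : A.RepVec env data (A.vadd x y) (p + q) :=
  ⟨A.rep_add hx.1 hy.1, A.rep_add hx.2 hy.2⟩

theorem RepVec.vsub {x y : A.Vec} {p q : Plane} (hx : A.RepVec env data x p)
    (hy : A.RepVec env data y q) : A.RepVec env data (A.vsub x y) (p - q) :=
  ⟨A.rep_sub hx.1 hy.1, A.rep_sub hx.2 hy.2⟩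

theorem RepVec.vcross {x y : A.Vec} {p q : Plane} (hx : A.RepVec env data x p)
    (hy : A.RepVec env data y q) : A.Rep env data (A.vcross x y) (cross p q) :=
  A.rep_sub (A.rep_mul hx.1 hy.2) (A.rep_mul hx.2 hy.1)

theorem coordSeq_add (q : ℕ) :
    coordSeq v (q * 2 + 0) = (v q).1 ∧ coordSeq v (q * 2 + 1) = (v q).2 ∧
    coordSeq v (q * 2 + 2) = (v (q + 1)).1 ∧ coordSeq v (q * 2 + 3) = (v (q + 1)).2 := by
  unfold coordSeq
  have e2 : (q * 2 + 1) / 2 = q := by omega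
  have e3 : (q * 2 + 2) / 2 = q + 1 := by omega
  have e4 : (q * 2 + 3) / 2 = q + 1 := by omega
  have f2 : (q * 2 + 1) % 2 = 1 := by omega
  have f3 : (q * 2 + 2) % 2 = 0 := by omega
  have f4 : (q * 2 + 3) % 2 = 1 := by omega
  simp [e2, e3, e4, f2, f3, f4]

theorem repVec_vertex (hv : A.Valid v data) {r q : ℕ} (he : env r = q * str) (h7 : 7 ≤ r)
    (hr : r < 12) (hq : q < 2 * n) : A.RepVec env data (A.vertex r) (v q) := by
  obtain ⟨e1, e2, -, -⟩ := coordSeq_add (v := v) q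
  refine ⟨?_, ?_⟩
  · rw [← e1]
    exact A.rep_coord hv he h7 hr (by omega) (by omega) (by omega)
  · rw [← e2]
    exact A.rep_coord hv he h7 hr (by omega) (by omega) (by omega)

theorem repVec_next (hv : A.Valid v data) {r q : ℕ} (he : env r = q * str) (h9 : 9 ≤ r)
    (hr : r < 12) (hq : q + 1 < 2 * n) : A.RepVec env data (A.next r) (v (q + 1)) := by
  obtain ⟨-, -, e1, e2⟩ := coordSeq_add (v := v) q
  refine ⟨?_, ?_⟩
  · rw [← e1]
    exact A.rep_coord hv he (by omega) hr (by omega) (by omega) (by omega)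
  · rw [← e2]
    exact A.rep_coord hv he (by omega) hr (by omega) (by omega) (by omega)

section Matrix

variable (h : IsSymmConvexPolygon n v) (hv : A.Valid v data) (e7 : env 7 = 0)
  (e8 : env 8 = n * str)
include h hv

omit h in
theorem repVec_edge {r : ℕ} {i : Fin n} (he : env r = i * str) (h9 : 9 ≤ r) (hr : r < 12) :
    A.RepVec env data (A.edge r) (edgeVec v i) := by
  have := i.2
  rw [IsSymmConvexPolygon.edgeVec_eq]
  exact (repVec_next hv he h9 hr (by omega)).vsub
    (repVec_vertex hv he (by omega) hr (by omega))

include e7 e8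

/-- Central symmetry replaces `v (j + n + 1)` by `v 0 + v n - v (j + 1)`. For `j = n - 1` its
address would be beyond the input, the index being `2n`. -/
theorem repVec_trans {r : ℕ} {i : Fin n} (he : env r = i * str) (h9 : 9 ≤ r) (hr : r < 12) :
    A.RepVec env data (A.trans r) (transVec v i) := by
  have := i.2
  rw [IsSymmConvexPolygon.transVec_eq, h.trans_eq _ 0]
  have r7 := repVec_vertex (env := env) (r := 7) (q := 0) hv (by rw [e7, zero_mul]) (by omega) (by omega)
    (by omega)
  have r8 := repVec_vertex (r := 8) (q := n) hv e8 (by omega) (by omega) (by omega)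
  rw [Nat.cast_zero] at r7
  rw [zero_add]
  exact ((r7.vadd r8).vsub (repVec_next hv he h9 hr (by omega))).vsub
    (repVec_vertex hv he (by omega) hr (by omega))

theorem static_matrix {i j k : Fin n} (e9 : env 9 = i * str) (e10 : env 10 = j * str)
    (e11 : env 11 = k * str) : A.matrix.Static str 12 := by
  have ti := repVec_trans h hv e7 e8 e9 (by omega) (by omega)
  have tj := repVec_trans h hv e7 e8 e10 (by omega) (by omega)
  have tk := repVec_trans h hv e7 e8 e11 (by omega) (by omega)
  have ek := repVec_edge hv e11 (by omega) (by omega)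
  have D := ti.vcross tj
  exact ⟨A.static_nonzero D, ⟨A.static_isRatio (tk.vcross tj) D,
    A.static_isRatio (ti.vcross tk) D⟩, ⟨A.static_isRatio (ek.vcross tj) D,
    A.static_isRatio (ti.vcross ek) D⟩, A.static_isRatio (tk.vcross ek) D⟩

theorem holds_matrix_iff {i j k : Fin n} (e9 : env 9 = i * str) (e10 : env 10 = j * str)
    (e11 : env 11 = k * str) (N : ℕ) : A.matrix.Holds M N str 12 env data ↔
      i ≠ j ∧ (transVec v k ∈ ratSpan (transVec v i) (transVec v j) ∨
        edgeVec v k ∈ ratSpan (transVec v i) (transVec v j) ∧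
          ∃ r : ℝ, transVec v k + r • edgeVec v k ∈
            ratSpan (transVec v i) (transVec v j)) := by
  have ti := repVec_trans h hv e7 e8 e9 (by omega) (by omega)
  have tj := repVec_trans h hv e7 e8 e10 (by omega) (by omega)
  have tk := repVec_trans h hv e7 e8 e11 (by omega) (by omega)
  have ek := repVec_edge hv e11 (by omega) (by omega)
  have D := ti.vcross tj
  have hne : cross (transVec v i) (transVec v j) ≠ 0 ↔ i ≠ j := by
    refine ⟨?_, h.cross_transVec_ne_zero⟩
    rintro hc rfl
    exact hc (cross_same _)
  simp only [matrix, ratios, Test.Holds]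
  rw [A.nonzero_iff D, hne]
  refine and_congr_right fun hij => ?_
  have hD := hne.2 hij
  rw [A.isRatio_iff (tk.vcross tj) D hD, A.isRatio_iff (ti.vcross tk) D hD,
    A.isRatio_iff (ek.vcross tj) D hD, A.isRatio_iff (ti.vcross ek) D hD,
    A.isRatio_iff (tk.vcross ek) D hD, ← mem_ratSpan_iff_cross hD, ← mem_ratSpan_iff_cross hD,
    ← not_or, not_not]
  refine or_congr_right (and_congr_right fun hmem => ?_)
  have he : edgeVec v k ≠ 0 := by
    rw [IsSymmConvexPolygon.edgeVec_eq]; exact h.edge_ne_zero _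
  exact (exists_add_smul_mem_ratSpan_iff hD he hmem).symm

end Matrix

/-- Whether the addresses are in range does not depend on the input, so one assignment to the
quantified registers suffices; all are set to the first vertex. -/
theorem static_formula (h : IsSymmConvexPolygon n v) (hv : A.Valid v data) :
    A.formula.Static str 9 := by
  have := h.two_le
  exact static_matrix (env := fun r => if r = 8 then n * str else 0) h hv rfl rfl
    (i := ⟨0, by omega⟩) (j := ⟨0, by omega⟩) (k := ⟨0, by omega⟩) (by simp) (by simp) (by simp)

theorem holds_formula_iff (h : IsSymmConvexPolygon n v) (hv : A.Valid v data) :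
    A.formula.Holds M n str 9 (initialEnv n str) data ↔ InClassB v := by
  have h2 := h.two_le
  rw [h.inClassB_iff]
  have key : ∀ i j k : Fin n, A.matrix.Holds M n str 12 (Function.update (Function.update
      (Function.update (initialEnv n str) 9 (i * str)) 10 (j * str)) 11 (k * str)) data ↔ _ :=
    fun i j k => holds_matrix_iff (i := i) (j := j) (k := k) h hv (by simp [initialEnv]) (by simp [initialEnv]) (by simp)
      (by simp) (by simp) n
  simp only [formula, Test.Holds]
  constructor
  · rintro ⟨i, hi, j, hj, hk⟩
    push Not at hk
    -- The condition `i ≠ j` is inside the universal quantifier, so it is read off at `k = 0`.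
    have := (key ⟨i, hi⟩ ⟨j, hj⟩ ⟨0, by omega⟩).1 (hk 0 (by omega))
    exact ⟨⟨i, hi⟩, ⟨j, hj⟩, this.1, fun k => ((key ⟨i, hi⟩ ⟨j, hj⟩ k).1 (hk k k.2)).2⟩
  · rintro ⟨i, j, hij, hc⟩
    refine ⟨i, i.2, j, j.2, ?_⟩
    rintro ⟨k, hk, hn⟩
    exact hn ((key i j ⟨k, hk⟩).2 ⟨hij, hc ⟨k, hk⟩⟩)

/-- Polygons that tile multiply are recognized in polynomial time. -/
theorem exists_decides (A : Arithmetic M str) (hM : M.Modest) (hstr : 1 ≤ str) :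
    ∃ (p : Program) (C k : ℕ), ∀ (n : ℕ) (v : ZMod (2 * n) → Plane), IsSymmConvexPolygon n v →
      ∀ w : ℕ → R, A.Valid v w → ∀ B : ℕ, 2 * (n * str) ≤ B →
        (∀ a < 2 * (n * str), M.numSize (w a) ≤ B) →
        ∃ (s : Memory R) (t : ℕ), Runs M p (inputMemory n (2 * (n * str)) w) s t ∧
          t ≤ C * B ^ k ∧ HoldsAnswer v s := by
  -- If the addresses were out of range, no polygon would have a valid input and any program would
  -- do.
  by_cases hs : A.formula.Static str 9
  · obtain ⟨C, k, hC⟩ := exists_runs_decisionProgram hM str hstr A.formula hs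
    refine ⟨decisionProgram str A.formula, C, k, fun n v h w hv B hB hw => ?_⟩
    have h2 := h.two_le
    obtain ⟨s, t, hr, ht, hh⟩ := hC n (by omega) w B hB hw
    refine ⟨s, t, hr, ht, ?_⟩
    rw [holds_formula_iff h hv] at hh
    unfold HoldsAnswer
    rw [h.tilesMultiply_iff]
    have hA := h.not_inClassA
    rcases hh with ⟨hh, h0⟩ | ⟨hh, h0⟩ <;> simp [h0, hh, hA]
  · exact ⟨.idxConst 0 0, 0, 0, fun n v h w hv => absurd (static_formula h hv) hs⟩

end Arithmetic

/-! ## Arithmetic with real numbers in one unit of time -/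

theorem modest_realModel : realModel.Modest where
  idxSize_le _ := Nat.zero_le _
  numSize_apply_le _ _ _ := Nat.zero_le _

/-- Real numbers represent themselves. -/
noncomputable def realArithmetic : Arithmetic realModel 2 where
  Number := Expr
  add := .app .add
  sub := .app .sub
  mul := .app .mul
  coord := .load
  nonzero x := .not (.isZero x)
  isRatio x y := .special (.app .div x y)
  Rep env data x a := x.Static 2 12 ∧ x.eval env data = a
  Valid v w := w = coordSeq v
  rep_add hx hy := ⟨⟨hx.1, hy.1⟩, by rw [← hx.2, ← hy.2]; rfl⟩
  rep_sub hx hy := ⟨⟨hx.1, hy.1⟩, by rw [← hx.2, ← hy.2]; rfl⟩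
  rep_mul hx hy := ⟨⟨hx.1, hy.1⟩, by rw [← hx.2, ← hy.2]; rfl⟩
  rep_coord := by
    rintro n v data rfl env r q c he h7 hr hc h8 -
    exact ⟨⟨h7, hr, hc, h8⟩, by rw [Expr.eval, he]⟩
  static_nonzero hx := hx.1
  nonzero_iff hx N := not_congr (by rw [← hx.2]; rfl)
  static_isRatio hx hy := ⟨hx.1, hy.1⟩
  isRatio_iff hx hy _ N := by rw [← hx.2, ← hy.2]; rfl

/-! ## Arithmetic with elements of a number field on integers of finite size -/

theorem size_add_le (a b : ℕ) : Nat.size (a + b) ≤ Nat.size a + Nat.size b + 1 := by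
  rw [Nat.size_le]
  have h1 := Nat.lt_size_self a
  have h2 := Nat.lt_size_self b
  have h3 : 2 ^ Nat.size a ≤ 2 ^ (Nat.size a + Nat.size b) :=
    Nat.pow_le_pow_right two_pos (by omega)
  have h4 : 2 ^ Nat.size b ≤ 2 ^ (Nat.size a + Nat.size b) :=
    Nat.pow_le_pow_right two_pos (by omega)
  rw [pow_succ]; omega

theorem size_mul_le (a b : ℕ) : Nat.size (a * b) ≤ Nat.size a + Nat.size b := by
  rw [Nat.size_le, pow_add]
  exact Nat.mul_lt_mul'' (Nat.lt_size_self a) (Nat.lt_size_self b)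

theorem modest_integerModel : integerModel.Modest where
  idxSize_le a := by
    change Nat.size a ≤ a
    rw [Nat.size_le]; exact Nat.lt_two_pow_self
  numSize_apply_le o x y := by
    change Nat.size (o.apply x y).natAbs ≤ Nat.size x.natAbs + Nat.size y.natAbs + 1
    cases o with
    | add => exact (Nat.size_le_size (Int.natAbs_add_le x y)).trans (size_add_le _ _)
    | sub => exact (Nat.size_le_size (Int.natAbs_sub_le x y)).trans (size_add_le _ _)
    | mul =>
      rw [ArithOp.apply, Int.natAbs_mul]
      exact (size_mul_le _ _).trans (Nat.le_succ _)
    | div =>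
      have := Nat.size_le_size (Int.natAbs_ediv_le_natAbs x y)
      rw [ArithOp.apply]
      omega

namespace Expr

/-- Sums of expressions. -/
def sum (f : ℕ → Expr) : ℕ → Expr
  | 0 => .const 0
  | m + 1 => .app .add (sum f m) (f m)

/-- Products of expressions. -/
def prod (f : ℕ → Expr) : ℕ → Expr
  | 0 => .const 1
  | m + 1 => .app .mul (prod f m) (f m)

variable {R : Type} [CommRing R] [Div R] {env : ℕ → ℕ} {data : ℕ → R} {str L : ℕ}

theorem eval_const (z : ℤ) : (const z).eval env data = (z : R) := rfl

theorem eval_add (a b : Expr) : (app .add a b).eval env data = a.eval env data + b.eval env data :=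
  rfl

theorem eval_sub (a b : Expr) : (app .sub a b).eval env data = a.eval env data - b.eval env data :=
  rfl

theorem eval_mul (a b : Expr) : (app .mul a b).eval env data = a.eval env data * b.eval env data :=
  rfl

theorem eval_sum (f : ℕ → Expr) (m : ℕ) :
    (sum f m).eval env data = ∑ k ∈ Finset.range m, (f k).eval env data := by
  induction m with
  | zero => simp [sum, eval]
  | succ m ih => rw [Finset.sum_range_succ, ← ih]; rfl

theorem eval_prod (f : ℕ → Expr) (m : ℕ) :
    (prod f m).eval env data = ∏ k ∈ Finset.range m, (f k).eval env data := by
  induction m with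
  | zero => simp [prod, eval]
  | succ m ih => rw [Finset.prod_range_succ, ← ih]; rfl

theorem static_sum {f : ℕ → Expr} {m : ℕ} (h : ∀ k < m, (f k).Static str L) :
    (sum f m).Static str L := by
  induction m with
  | zero => trivial
  | succ m ih => exact ⟨ih fun k hk => h k (by omega), h m (by omega)⟩

theorem static_prod {f : ℕ → Expr} {m : ℕ} (h : ∀ k < m, (f k).Static str L) :
    (prod f m).Static str L := by
  induction m with
  | zero => trivial
  | succ m ih => exact ⟨ih fun k hk => h k (by omega), h m (by omega)⟩

end Expr

namespace Test

/-- Conjunctions of tests. -/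
def all (f : ℕ → Test) : ℕ → Test
  | 0 => .isZero (.const 0)
  | m + 1 => .and (all f m) (f m)

variable {R : Type} [CommRing R] [Div R] {M : NumberModel R} {env : ℕ → ℕ} {data : ℕ → R}
  {N str L : ℕ}

theorem holds_all (f : ℕ → Test) (m : ℕ) : (all f m).Holds M N str L env data ↔
    ∀ k < m, (f k).Holds M N str L env data := by
  induction m with
  | zero => simp [all, Holds, Expr.eval]
  | succ m ih =>
    rw [all, Holds, ih]
    exact Nat.forall_lt_succ_right.symm

theorem static_all {f : ℕ → Test} {m : ℕ} (h : ∀ k < m, (f k).Static str L) :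
    (all f m).Static str L := by
  induction m with
  | zero => trivial
  | succ m ih => exact ⟨ih fun k hk => h k (by omega), h m (by omega)⟩

end Test

/-- A multiplication table for `ℚ(α)` with basis `1, α, …, α ^ (d - 1)`. -/
structure PowerTable (α : ℝ) (d : ℕ) where
  /-- The common denominator. -/
  den : ℤ
  /-- The coefficients. -/
  coeff : ℕ → ℕ → ℤ
  one_le : 1 ≤ d
  den_ne_zero : den ≠ 0
  den_mul_pow : ∀ m < 2 * d, (den : ℝ) * α ^ m = ∑ k ∈ Finset.range d, (coeff m k : ℝ) * α ^ k
  eq_zero_of_sum : ∀ f : ℕ → ℤ, ∑ k ∈ Finset.range d, (f k : ℝ) * α ^ k = 0 → ∀ k < d, f k = 0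

/-- The coefficients are those of the remainders of `X ^ m` modulo the minimal polynomial,
multiplied by a common denominator. Exponents below `2 * d` cover all products of two basis
elements. -/
theorem exists_powerTable {α : ℝ} (hα : IsAlgebraic ℚ α) :
    Nonempty (PowerTable α (minpoly ℚ α).natDegree) := by
  classical
  have hint : IsIntegral ℚ α := hα.isIntegral
  have hd := minpoly.natDegree_pos hint
  set d := (minpoly ℚ α).natDegree with hd'
  let r : ℕ → Polynomial ℚ := fun m => Polynomial.X ^ m %ₘ minpoly ℚ α
  obtain ⟨b, hb⟩ := IsLocalization.exist_integer_multiples_of_finset (nonZeroDivisors ℤ)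
    (((Finset.range (2 * d)) ×ˢ (Finset.range d)).image fun p => (r p.1).coeff p.2)
  have hz : ∀ m k, ∃ z : ℤ, m < 2 * d → k < d → (z : ℚ) = (b : ℤ) * (r m).coeff k := by
    intro m k
    by_cases hm : m < 2 * d ∧ k < d
    · obtain ⟨z, hz⟩ := hb ((r m).coeff k) (Finset.mem_image.2 ⟨(m, k), by simp [hm], rfl⟩)
      exact ⟨z, fun _ _ => by simpa using hz⟩
    · exact ⟨0, fun h1 h2 => absurd ⟨h1, h2⟩ hm⟩
  choose z hz using hz
  refine ⟨⟨b, z, hd, nonZeroDivisors.ne_zero b.2, fun m hm => ?_, fun f hf k hk => ?_⟩⟩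
  · have e1 : Polynomial.aeval α (r m) = α ^ m := by
      rw [Polynomial.aeval_modByMonic_eq_self_of_root (minpoly.aeval ℚ α)]; simp
    have hdeg : (r m).natDegree < d := by
      refine Polynomial.natDegree_modByMonic_lt _ (minpoly.monic hint) ?_
      intro e
      rw [hd', e] at hd; simp at hd
    rw [← e1, Polynomial.aeval_eq_sum_range' hdeg, Finset.mul_sum]
    refine Finset.sum_congr rfl fun k hk => ?_
    have := hz m k hm (Finset.mem_range.1 hk)
    have e2 : (z m k : ℝ) = (b : ℤ) * ((r m).coeff k : ℝ) := by exact_mod_cast this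
    rw [e2, ← Rat.cast_smul_eq_qsmul ℝ, smul_eq_mul, mul_assoc]
  · have li := linearIndependent_pow (K := ℚ) α
    rw [Fintype.linearIndependent_iff] at li
    have := li (fun i => (f i : ℚ)) (by
      rw [Finset.sum_range] at hf
      rw [← hf]
      refine Finset.sum_congr rfl fun i _ => ?_
      rw [← Rat.cast_smul_eq_qsmul ℝ, smul_eq_mul]; push_cast; rfl) ⟨k, hk⟩
    exact_mod_cast this

section NumberField

variable {α : ℝ} {d : ℕ} (K : PowerTable α d)

/-- Elements of `ℚ(α)` with common denominator. -/
structure FieldExpr : Type where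
  /-- The denominator. -/
  den : Expr
  /-- The coefficients of the numerator. -/
  coeff : ℕ → Expr

/-- The relation between elements of `ℚ(α)` and real numbers. -/
structure FieldRep (α : ℝ) (d : ℕ) (env : ℕ → ℕ) (data : ℕ → ℤ) (x : FieldExpr) (a : ℝ) :
    Prop where
  static_den : x.den.Static (4 * d) 12
  static_coeff : ∀ k < d, (x.coeff k).Static (4 * d) 12
  den_ne_zero : x.den.eval env data ≠ 0
  mul_den : a * ((x.den.eval env data : ℤ) : ℝ) =
    ∑ k ∈ Finset.range d, (((x.coeff k).eval env data : ℤ) : ℝ) * α ^ k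

namespace FieldExpr

/-- Sums in `ℚ(α)`. -/
def add (x y : FieldExpr) : FieldExpr where
  den := .app .mul x.den y.den
  coeff k := .app .add (.app .mul (x.coeff k) y.den) (.app .mul (y.coeff k) x.den)

/-- Differences in `ℚ(α)`. -/
def sub (x y : FieldExpr) : FieldExpr where
  den := .app .mul x.den y.den
  coeff k := .app .sub (.app .mul (x.coeff k) y.den) (.app .mul (y.coeff k) x.den)

/-- Products in `ℚ(α)`. -/
def mul (x y : FieldExpr) : FieldExpr where
  den := .app .mul (.const K.den) (.app .mul x.den y.den)
  coeff m := .sum (fun k => .sum (fun l => .app .mul (.const (K.coeff (k + l) m))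
    (.app .mul (x.coeff k) (y.coeff l))) d) d

/-- Coordinates of a vertex. -/
def coord (d r c : ℕ) : FieldExpr where
  den := .prod (fun l => .load r (2 * (c * d + l) + 1)) d
  coeff k := .app .mul (.load r (2 * (c * d + k)))
    (.prod (fun l => if l = k then .const 1 else .load r (2 * (c * d + l) + 1)) d)

/-- The test whether a number is nonzero. -/
def nonzero (d : ℕ) (x : FieldExpr) : Test := .not (.all (fun k => .isZero (x.coeff k)) d)

/-- The test whether a ratio is rational. -/
def isRatio (d : ℕ) (x y : FieldExpr) : Test :=
  .all (fun k => .all (fun l => .isZero (.app .sub (.app .mul (x.coeff k) (y.coeff l))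
    (.app .mul (x.coeff l) (y.coeff k)))) d) d

end FieldExpr

variable {env : ℕ → ℕ} {data : ℕ → ℤ} {x y : FieldExpr} {a b : ℝ}

theorem FieldRep.add (hx : FieldRep α d env data x a) (hy : FieldRep α d env data y b) :
    FieldRep α d env data (x.add y) (a + b) where
  static_den := ⟨hx.static_den, hy.static_den⟩
  static_coeff k hk := ⟨⟨hx.static_coeff k hk, hy.static_den⟩, hy.static_coeff k hk, hx.static_den⟩
  den_ne_zero := mul_ne_zero hx.den_ne_zero hy.den_ne_zero
  mul_den := by
    simp only [FieldExpr.add, Expr.eval_add, Expr.eval_mul]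
    push_cast
    simp only [add_mul, Finset.sum_add_distrib, mul_right_comm _ _ (α ^ _), ← Finset.sum_mul,
      ← hx.mul_den, ← hy.mul_den]
    ring

theorem FieldRep.sub (hx : FieldRep α d env data x a) (hy : FieldRep α d env data y b) :
    FieldRep α d env data (x.sub y) (a - b) where
  static_den := ⟨hx.static_den, hy.static_den⟩
  static_coeff k hk := ⟨⟨hx.static_coeff k hk, hy.static_den⟩, hy.static_coeff k hk, hx.static_den⟩
  den_ne_zero := mul_ne_zero hx.den_ne_zero hy.den_ne_zero
  mul_den := by
    simp only [FieldExpr.sub, Expr.eval_sub, Expr.eval_mul]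
    push_cast
    simp only [sub_mul, Finset.sum_sub_distrib, mul_right_comm _ _ (α ^ _), ← Finset.sum_mul,
      ← hx.mul_den, ← hy.mul_den]
    ring

theorem FieldRep.mul (hx : FieldRep α d env data x a) (hy : FieldRep α d env data y b) :
    FieldRep α d env data (x.mul K y) (a * b) where
  static_den := ⟨trivial, hx.static_den, hy.static_den⟩
  static_coeff m hm := Expr.static_sum fun k hk => Expr.static_sum fun l hl =>
    ⟨trivial, hx.static_coeff k hk, hy.static_coeff l hl⟩
  den_ne_zero := by
    simp only [FieldExpr.mul, Expr.eval_mul, Expr.eval_const, Int.cast_id]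
    exact mul_ne_zero K.den_ne_zero (mul_ne_zero hx.den_ne_zero hy.den_ne_zero)
  mul_den := by
    have hden : (((x.mul K y).den.eval env data : ℤ) : ℝ) =
        K.den * ((x.den.eval env data : ℤ) * (y.den.eval env data : ℤ)) := by
      simp only [FieldExpr.mul, Expr.eval_mul, Expr.eval_const, Int.cast_id]
      push_cast; rfl
    have hcoeff : ∀ m, ((((x.mul K y).coeff m).eval env data : ℤ) : ℝ) = ∑ k ∈ Finset.range d,
        ∑ l ∈ Finset.range d, (K.coeff (k + l) m : ℝ) *
          (((x.coeff k).eval env data : ℤ) * ((y.coeff l).eval env data : ℤ)) := by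
      intro m
      simp only [FieldExpr.mul, Expr.eval_sum, Expr.eval_mul, Expr.eval_const, Int.cast_id]
      push_cast; rfl
    rw [hden]
    simp only [hcoeff]
    have e : a * b * ((K.den : ℝ) * ((x.den.eval env data : ℤ) * (y.den.eval env data : ℤ))) =
        K.den * ((a * (x.den.eval env data : ℤ)) * (b * (y.den.eval env data : ℤ))) := by ring
    rw [e, hx.mul_den, hy.mul_den, Finset.sum_mul_sum, Finset.mul_sum]
    simp_rw [Finset.sum_mul]
    rw [Finset.sum_comm' (t' := Finset.range d) (s' := fun _ => Finset.range d) (by simp)]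
    refine Finset.sum_congr rfl fun k hk => ?_
    rw [Finset.sum_comm' (t' := Finset.range d) (s' := fun _ => Finset.range d) (by simp),
      Finset.mul_sum]
    refine Finset.sum_congr rfl fun l hl => ?_
    have hkl : k + l < 2 * d := by
      rw [Finset.mem_range] at hk hl; omega
    have e2 : (K.den : ℝ) * (((x.coeff k).eval env data : ℤ) * α ^ k *
        (((y.coeff l).eval env data : ℤ) * α ^ l)) = ((x.coeff k).eval env data : ℤ) *
          ((y.coeff l).eval env data : ℤ) * (K.den * α ^ (k + l)) := by ring
    rw [e2, K.den_mul_pow _ hkl, Finset.mul_sum]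
    refine Finset.sum_congr rfl fun m _ => ?_
    ring

/-- The common denominator is the product of all `d` denominators; the numerator `k` is multiplied
by the other ones, the factor `1` standing in for its own. -/
theorem fieldRep_coord {n : ℕ} {v : ZMod (2 * n) → Plane} (hv : Represents α d data v)
    {r q c : ℕ} (he : env r = q * (4 * d)) (h7 : 7 ≤ r) (hr : r < 12) (hc : c < 4)
    (h8 : r = 8 → c < 2) (hq : q * 2 + c < 4 * n) :
    FieldRep α d env data (.coord d r c) (coordSeq v (q * 2 + c)) := by
  obtain ⟨hden, hval⟩ := hv _ hq
  have addr : ∀ k, env r + 2 * (c * d + k) = 2 * ((q * 2 + c) * d + k) := by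
    intro k; rw [he]; ring
  have st : ∀ k < d, ∀ e ≤ 1, (Expr.load r (2 * (c * d + k) + e)).Static (4 * d) 12 := by
    intro k hk e he
    refine ⟨h7, hr, ?_, fun h => ?_⟩
    · have : c * d ≤ 3 * d := Nat.mul_le_mul_right _ (by omega)
      omega
    · have : c * d ≤ 1 * d := Nat.mul_le_mul_right _ (by have := h8 h; omega)
      omega
  have e1 : ∀ k, (Expr.load r (2 * (c * d + k) + 1)).eval env data =
      data (2 * ((q * 2 + c) * d + k) + 1) := fun k => by
    rw [Expr.eval, ← add_assoc, addr]
  have e0 : ∀ k, (Expr.load r (2 * (c * d + k))).eval env data =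
      data (2 * ((q * 2 + c) * d + k)) := fun k => by
    rw [Expr.eval, addr]
  refine ⟨Expr.static_prod fun l hl => st l hl 1 le_rfl, fun k hk => ⟨st k hk 0 zero_le_one,
    Expr.static_prod fun l hl => ?_⟩, ?_, ?_⟩
  · by_cases hlk : l = k
    · simp only [hlk, if_true]; trivial
    · simp only [hlk, if_false]; exact st l hl 1 le_rfl
  · simp only [FieldExpr.coord, Expr.eval_prod, e1]
    exact Finset.prod_ne_zero_iff.2 fun k hk => hden k (Finset.mem_range.1 hk)
  · simp only [FieldExpr.coord, Expr.eval_prod, Expr.eval_mul, e1, e0]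
    push_cast
    rw [hval, Finset.sum_mul]
    refine Finset.sum_congr rfl fun k hk => ?_
    have hk' : (data (2 * ((q * 2 + c) * d + k) + 1) : ℝ) ≠ 0 := by
      exact_mod_cast hden k (Finset.mem_range.1 hk)
    rw [← Finset.mul_prod_erase _ _ hk, ← Finset.mul_prod_erase _ (fun l => ((Expr.eval env data
      (if l = k then Expr.const 1 else Expr.load r (2 * (c * d + l) + 1)) : ℤ) : ℝ)) hk]
    have e2 : ∏ l ∈ (Finset.range d).erase k, ((Expr.eval env data
        (if l = k then Expr.const 1 else Expr.load r (2 * (c * d + l) + 1)) : ℤ) : ℝ) =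
        ∏ l ∈ (Finset.range d).erase k, (data (2 * ((q * 2 + c) * d + l) + 1) : ℝ) := by
      refine Finset.prod_congr rfl fun l hl => ?_
      rw [if_neg (Finset.ne_of_mem_erase hl), e1]
    rw [e2]
    simp only [if_true, Expr.eval_const, Int.cast_one, one_mul]
    field_simp

include K

theorem FieldRep.eq_zero_iff (hx : FieldRep α d env data x a) :
    a = 0 ↔ ∀ k < d, (x.coeff k).eval env data = 0 := by
  have hd : ((x.den.eval env data : ℤ) : ℝ) ≠ 0 := by exact_mod_cast hx.den_ne_zero
  constructor
  · rintro rfl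
    have := hx.mul_den
    rw [zero_mul] at this
    exact K.eq_zero_of_sum _ this.symm
  · intro h
    have := hx.mul_den
    rw [Finset.sum_eq_zero fun k hk => by rw [h k (Finset.mem_range.1 hk)]; simp] at this
    exact (mul_eq_zero.1 this).resolve_right hd

theorem FieldRep.nonzero_iff (hx : FieldRep α d env data x a) (N : ℕ) :
    (x.nonzero d).Holds integerModel N (4 * d) 12 env data ↔ a ≠ 0 := by
  rw [FieldExpr.nonzero, Test.Holds, Test.holds_all, Ne, hx.eq_zero_iff K]
  rfl

/-- As the powers of `α` are independent, a rational ratio means that the coefficient vectors are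
proportional, that is, that all two-by-two minors vanish. This needs no division in the field. -/
theorem FieldRep.isRatio_iff (hx : FieldRep α d env data x a) (hy : FieldRep α d env data y b)
    (hb : b ≠ 0) (N : ℕ) : (x.isRatio d y).Holds integerModel N (4 * d) 12 env data ↔
      ∃ q : ℚ, (q : ℝ) = a / b := by
  have hdx : ((x.den.eval env data : ℤ) : ℝ) ≠ 0 := by exact_mod_cast hx.den_ne_zero
  have hdy : ((y.den.eval env data : ℤ) : ℝ) ≠ 0 := by exact_mod_cast hy.den_ne_zero
  have ex := hx.mul_den
  have ey := hy.mul_den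
  have step : (x.isRatio d y).Holds integerModel N (4 * d) 12 env data ↔ ∀ k < d, ∀ l < d,
      (x.coeff k).eval env data * (y.coeff l).eval env data =
      (x.coeff l).eval env data * (y.coeff k).eval env data := by
    simp only [FieldExpr.isRatio, Test.holds_all, Test.Holds, Expr.eval_sub, Expr.eval_mul,
      sub_eq_zero]
  rw [step]
  constructor
  · intro h
    have hne := mt (hy.eq_zero_iff K).2 hb
    push Not at hne
    obtain ⟨l, hl, hl0⟩ := hne
    have hl0' : (((y.coeff l).eval env data : ℤ) : ℝ) ≠ 0 := by exact_mod_cast hl0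
    have e : (((y.coeff l).eval env data : ℤ) : ℝ) * (a * (x.den.eval env data : ℤ)) =
        ((x.coeff l).eval env data : ℤ) * (b * (y.den.eval env data : ℤ)) := by
      rw [ex, ey, Finset.mul_sum, Finset.mul_sum]
      refine Finset.sum_congr rfl fun k hk => ?_
      have : (((x.coeff k).eval env data : ℤ) : ℝ) * ((y.coeff l).eval env data : ℤ) =
        ((x.coeff l).eval env data : ℤ) * ((y.coeff k).eval env data : ℤ) := by
          exact_mod_cast h k (Finset.mem_range.1 hk) l hl
      linear_combination α ^ k * this
    -- The ratio is read off at an index `l` at which the coefficient of `y` is nonzero, and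
    -- corrected by the denominators.
    refine ⟨((x.coeff l).eval env data * y.den.eval env data : ℤ) /
      ((y.coeff l).eval env data * x.den.eval env data : ℤ), ?_⟩
    push_cast
    rw [div_eq_div_iff (mul_ne_zero hl0' hdx) hb]
    linear_combination -e
  · rintro ⟨q, hq⟩ k hk l hl
    rw [eq_div_iff hb] at hq
    have hqd : (q : ℝ) = q.num / q.den := by exact_mod_cast (Rat.num_div_den q).symm
    have hden : (q.den : ℝ) ≠ 0 := by exact_mod_cast q.den_ne_zero
    have hsum := K.eq_zero_of_sum (fun k => y.den.eval env data * q.den *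
      (x.coeff k).eval env data - q.num * x.den.eval env data * (y.coeff k).eval env data) (by
        push_cast
        simp only [sub_mul, Finset.sum_sub_distrib, mul_assoc, ← Finset.mul_sum, ← ex, ← ey]
        rw [← hq, hqd]
        field_simp
        ring)
    have h1 := hsum k hk
    have h2 := hsum l hl
    have hne : y.den.eval env data * (q.den : ℤ) ≠ 0 :=
      mul_ne_zero hy.den_ne_zero (by exact_mod_cast q.den_ne_zero)
    refine mul_left_cancel₀ hne ?_
    linear_combination (y.coeff l).eval env data * h1 - (y.coeff k).eval env data * h2

omit K

/-- Arithmetic in `ℚ(α)`. -/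
noncomputable def fieldArithmetic : Arithmetic integerModel (4 * d) where
  Number := FieldExpr
  add := FieldExpr.add
  sub := FieldExpr.sub
  mul := FieldExpr.mul K
  coord := FieldExpr.coord d
  nonzero := FieldExpr.nonzero d
  isRatio := FieldExpr.isRatio d
  Rep := FieldRep α d
  Valid v w := Represents α d w v
  rep_add := FieldRep.add
  rep_sub := FieldRep.sub
  rep_mul := FieldRep.mul K
  rep_coord := fun hv _ _ _ _ => fieldRep_coord hv
  static_nonzero hx := by
    rw [FieldExpr.nonzero, Test.Static]
    exact Test.static_all fun k hk => hx.static_coeff k hk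
  nonzero_iff hx := hx.nonzero_iff K
  static_isRatio hx hy := by
    rw [FieldExpr.isRatio]
    exact Test.static_all fun k hk => Test.static_all fun l hl => ⟨⟨hx.static_coeff k hk, hy.static_coeff l hl⟩, hx.static_coeff l hl, hy.static_coeff k hk⟩
  isRatio_iff hx hy := hx.isRatio_iff K hy

end NumberField

theorem le_bitLength (len : ℕ) (w : ℕ → ℤ) : len ≤ bitLength len w := by
  unfold bitLength
  calc len = ∑ _a ∈ Finset.range len, 1 := by simp
    _ ≤ _ := Finset.sum_le_sum fun a _ => by omega

theorem size_le_bitLength {len a : ℕ} (w : ℕ → ℤ) (ha : a < len) :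
    Nat.size (w a).natAbs ≤ bitLength len w := by
  unfold bitLength
  refine le_trans (Nat.le_add_left _ 1) ?_
  exact Finset.single_le_sum (f := fun a => 1 + Nat.size (w a).natAbs)
    (fun _ _ => Nat.zero_le _) (Finset.mem_range.2 ha)

theorem mainTheorem2 :
    -- the two classes, the tests for them, and the sets that the test for Class B runs through
    (∀ (n : ℕ) (v : ZMod (2 * n) → Plane), IsSymmConvexPolygon n v →
      (TilesMultiply v ↔ InClassA v ∨ InClassB v) ∧
      ¬ (InClassA v ∧ InClassB v) ∧
      (InClassA v ↔ PassesTestA v) ∧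
      (InClassB v ↔ PassesTestB v) ∧
      (∀ i j : Fin n, i ≠ j → ∃! J : Finset (Fin n), IsMaxDiscrete v J ∧ i ∈ J ∧ j ∈ J) ∧
      {J : Finset (Fin n) | IsMaxDiscrete v J}.ncard ≤ n ^ 2) ∧
    -- polynomial time over the reals with unit costs and a test for rationality
    (∃ (p : Program) (C k : ℕ),
      ∀ (n : ℕ) (v : ZMod (2 * n) → Plane), IsSymmConvexPolygon n v →
        ∃ (s : Memory ℝ) (t : ℕ),
          Runs realModel p (inputMemory n (4 * n) (coordSeq v)) s t ∧
          t ≤ C * n ^ k ∧ HoldsAnswer v s) ∧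
    -- polynomial time on integers of finite size, for polygons over a fixed number field
    (∀ α : ℝ, IsAlgebraic ℚ α →
      ∃ (p : Program) (C k : ℕ),
        ∀ (n : ℕ) (v : ZMod (2 * n) → Plane), IsSymmConvexPolygon n v →
          ∀ w : ℕ → ℤ, Represents α (minpoly ℚ α).natDegree w v →
            ∃ (s : Memory ℤ) (t : ℕ),
              Runs integerModel p
                (inputMemory n (8 * n * (minpoly ℚ α).natDegree) w) s t ∧
              t ≤ C * bitLength (8 * n * (minpoly ℚ α).natDegree) w ^ k ∧
              HoldsAnswer v s) := by
  refine ⟨fun n v h => h.classification, ?_, fun α hα => ?_⟩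
  · obtain ⟨p, C, k, hp⟩ := realArithmetic.exists_decides modest_realModel one_le_two
    -- All sizes are zero, so the bound `B` is just the number `4 * n` of input cells, whence the
    -- factor `4 ^ k`.
    refine ⟨p, C * 4 ^ k, k, fun n v h => ?_⟩
    have e : 2 * (n * 2) = 4 * n := by ring
    obtain ⟨s, t, hr, ht, hs⟩ := hp n v h (coordSeq v) rfl (4 * n) e.le
      fun a _ => Nat.zero_le _
    rw [e] at hr
    exact ⟨s, t, hr, by rwa [mul_assoc, ← mul_pow], hs⟩
  · obtain ⟨K⟩ := exists_powerTable hα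
    obtain ⟨p, C, k, hp⟩ := (fieldArithmetic K).exists_decides modest_integerModel
      (by have := K.one_le; omega)
    refine ⟨p, C, k, fun n v h w hw => ?_⟩
    have e : 2 * (n * (4 * (minpoly ℚ α).natDegree)) = 8 * n * (minpoly ℚ α).natDegree := by ring
    rw [← e]
    exact hp n v h w hw _ (le_bitLength _ w) fun a ha => size_le_bitLength w ha
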